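/- Let $N\ge 2$, $n=\lfloor N/2\rfloor$, $j'=N-j+1$, and let $q\in\mathbb C\setminus\{0\}$ be not a root of unity, with a fixed square root $q^{1/2}$. Put $(\rho_1,\dots,\rho_N)=(n-\frac12,\dots,\frac12,0,-\frac12,\dots,-n+\frac12)$ if $N=2n+1$ and $(n-1,\dots,1,0,0,-1,\dots,-n+1)$ if $N=2n$. Write $[a]=\frac{1-q^a}{1-q}$, $[a]_q=\frac{q^a-q^{-a}}{q-q^{-1}}$, $(a;p)_k=\prod_{i=0}^{k-1}(1-ap^i)$. Let $\mathcal A$ be the associative unital $\mathbb C$-algebra generated by $x_1,\dots,x_N$ with relations $x_ix_j=qx_jx_i$ for $i<j$, $i\ne j'$; $x_{i'}x_i-x_ix_{i'}=\frac{q-q^{-1}}{q^{\rho_i-1}+q^{-\rho_i+1}}\sum_{j=i+1}^{(i+1)'}q^{\rho_{j'}}x_jx_{j'}$ for $i<n$; and $x_{n'}x_n-x_nx_{n'}=(q^{1/2}-q^{-1/2})x_{n+1}^2$ if $N=2n+1$, $x_{n'}x_n=x_nx_{n'}$ if $N=2n$. The monomials $\mathbf x^\nu=x_1^{\nu_1}\cdots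 x_N^{\nu_N}$ form a basis of $\mathcal A$; $\mathcal A_m$ is the span of those with $\sum_i\nu_i=m$. Let $Q=\sum_{i=1}^Nq^{\rho_{i'}}x_ix_{i'}$. The linear operators $\partial_i$ on $\mathcal A$ are given by $\partial_k\mathbf x^\nu=[\nu_k]_q\,q^{\nu_{k+1}+\cdots+\nu_{1'}}\mathbf x^{\nu-\varepsilon_k}$ for $k\le n$; $\partial_{n+1}\mathbf x^\nu=[\nu_{n+1}]\,q^{\nu_{n'}+\cdots+\nu_{1'}}\mathbf x^{\nu-\varepsilon_{n+1}}$ if $N=2n+1$; and, for $k\le n$, $$\partial_{k'}\mathbf x^\nu=[\nu_{k'}]_q\,q^{\nu_k+\nu_{(k-1)'}+\cdots+\nu_{1'}}\mathbf x^{\nu-\varepsilon_{k'}}+\sum_{j=k+1}^n[\nu_j]_q[\nu_{j'}]_q(q-q^{-1})q^{\rho_k-\rho_j+d_{kj}}\mathbf x^{\nu+\varepsilon_k-\varepsilon_j-\varepsilon_{j'}}+[\nu_{n+1}-1][\nu_{n+1}]\frac{q-q^{-1}}{1+q}q^{\rho_k+2+e_k}\mathbf x^{\nu+\varepsilon_k-2\varepsilon_{n+1}},$$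 where $d_{kj}=\nu_k+\cdots+\nu_{j-1}+\nu_{(j-1)'}+\cdots+\nu_{1'}$, $e_k=(\nu_k+\cdots+\nu_{1'})-2\nu_{n+1}$, and the last summand is omitted if $N=2n$. Put $\Delta_q=\sum_{i=1}^Nq^{\rho_i}\partial_i\partial_{i'}$, $\Delta_q^{(N-2)}=\sum_{i=2}^{N-1}q^{\rho_i}\partial_i\partial_{i'}$, $\mathcal H_m=\{p\in\mathcal A_m:\Delta_qp=0\}$, and let $\mathcal H^{(N-2)}_l$ be the space of $p\in\mathcal A_l$ which lie in the subalgebra generated by $x_2,\dots,x_{2'}$ and satisfy $\Delta_q^{(N-2)}p=0$. For $m_1,m_1'\ge0$ with $l=m-m_1-m_1'\ge0$ put $$t^{N,m}_{m_1m_1'}=\sum_{k=0}^{\min(m_1,m_1')}\frac{(q^{-2m_1};q^2)_k(q^{-2m_1'};q^2)_k}{(q^2;q^2)_k(q^{-N-2m+4};q^2)_k}\,\frac{q^{(-\rho_1-2l+2)k}}{(1+q^{N-2})^k}\;Q^kx_1^{m_1-k}x_{1'}^{m_1'-k}.$$ Let $h$ be the linear functional on $\mathcal A$ (the invariant functional of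 the quantum sphere, composed with the canonical map $\mathcal A\to\mathcal A/(Q-1)$) which vanishes on $\mathbf x^\nu$ unless $\nu_i=\nu_{i'}$ for $i\le n$ and, if $N=2n+1$, $\nu_{n+1}=2s$ is even, and which in that case has the value $$h(\mathbf x^\nu)=\frac{(q^{-2};q^{-2})_{\nu_1}\cdots(q^{-2};q^{-2})_{\nu_n}(q^{-1};q^{-2})_s(1+q)^s}{q^{\rho_1\nu_1+\cdots+\rho_n\nu_n+s}(1+q^{N-2})^{\nu_1+\cdots+\nu_n+s}(q^{-N};q^{-2})_{\nu_1+\cdots+\nu_n+s}},$$ with $s=0$ if $N=2n$. Let $\langle a,b\rangle=h(a^*b)$, where $*$ is the algebra anti-automorphism of $\mathcal A$ with $x_i^*=q^{\rho_{i'}}x_{i'}$, either the linear one (for every $q$) or the conjugate-linear one (which exists if $q$ is real and, for odd $N$, $q^{1/2}$ is real). Then for every $m\ge0$ $$\mathcal H_m=\bigoplus_{m_1,m_1'\ge0,\;m-m_1-m_1'\ge0}t^{N,m}_{m_1m_1'}\,\mathcal H^{(N-2)}_{m-m_1-m_1'},$$ the sum is direct, and different summands are orthogonal with respect to $\langle\cdot,\cdot\rangle$.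 -/

import Mathlib

open Finset

noncomputable section

namespace QEuclid

/-! Conventions: `r` is a fixed square root of the deformation parameter, so `q = r ^ 2` and
`q ^ (e / 2) = r ^ e` for an integer `e`. The generators `x_1, …, x_N` are indexed by `Fin N`, from
`0` on; the index `j' = N - j + 1` of the usual convention is `Fin.rev j`, and `n = N / 2`. -/

/-- Twice the number `ρ_i`, where `(ρ_1, …, ρ_N) = (n - 1/2, …, 1/2, 0, -1/2, …, -n + 1/2)` for
`N = 2 n + 1` and `(n - 1, …, 1, 0, 0, -1, …, -n + 1)` for `N = 2 n`. -/
def rhoTwo (N : ℕ) (i : Fin N) : ℤ :=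
  if i < i.rev then (N : ℤ) - 2 - 2 * (i : ℤ)
  else if i = i.rev then 0
  else (N : ℤ) - 2 * (i : ℤ)

/-- The `q`-number `[a] = (1 - q ^ a) / (1 - q)`. -/
def brk (q : ℂ) (a : ℤ) : ℂ := (1 - q ^ a) / (1 - q)

/-- The `q`-number `[a]_q = (q ^ a - q ^ (-a)) / (q - q⁻¹)`. -/
def brkSym (q : ℂ) (a : ℤ) : ℂ := (q ^ a - q ^ (-a)) / (q - q⁻¹)

/-- The `q`-shifted factorial `(a; p)_k = (1 - a) (1 - a p) ⋯ (1 - a p ^ (k - 1))`. -/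
def qPoch (a p : ℂ) (k : ℕ) : ℂ := ∏ i ∈ range k, (1 - a * p ^ i)

/-! ### The algebra of polynomials on the quantum Euclidean space -/

/-- The defining relations of the algebra of polynomials on the quantum Euclidean space. -/
inductive Rel (N : ℕ) (r : ℂ) : FreeAlgebra ℂ (Fin N) → FreeAlgebra ℂ (Fin N) → Prop
  | qComm (i j : Fin N) (hij : i < j) (hj : i ≠ j.rev) :
      Rel N r (FreeAlgebra.ι ℂ i * FreeAlgebra.ι ℂ j)
        (r ^ 2 • (FreeAlgebra.ι ℂ j * FreeAlgebra.ι ℂ i))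
  | cross (i : Fin N) (hi : (i : ℕ) + 1 < N / 2) :
      Rel N r
        (FreeAlgebra.ι ℂ i.rev * FreeAlgebra.ι ℂ i - FreeAlgebra.ι ℂ i * FreeAlgebra.ι ℂ i.rev)
        (((r ^ 2 - (r ^ 2)⁻¹) / (r ^ (rhoTwo N i - 2) + r ^ (-rhoTwo N i + 2))) •
          ∑ j ∈ Ioo i i.rev,
            r ^ rhoTwo N j.rev • (FreeAlgebra.ι ℂ j * FreeAlgebra.ι ℂ j.rev))
  | crossOdd (i c : Fin N) (hi : (i : ℕ) + 1 = N / 2) (hc : c = c.rev) :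
      Rel N r
        (FreeAlgebra.ι ℂ i.rev * FreeAlgebra.ι ℂ i - FreeAlgebra.ι ℂ i * FreeAlgebra.ι ℂ i.rev)
        ((r - r⁻¹) • (FreeAlgebra.ι ℂ c * FreeAlgebra.ι ℂ c))
  | crossEven (i : Fin N) (hi : (i : ℕ) + 1 = N / 2) (hN : Even N) :
      Rel N r (FreeAlgebra.ι ℂ i.rev * FreeAlgebra.ι ℂ i)
        (FreeAlgebra.ι ℂ i * FreeAlgebra.ι ℂ i.rev)

/-- The algebra `𝒜 = ℂ_q[x_1, …, x_N]`: the associative unital algebra with generators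
`x_1, …, x_N` and the relations `Rel`. -/
abbrev Alg (N : ℕ) (r : ℂ) : Type := RingQuot (Rel N r)

/-- The generator `x_i`. -/
def x (N : ℕ) (r : ℂ) (i : Fin N) : Alg N r :=
  RingQuot.mkAlgHom ℂ (Rel N r) (FreeAlgebra.ι ℂ i)

/-- The ordered monomial `x_1 ^ ν_1 * x_2 ^ ν_2 * ⋯ * x_N ^ ν_N`. -/
def mono (N : ℕ) (r : ℂ) (ν : Fin N → ℕ) : Alg N r :=
  (List.ofFn fun i => x N r i ^ ν i).prod

/-- The linear map from formal combinations of exponent vectors to `𝒜` with `ν ↦ x ^ ν`. -/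
def evalMono (N : ℕ) (r : ℂ) : ((Fin N → ℕ) →₀ ℂ) →ₗ[ℂ] Alg N r :=
  Finsupp.linearCombination ℂ (mono N r)

/-- The coordinates of an element of `𝒜` in the basis of ordered monomials: the inverse of
`evalMono`, which is bijective for `q` nonzero and not a root of unity. -/
def coords (N : ℕ) (r : ℂ) : Alg N r →ₗ[ℂ] ((Fin N → ℕ) →₀ ℂ) :=
  (evalMono N r).leftInverse

/-- The linear map on `𝒜` with prescribed values `f ν` on the ordered monomials `x ^ ν`. -/
def onMono (N : ℕ) (r : ℂ) {M : Type} [AddCommGroup M] [Module ℂ M] (f : (Fin N → ℕ) → M) :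
    Alg N r →ₗ[ℂ] M :=
  Finsupp.linearCombination ℂ f ∘ₗ coords N r

/-- The subspace `𝒜_m` of homogeneous polynomials of degree `m`. -/
def homog (N : ℕ) (r : ℂ) (m : ℕ) : Submodule ℂ (Alg N r) :=
  Submodule.span ℂ {a | ∃ ν : Fin N → ℕ, ∑ i, ν i = m ∧ a = mono N r ν}

/-- The squared `q`-radius `Q = ∑_i q ^ ρ_{i'} x_i x_{i'}`. -/
def radius (N : ℕ) (r : ℂ) : Alg N r :=
  ∑ i : Fin N, r ^ rhoTwo N i.rev • (x N r i * x N r i.rev)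

/-! ### Differential operators and the `q`-Laplace operator -/

/-- The value `∂_k x ^ ν`. The first two cases are `k < k'` and `k = k'`. In the third case
`k = l'` with `l < l'`, the first sum is over `j` with `l < j ≤ n`, and the last sum has one
term, the index `c = n + 1`, if `N = 2 n + 1` and is empty if `N = 2 n`. (Whenever a difference of
exponents is negative, the coefficient in front of it vanishes.) -/
def partialMono (N : ℕ) (r : ℂ) (k : Fin N) (ν : Fin N → ℕ) : Alg N r :=
  let q := r ^ 2
  let l := k.rev
  if k < l then
    (brkSym q (ν k) * q ^ (∑ i ∈ Ioi k, ν i)) • mono N r (ν - Pi.single k 1)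
  else if k = l then
    (brk q (ν k) * q ^ (∑ i ∈ Ioi k, ν i)) • mono N r (ν - Pi.single k 1)
  else
    (brkSym q (ν k) * q ^ (ν l + ∑ i ∈ Ioi k, ν i)) • mono N r (ν - Pi.single k 1)
    + ∑ j : Fin N with l < j ∧ j < j.rev,
        (brkSym q (ν j) * brkSym q (ν j.rev) * (q - q⁻¹) * r ^ (rhoTwo N l - rhoTwo N j)
          * q ^ ((∑ i ∈ Ico l j, ν i) + ∑ i ∈ Ioi j.rev, ν i)) •
          mono N r (ν + Pi.single l 1 - Pi.single j 1 - Pi.single j.rev 1)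
    + ∑ c : Fin N with c = c.rev,
        (brk q ((ν c : ℤ) - 1) * brk q (ν c) * ((q - q⁻¹) / (1 + q)) * r ^ (rhoTwo N l + 4)
          * q ^ ((∑ i ∈ Ici l, ν i : ℕ) - 2 * (ν c : ℤ))) •
          mono N r (ν + Pi.single l 1 - 2 • Pi.single c 1)

/-- The differential operator `∂_k` on `𝒜`. -/
def partialOp (N : ℕ) (r : ℂ) (k : Fin N) : Alg N r →ₗ[ℂ] Alg N r :=
  onMono N r (partialMono N r k)

/-- The `q`-Laplace operator `Δ_q = ∑_i q ^ ρ_i ∂_i ∂_{i'}`. -/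
def laplace (N : ℕ) (r : ℂ) : Alg N r →ₗ[ℂ] Alg N r :=
  ∑ i : Fin N, r ^ rhoTwo N i • (partialOp N r i ∘ₗ partialOp N r i.rev)

/-- The space `ℋ_m` of homogeneous `q`-harmonic polynomials of degree `m`. -/
def harm (N : ℕ) (r : ℂ) (m : ℕ) : Submodule ℂ (Alg N r) :=
  homog N r m ⊓ LinearMap.ker (laplace N r)

/-- The inner indices `2, …, 2' = N - 1`. -/
def innerIdx (N : ℕ) : Finset (Fin N) :=
  univ.filter fun i => 0 < (i : ℕ) ∧ (i : ℕ) + 1 < N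

/-- The subalgebra `𝒜^{(N-2)} = ℂ_q[x_2, …, x_{2'}]` of `𝒜`. -/
def innerAlg (N : ℕ) (r : ℂ) : Subalgebra ℂ (Alg N r) :=
  Algebra.adjoin ℂ (x N r '' (innerIdx N : Set (Fin N)))

/-- The operator `Δ_q^{(N-2)}`, the sum of `q ^ ρ_i ∂_i ∂_{i'}` over `i = 2, …, 2'`. -/
def innerLaplace (N : ℕ) (r : ℂ) : Alg N r →ₗ[ℂ] Alg N r :=
  ∑ i ∈ innerIdx N, r ^ rhoTwo N i • (partialOp N r i ∘ₗ partialOp N r i.rev)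

/-- The space `ℋ^{(N-2)}_l` of homogeneous `Δ_q^{(N-2)}`-harmonic polynomials of degree `l` in
`x_2, …, x_{2'}`. -/
def innerHarm (N : ℕ) (r : ℂ) (l : ℕ) : Submodule ℂ (Alg N r) :=
  homog N r l ⊓ Subalgebra.toSubmodule (innerAlg N r) ⊓ LinearMap.ker (innerLaplace N r)

/-! ### The scalar product -/

/-- `σ` fixes `q`, and it fixes `q ^ (1/2)` if `N` is odd (so that it fixes every `q ^ ρ_i`). For
`σ` the complex conjugation this says that `q` is real, and positive if `N` is odd; for `σ` the
identity it always holds. -/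
def Fixes (N : ℕ) (r : ℂ) (σ : ℂ →+* ℂ) : Prop :=
  σ (r ^ 2) = r ^ 2 ∧ (Odd N → σ r = r)

theorem rhoTwo_rev {N : ℕ} (i : Fin N) : rhoTwo N i.rev = -rhoTwo N i := by
  have h : (i : ℕ) + (i.rev : ℕ) + 1 = N := by
    have := i.isLt
    rw [Fin.val_rev]; omega
  simp only [rhoTwo, Fin.rev_rev, Fin.lt_def, Fin.ext_iff]
  split_ifs <;> omega

theorem rhoTwo_even {N : ℕ} (hN : Even N) (i : Fin N) : Even (rhoTwo N i) := by
  obtain ⟨a, ha⟩ := hN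
  have h : (i : ℕ) + (i.rev : ℕ) + 1 = N := by
    have := i.isLt
    rw [Fin.val_rev]; omega
  rw [Int.even_iff]
  simp only [rhoTwo, Fin.lt_def, Fin.ext_iff]
  split_ifs <;> omega

theorem Fixes.rho {N : ℕ} {r : ℂ} {σ : ℂ →+* ℂ} (h : Fixes N r σ) (i : Fin N) :
    σ (r ^ rhoTwo N i) = r ^ rhoTwo N i := by
  rcases Nat.even_or_odd N with hN | hN
  · obtain ⟨a, ha⟩ := rhoTwo_even hN i
    have : r ^ rhoTwo N i = (r ^ 2) ^ a := by
      rw [ha, ← two_mul, zpow_mul]; norm_cast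
    rw [this, map_zpow₀, h.1]
  · rw [map_zpow₀, h.2 hN]

/-- The ring homomorphism from the free algebra which is `φ` on scalars and `f` on generators. -/
def freeLift {X B : Type} [Ring B] (φ : ℂ →+* B) (hφ : ∀ c b, φ c * b = b * φ c) (f : X → B) :
    FreeAlgebra ℂ X →+* B :=
  letI : Algebra ℂ B := φ.toAlgebra' hφ
  (FreeAlgebra.lift ℂ f).toRingHom

theorem freeLift_ι {X B : Type} [Ring B] (φ : ℂ →+* B) (hφ : ∀ c b, φ c * b = b * φ c)
    (f : X → B) (i : X) : freeLift φ hφ f (FreeAlgebra.ι ℂ i) = f i :=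
  letI : Algebra ℂ B := φ.toAlgebra' hφ
  FreeAlgebra.lift_ι_apply f i

theorem freeLift_algebraMap {X B : Type} [Ring B] (φ : ℂ →+* B)
    (hφ : ∀ c b, φ c * b = b * φ c) (f : X → B) (c : ℂ) :
    freeLift φ hφ f (algebraMap ℂ _ c) = φ c :=
  letI : Algebra ℂ B := φ.toAlgebra' hφ
  (FreeAlgebra.lift ℂ f).commutes c

/-- On the free algebra: the `σ`-semilinear anti-multiplicative map with
`x_i ↦ q ^ ρ_{i'} x_{i'}`, valued in `𝒜`. -/
def starFree (N : ℕ) (r : ℂ) (σ : ℂ →+* ℂ) : FreeAlgebra ℂ (Fin N) →+* (Alg N r)ᵐᵒᵖ :=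
  freeLift ((algebraMap ℂ (Alg N r)ᵐᵒᵖ).comp σ) (fun c b => Algebra.commutes (σ c) b)
    (fun i => MulOpposite.op (r ^ rhoTwo N i.rev • x N r i.rev))

theorem starFree_ι (N : ℕ) (r : ℂ) (σ : ℂ →+* ℂ) (i : Fin N) :
    starFree N r σ (FreeAlgebra.ι ℂ i) = MulOpposite.op (r ^ rhoTwo N i.rev • x N r i.rev) :=
  freeLift_ι _ _ _ i

theorem starFree_smul (N : ℕ) (r : ℂ) (σ : ℂ →+* ℂ) (c : ℂ) (w : FreeAlgebra ℂ (Fin N)) :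
    starFree N r σ (c • w) = σ c • starFree N r σ w := by
  have h : starFree N r σ (algebraMap ℂ _ c) = algebraMap ℂ (Alg N r)ᵐᵒᵖ (σ c) :=
    freeLift_algebraMap _ _ _ c
  rw [Algebra.smul_def, map_mul, h, Algebra.smul_def]

theorem x_rel {N : ℕ} {r : ℂ} {a b : FreeAlgebra ℂ (Fin N)} (h : Rel N r a b) :
    RingQuot.mkAlgHom ℂ (Rel N r) a = RingQuot.mkAlgHom ℂ (Rel N r) b :=
  RingQuot.mkAlgHom_rel ℂ h

theorem starFree_mul_rev {N : ℕ} {r : ℂ} (hr : r ≠ 0) (σ : ℂ →+* ℂ) (i : Fin N) :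
    starFree N r σ (FreeAlgebra.ι ℂ i * FreeAlgebra.ι ℂ i.rev) =
      MulOpposite.op
        (RingQuot.mkAlgHom ℂ (Rel N r) (FreeAlgebra.ι ℂ i * FreeAlgebra.ι ℂ i.rev)) := by
  rw [map_mul, starFree_ι, starFree_ι, ← MulOpposite.op_mul, Fin.rev_rev, smul_mul_smul_comm,
    rhoTwo_rev, ← zpow_add₀ hr, map_mul]
  simp [x]

theorem starFree_rel {N : ℕ} {r : ℂ} (hr : r ≠ 0) {σ : ℂ →+* ℂ} (hσ : Fixes N r σ)
    ⦃a b : FreeAlgebra ℂ (Fin N)⦄ (h : Rel N r a b) : starFree N r σ a = starFree N r σ b := by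
  have hrev : ∀ i : Fin N, starFree N r σ (FreeAlgebra.ι ℂ i.rev * FreeAlgebra.ι ℂ i) =
      MulOpposite.op
        (RingQuot.mkAlgHom ℂ (Rel N r) (FreeAlgebra.ι ℂ i.rev * FreeAlgebra.ι ℂ i)) := by
    intro i
    have := starFree_mul_rev hr σ i.rev
    rwa [Fin.rev_rev] at this
  have hh := x_rel h
  cases h with
  | qComm i j hij hj =>
    have hlt : j.rev < i.rev := Fin.rev_lt_rev.mpr hij
    have hne : j.rev ≠ i.rev.rev := by rw [Fin.rev_rev]; exact fun e => hj e.symm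
    have key := x_rel (Rel.qComm (r := r) j.rev i.rev hlt hne)
    rw [map_mul, map_smul, map_mul] at key
    rw [starFree_smul, map_mul, map_mul, starFree_ι, starFree_ι, hσ.1, ← MulOpposite.op_mul,
      ← MulOpposite.op_mul, ← MulOpposite.op_smul, smul_mul_smul_comm, smul_mul_smul_comm]
    congr 1
    simp only [x]
    rw [key, smul_comm, mul_comm (r ^ rhoTwo N j.rev)]
  | cross i hi =>
    have hc : σ ((r ^ 2 - (r ^ 2)⁻¹) / (r ^ (rhoTwo N i - 2) + r ^ (-rhoTwo N i + 2))) =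
        (r ^ 2 - (r ^ 2)⁻¹) / (r ^ (rhoTwo N i - 2) + r ^ (-rhoTwo N i + 2)) := by
      have h2 : σ (r ^ (2 : ℤ)) = r ^ (2 : ℤ) := by exact_mod_cast hσ.1
      have h3 : σ (r ^ (-rhoTwo N i)) = r ^ (-rhoTwo N i) := by
        rw [← rhoTwo_rev]; exact hσ.rho _
      rw [zpow_sub₀ hr, zpow_add₀ hr]
      simp only [map_div₀, map_sub, map_add, map_mul, map_inv₀, hσ.1, h2, h3, hσ.rho]
    rw [map_sub, hrev, starFree_mul_rev hr, starFree_smul, hc, map_sum]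
    rw [← MulOpposite.op_sub, ← map_sub, hh]
    rw [map_smul, map_sum, MulOpposite.op_smul, Finset.op_sum]
    congr 1
    refine Finset.sum_congr rfl fun j _ => ?_
    rw [starFree_smul, hσ.rho, starFree_mul_rev hr, map_smul, MulOpposite.op_smul]
  | crossOdd i c hi hc =>
    have hodd : Odd N := by
      have h1 := congrArg Fin.val hc
      have := c.isLt
      rw [Fin.val_rev] at h1
      exact ⟨c, by omega⟩
    have hcc := starFree_mul_rev hr σ c
    rw [← hc] at hcc
    rw [map_sub, hrev, starFree_mul_rev hr, starFree_smul, hcc, ← MulOpposite.op_sub, ← map_sub,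
      hh, map_sub, map_inv₀, hσ.2 hodd, map_smul, MulOpposite.op_smul]
  | crossEven i hi hN =>
    rw [hrev, starFree_mul_rev hr, hh]

/-- The `*`-operation of `𝒜`: the `σ`-semilinear algebra anti-automorphism, written as a ring
homomorphism to the opposite ring, which maps `x_i` to `q ^ ρ_{i'} x_{i'}`. -/
def starHom (N : ℕ) {r : ℂ} (hr : r ≠ 0) {σ : ℂ →+* ℂ} (hσ : Fixes N r σ) :
    Alg N r →+* (Alg N r)ᵐᵒᵖ :=
  RingQuot.lift ⟨starFree N r σ, starFree_rel hr hσ⟩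

/-- The value on `x ^ ν` of the invariant functional of the quantum sphere, that is, `h (τ x ^ ν)`
for the canonical map `τ` from `𝒜` to its quotient by the ideal generated by `Q - 1`. Here `k` is
`ν_{n+1} / 2` if `N = 2 n + 1` and `0` if `N = 2 n`, and `t = ν_1 + ⋯ + ν_n + k`. -/
def haarMono (N : ℕ) (r : ℂ) (ν : Fin N → ℕ) : ℂ :=
  open Classical in
  let q := r ^ 2
  let k := ∑ c : Fin N with c = c.rev, ν c / 2
  let t := (∑ i : Fin N with i < i.rev, ν i) + k
  if (∀ i : Fin N, ν i = ν i.rev) ∧ ∀ c : Fin N, c = c.rev → Even (ν c) then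
    ((∏ i : Fin N with i < i.rev, qPoch (q ^ (-2 : ℤ)) (q ^ (-2 : ℤ)) (ν i))
        * qPoch q⁻¹ (q ^ (-2 : ℤ)) k * (1 + q) ^ k) /
      (r ^ ((∑ i : Fin N with i < i.rev, rhoTwo N i * ν i) + 2 * k)
        * (1 + q ^ ((N : ℤ) - 2)) ^ t * qPoch (q ^ (-(N : ℤ))) (q ^ (-2 : ℤ)) t)
  else 0

/-- The invariant functional of the quantum sphere, composed with the canonical map `τ` from `𝒜`
to the algebra of functions on the quantum sphere. -/
def haar (N : ℕ) (r : ℂ) : Alg N r →ₗ[ℂ] ℂ := onMono N r (haarMono N r)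

/-- The scalar product `⟨a, b⟩ = h ((τ a)^* (τ b)) = h (τ (a^* b))`. -/
def scalarProd (N : ℕ) {r : ℂ} (hr : r ≠ 0) {σ : ℂ →+* ℂ} (hσ : Fixes N r σ)
    (a b : Alg N r) : ℂ :=
  haar N r ((starHom N hr hσ a).unop * b)

/-! ### The polynomials `t^{N,m}_{m_1 m_1'}` and the summands of the decomposition -/

/-- The coefficient `C^{m,k}_{m_1 m_1'}` of `t^{N,m}_{m_1 m_1'}`, where `l = m - m_1 - m_1'`; note
`q ^ (- n + ε) = q ^ (- ρ_1) = r ^ (2 - N)` for both parities of `N`. -/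
def tCoeff (N : ℕ) (r : ℂ) (m a b k : ℕ) : ℂ :=
  let q := r ^ 2
  let l : ℤ := (m : ℤ) - a - b
  qPoch (q ^ (-2 * (a : ℤ))) (q ^ 2) k * qPoch (q ^ (-2 * (b : ℤ))) (q ^ 2) k
    / (qPoch (q ^ 2) (q ^ 2) k * qPoch (q ^ (-(N : ℤ) - 2 * m + 4)) (q ^ 2) k)
    * (r ^ ((2 - (N : ℤ) - 4 * l + 4) * k) / (1 + q ^ ((N : ℤ) - 2)) ^ k)

/-- The polynomial `t^{N,m}_{a b} = ∑_k C^{m,k}_{a b} Q ^ k x_1 ^ (a - k) x_{1'} ^ (b - k)`. -/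
def tPoly {N : ℕ} (hN : 2 ≤ N) (r : ℂ) (m a b : ℕ) : Alg N r :=
  let first : Fin N := ⟨0, by omega⟩
  ∑ k ∈ range (min a b + 1),
    tCoeff N r m a b k • (radius N r ^ k * x N r first ^ (a - k) * x N r first.rev ^ (b - k))

/-- The subspace `t^{N,m}_{a b} ℋ^{(N-2)}_{m-a-b}` (for `a + b ≤ m`). -/
def summand {N : ℕ} (hN : 2 ≤ N) (r : ℂ) (m a b : ℕ) : Submodule ℂ (Alg N r) :=
  (innerHarm N r (m - a - b)).map (LinearMap.mulLeft ℂ (tPoly hN r m a b))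

end QEuclid

end

noncomputable section

namespace QEuclid

/-! Everything is a recursion from `N` to `N + 2`. The algebra for `N + 2` is the direct sum of the
spaces `x_1 ^ a 𝒜' x_{1'} ^ b`, where `𝒜'`, generated by the inner variables, is a copy of the
algebra for `N` (`decEquiv`; the summands are the images of `tri a b`). Primes mark the objects of
`𝒜'`. In place of `Δ_q` one uses `L = lap`: by `laplace_eq`, `Δ_q` is a nonzero constant times `L
θ`, with `θ` the grading automorphism `x_i ↦ q x_i`, so both have the same kernel in each degree. By
`lap_tri`, `L` sends `x_1 ^ a f x_{1'} ^ b` to a multiple of `x_1 ^ (a-1) f x_{1'} ^ (b-1)`, nonzero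
scalar if `a, b > 0`, plus `q ^ (a+b) x_1 ^ a (L' f) x_{1'} ^ b`. By `lap_radius_mul`, the
commutator of `L` with the central element `Q` is a scalar on each degree.

Decomposition. If `L p = 0`, then `lap_tri` determines the component of `p` at `(i+1, j+1)` from the
one at `(i, j)`; so `p` is determined by its boundary components, those with `i = 0` or `j = 0`
(`eq_zero_of_boundary`). On the boundary, multiplication by `Q` is a nonzero multiple of
multiplication by `Q'`. Hence `t_{ab} h` has at most one nonzero boundary component, a nonzero
multiple of `Q' ^ min(a,b) h` at the place `(a - min(a,b), b - min(a,b))` (`comp_tPoly_mul_emb`). It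
is harmonic because the coefficients of `t` solve the two-term recursion which makes `L (t h)`
telescope (`tExp_recursion`). The theorem thereby becomes the decomposition `f = ∑ Q' ^ s h_s`, with
`h_s` harmonic, of each boundary component (`exists_harmonic_decomposition`,
`radius_pow_mul_eq_zero_of_sum`), which follows from the commutator of `L` and `Q`.

Orthogonality. If `u` and `v` lie in the summands of `(a, b)` and `(a', b')` and come from `h` and
`h'`, then `u^* v` is a combination of elements `x_1 ^ c Q' ^ s (h^* h') x_{1'} ^ d` with `c - d =
(a' - b') - (a - b)` (`triSpan`). The functional kills these if `c ≠ d`. If `a - b = a' - b'` for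
distinct pairs, then `h` and `h'` have different degrees, and it remains to see that the inner
functional kills `Q' ^ s h^* h'`. Two facts give this: each generator satisfies a `q`-Serre relation
with `L` (`lap_serre`), so left multiplication by a polynomial of degree `d` raises the order of
nilpotency under `L` by at most `d`; and in nonzero degree the functional factors through `L`
(`haarRed_lap`), so it kills elements annihilated by few enough powers of `L`. -/

/-- The parameter `q = r ^ 2` is nonzero and not a root of unity. -/
class Generic (r : ℂ) : Prop where
  ne_zero : r ≠ 0
  not_root : ∀ k : ℕ, 0 < k → (r ^ 2) ^ k ≠ 1

/-! ### Nonvanishing of the scalars -/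

section Scalars

variable (r : ℂ) [hg : Generic r]

theorem r_ne : r ≠ 0 := hg.ne_zero

theorem q_ne : r ^ 2 ≠ 0 := pow_ne_zero _ hg.ne_zero

theorem r_zpow_ne_one {k : ℤ} (hk : k ≠ 0) : r ^ k ≠ 1 := by
  have nat : ∀ n : ℕ, 0 < n → r ^ n ≠ 1 := fun n hn h =>
    hg.not_root n hn (by rw [← pow_mul, mul_comm, pow_mul, h, one_pow])
  obtain ⟨n, rfl | rfl⟩ := Int.eq_nat_or_neg k
  · rw [zpow_natCast]; exact nat n (by omega)
  · rw [zpow_neg, zpow_natCast]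
    exact fun h => nat n (by omega) (inv_eq_one.mp h)

theorem r_zpow_inj {a b : ℤ} (h : r ^ a = r ^ b) : a = b := by
  by_contra hne
  refine r_zpow_ne_one r (sub_ne_zero.mpr hne) ?_
  rw [zpow_sub₀ (r_ne r), h, div_self (zpow_ne_zero _ (r_ne r))]

/-- Squaring `r ^ a = -r ^ b` forces `a = b`, and then `2 r ^ a = 0`. Denominators such as `1 + q ^
(N-2)` are nonzero for this reason. -/
theorem r_zpow_add_ne_zero (a b : ℤ) : r ^ a + r ^ b ≠ 0 := by
  intro h
  have h1 : r ^ a = -r ^ b := eq_neg_of_add_eq_zero_left h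
  have h2 : r ^ (a * 2) = r ^ (b * 2) := by
    rw [zpow_mul, zpow_mul, h1]; norm_num
  obtain rfl : a = b := by have := r_zpow_inj r h2; omega
  have h3 : (2 : ℂ) * r ^ a = 0 := by rw [two_mul]; exact h
  exact zpow_ne_zero a (r_ne r) (by simpa using h3)

theorem r_sq_add_one_ne : r ^ 2 + 1 ≠ 0 := by
  simpa using r_zpow_add_ne_zero r 2 0

theorem r_sq_sub_one_ne : r ^ 2 - 1 ≠ 0 := by
  simpa [sub_eq_zero] using r_zpow_ne_one r (k := 2) (by norm_num)

theorem r_four_sub_one_ne : r ^ 4 - 1 ≠ 0 := by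
  have h : r ^ (4 : ℤ) ≠ 1 := r_zpow_ne_one r (k := 4) (by norm_num)
  exact sub_ne_zero.mpr (by exact_mod_cast h)

theorem q_sub_inv_ne : r ^ 2 - (r ^ 2)⁻¹ ≠ 0 := by
  have h0 := r_ne r
  have h := r_four_sub_one_ne r
  have : r ^ 2 - (r ^ 2)⁻¹ = (r ^ 4 - 1) / r ^ 2 := by field_simp
  rw [this]; exact div_ne_zero h (q_ne r)

end Scalars

/-! ### Presentations -/

section Presentation

variable {N : ℕ} {r : ℂ}

theorem alg_induction {C : Alg N r → Prop} (algebraMap : ∀ c, C (algebraMap ℂ _ c))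
    (gen : ∀ i, C (x N r i)) (mul : ∀ a b, C a → C b → C (a * b))
    (add : ∀ a b, C a → C b → C (a + b)) (p : Alg N r) : C p := by
  obtain ⟨w, rfl⟩ := RingQuot.mkAlgHom_surjective ℂ (Rel N r) p
  induction w using FreeAlgebra.induction with
  | grade0 c => simpa using algebraMap c
  | grade1 i => exact gen i
  | mul a b ha hb => rw [map_mul]; exact mul _ _ ha hb
  | add a b ha hb => rw [map_add]; exact add _ _ ha hb

theorem algHom_ext {B : Type} [Ring B] [Algebra ℂ B] {f g : Alg N r →ₐ[ℂ] B}
    (h : ∀ i, f (x N r i) = g (x N r i)) : f = g := by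
  refine AlgHom.ext fun p => ?_
  induction p using alg_induction with
  | algebraMap c => simp
  | gen i => exact h i
  | mul a b ha hb => rw [map_mul, map_mul, ha, hb]
  | add a b ha hb => rw [map_add, map_add, ha, hb]

/-- The coefficient of the relation between `x_i` and `x_{i'}`. -/
def crossCoeff (r : ℂ) (e : ℤ) : ℂ := (r ^ 2 - (r ^ 2)⁻¹) / (r ^ (e - 2) + r ^ (-e + 2))

/-- The tuple `f` satisfies the relations of the generators of `𝒜`, in a uniform form. -/
structure SatRel (N : ℕ) (r : ℂ) {B : Type} [Ring B] [Algebra ℂ B] (f : Fin N → B) : Prop where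
  comm : ∀ i j, i < j → i ≠ j.rev → f i * f j = r ^ 2 • (f j * f i)
  cross : ∀ i, i < i.rev → f i.rev * f i - f i * f i.rev =
    crossCoeff r (rhoTwo N i) • ∑ j ∈ Ioo i i.rev, r ^ rhoTwo N j.rev • (f j * f j.rev)

theorem crossCoeff_one [Generic r] : crossCoeff r 1 = r - r⁻¹ := by
  have h0 := r_ne r
  have h1 := r_sq_add_one_ne r
  have : r ^ ((1 : ℤ) - 2) + r ^ (-(1 : ℤ) + 2) = (r ^ 2 + 1) / r := by
    norm_num
    field_simp
    ring
  rw [crossCoeff, this]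
  field_simp
  ring

theorem Ioo_rev_odd {i c : Fin N} (hi : (i : ℕ) + 1 = N / 2) (hc : c = c.rev) :
    Ioo i i.rev = {c} := by
  have h1 := congrArg Fin.val hc
  rw [Fin.val_rev] at h1
  ext j
  simp only [mem_Ioo, mem_singleton, Fin.lt_def, Fin.val_rev, Fin.ext_iff]
  omega

theorem Ioo_rev_even {i : Fin N} (hi : (i : ℕ) + 1 = N / 2) (hN : Even N) :
    Ioo i i.rev = ∅ := by
  obtain ⟨a, ha⟩ := hN
  ext j
  simp only [mem_Ioo, Fin.lt_def, Fin.val_rev, notMem_empty, iff_false]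
  omega

theorem rhoTwo_eq_one {i c : Fin N} (hi : (i : ℕ) + 1 = N / 2) (hc : c = c.rev) :
    rhoTwo N i = 1 := by
  have h1 := congrArg Fin.val hc
  rw [Fin.val_rev] at h1
  simp only [rhoTwo, Fin.lt_def, Fin.val_rev, Fin.ext_iff]
  split_ifs <;> omega

theorem rhoTwo_self {c : Fin N} (hc : c = c.rev) : rhoTwo N c = 0 := by
  simp [rhoTwo, ← hc]

/-- The three kinds of cross relation are one formula: for `i = n` the open interval from `i` to
`i'` is empty (even `N`) or the middle index alone (odd `N`), and in the latter case the coefficient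
at `ρ_i = 1/2` is `q ^ (1/2) - q ^ (-1/2)`. -/
theorem satRel_x [Generic r] : SatRel N r (x N r) where
  comm i j hij hj := by
    have := x_rel (Rel.qComm (r := r) i j hij hj)
    simpa [x] using this
  cross i hi := by
    have hi' : (i : ℕ) < N - (i + 1) := by simpa [Fin.lt_def, Fin.val_rev] using hi
    rcases lt_or_eq_of_le (show (i : ℕ) + 1 ≤ N / 2 by omega) with h | h
    · have := x_rel (Rel.cross (r := r) i h)
      simpa [x, crossCoeff] using this
    · rcases Nat.even_or_odd N with hN | hN
      · have := x_rel (Rel.crossEven (r := r) i h hN)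
        rw [Ioo_rev_even h hN, sum_empty, smul_zero, sub_eq_zero]
        simpa [x] using this
      · obtain ⟨c, hc⟩ : ∃ c : Fin N, c = c.rev := by
          obtain ⟨a, ha⟩ := hN
          exact ⟨⟨a, by omega⟩, by ext; simp only [Fin.val_rev]; omega⟩
        have := x_rel (Rel.crossOdd (r := r) i c h hc)
        rw [Ioo_rev_odd h hc, sum_singleton, rhoTwo_eq_one h hc, crossCoeff_one, ← hc,
          rhoTwo_self hc]
        simpa [x] using this

variable {B : Type} [Ring B] [Algebra ℂ B]

theorem SatRel.lift_rel [Generic r] {f : Fin N → B} (hf : SatRel N r f)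
    ⦃a b : FreeAlgebra ℂ (Fin N)⦄ (h : Rel N r a b) :
    FreeAlgebra.lift ℂ f a = FreeAlgebra.lift ℂ f b := by
  cases h with
  | qComm i j hij hj => simpa using hf.comm i j hij hj
  | cross i hi =>
    have := hf.cross i (by simp only [Fin.lt_def, Fin.val_rev]; omega)
    simpa [crossCoeff] using this
  | crossOdd i c hi hc =>
    have := hf.cross i (by simp only [Fin.lt_def, Fin.val_rev]; omega)
    rw [Ioo_rev_odd hi hc, sum_singleton, rhoTwo_eq_one hi hc, crossCoeff_one, ← hc,
      rhoTwo_self hc] at this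
    simpa using this
  | crossEven i hi hN =>
    have := hf.cross i (by simp only [Fin.lt_def, Fin.val_rev]; omega)
    rw [Ioo_rev_even hi hN, sum_empty, smul_zero, sub_eq_zero] at this
    simpa using this

/-- The homomorphism on `𝒜` with given values on the generators. -/
def liftAlg [Generic r] (f : Fin N → B) (hf : SatRel N r f) : Alg N r →ₐ[ℂ] B :=
  RingQuot.liftAlgHom ℂ ⟨FreeAlgebra.lift ℂ f, hf.lift_rel⟩

@[simp]
theorem liftAlg_x [Generic r] (f : Fin N → B) (hf : SatRel N r f) (i : Fin N) :
    liftAlg f hf (x N r i) = f i := by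
  simp [liftAlg, x]

/-- All terms of a cross relation have the form `x_j x_{j'}` or `x_{j'} x_j`, so they are rescaled
by the same factor `l`. -/
theorem SatRel.smul {f : Fin N → B} (hf : SatRel N r f) (s : Fin N → ℂ) (l : ℂ)
    (hs : ∀ i, s i * s i.rev = l) : SatRel N r (fun i => s i • f i) where
  comm i j hij hj := by
    rw [smul_mul_smul_comm, smul_mul_smul_comm, hf.comm i j hij hj, mul_comm (s j),
      smul_comm]
  cross i hi := by
    have h : ∀ j, s j • f j * s j.rev • f j.rev = l • (f j * f j.rev) := fun j => by
      rw [smul_mul_smul_comm, hs]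
    rw [h, smul_mul_smul_comm, mul_comm (s i.rev), hs, ← smul_sub, hf.cross i hi, smul_comm,
      smul_sum]
    simp only [h, smul_comm l]

/-- The algebra endomorphism `x_i ↦ s_i x_i`. -/
def scale [Generic r] (s : Fin N → ℂ) (l : ℂ) (hs : ∀ i, s i * s i.rev = l) :
    Alg N r →ₐ[ℂ] Alg N r :=
  liftAlg _ (satRel_x.smul s l hs)

/-- The grading automorphism `x_i ↦ z x_i`. -/
def theta (N : ℕ) (r : ℂ) [Generic r] (z : ℂ) : Alg N r →ₐ[ℂ] Alg N r :=
  scale (fun _ => z) (z * z) fun _ => rfl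

@[simp]
theorem theta_x [Generic r] (z : ℂ) (i : Fin N) : theta N r z (x N r i) = z • x N r i := by
  simp [theta, scale]

theorem theta_theta [Generic r] (z w : ℂ) (p : Alg N r) :
    theta N r z (theta N r w p) = theta N r (z * w) p := by
  have : (theta N r z).comp (theta N r w) = theta N r (z * w) :=
    algHom_ext fun i => by simp [smul_smul, mul_comm]
  exact DFunLike.congr_fun this p

theorem theta_one [Generic r] (p : Alg N r) : theta N r 1 p = p := by
  have : theta N r 1 = AlgHom.id ℂ _ := algHom_ext fun i => by simp
  exact DFunLike.congr_fun this p

end Presentation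

/-! ### Passing from `N` to `N + 2` -/

section Step

variable {N : ℕ} {r : ℂ}

/-- The inner index of `N + 2` which corresponds to an index of `N`. -/
def mid (i : Fin N) : Fin (N + 2) := i.castSucc.succ

theorem mid_rev (i : Fin N) : (mid i).rev = mid i.rev := by
  ext; simp only [mid, Fin.val_rev, Fin.val_succ, Fin.val_castSucc]; omega

@[simp] theorem val_mid (i : Fin N) : (mid i : ℕ) = i + 1 := rfl

theorem mid_lt_mid {i j : Fin N} : mid i < mid j ↔ i < j := by rw [Fin.lt_def, Fin.lt_def]; simp

theorem mid_inj {i j : Fin N} : mid i = mid j ↔ i = j := by simp [Fin.ext_iff]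

theorem mid_ne_zero (i : Fin N) : mid i ≠ 0 := by simp [Fin.ext_iff]

theorem mid_ne_last (i : Fin N) : mid i ≠ Fin.last (N + 1) := by
  have := i.isLt
  simp only [ne_eq, Fin.ext_iff, val_mid, Fin.val_last]; omega

theorem zero_lt_mid (i : Fin N) : 0 < mid i := by simp [Fin.lt_def]

theorem mid_lt_last (i : Fin N) : mid i < Fin.last (N + 1) :=
  lt_of_le_of_ne (Fin.le_last _) (mid_ne_last i)

theorem zero_lt_last : (0 : Fin (N + 2)) < Fin.last (N + 1) := by
  simp [Fin.lt_def]

theorem zero_rev : (0 : Fin (N + 2)).rev = Fin.last (N + 1) := Fin.rev_zero _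

theorem last_rev : (Fin.last (N + 1)).rev = 0 := Fin.rev_last _

@[elab_as_elim]
theorem fin_cases_mid {P : Fin (N + 2) → Prop} (zero : P 0) (mid : ∀ j : Fin N, P (mid j))
    (last : P (Fin.last (N + 1))) (i : Fin (N + 2)) : P i := by
  refine Fin.cases zero (fun j => ?_) i
  refine Fin.lastCases ?_ (fun j => ?_) j
  · exact last
  · exact mid j

theorem sum_fin_add_two {M : Type} [AddCommMonoid M] (f : Fin (N + 2) → M) :
    ∑ i, f i = f 0 + ∑ i : Fin N, f (mid i) + f (Fin.last (N + 1)) := by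
  rw [Fin.sum_univ_succ, Fin.sum_univ_castSucc, ← add_assoc]
  rfl

theorem prod_fin_add_two {M : Type} [CommMonoid M] (f : Fin (N + 2) → M) :
    ∏ i, f i = f 0 * (∏ i : Fin N, f (mid i)) * f (Fin.last (N + 1)) := by
  rw [Fin.prod_univ_succ, Fin.prod_univ_castSucc, ← mul_assoc]
  rfl

theorem rhoTwo_zero : rhoTwo (N + 2) 0 = N := by
  simp [rhoTwo, zero_lt_last]

theorem rhoTwo_last : rhoTwo (N + 2) (Fin.last (N + 1)) = -N := by
  rw [← zero_rev, rhoTwo_rev, rhoTwo_zero]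

theorem rhoTwo_mid (i : Fin N) : rhoTwo (N + 2) (mid i) = rhoTwo N i := by
  simp only [rhoTwo, mid_rev, mid_lt_mid, mid_inj, val_mid]
  push_cast
  split_ifs <;> ring

theorem Ioo_mid (i j : Fin N) : Ioo (mid i) (mid j) = (Ioo i j).image mid := by
  ext k
  induction k using fin_cases_mid with
  | zero => simp [mem_Ioo, mid_ne_zero]
  | mid k => simp [mem_Ioo, mid_lt_mid, mid_inj]
  | last =>
    simp only [mem_Ioo, mem_image, mid_ne_last, and_false, exists_false, iff_false, not_and]
    intro _ h
    exact absurd h (not_lt.mpr (Fin.le_last _))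

theorem sum_Ioo_mid {M : Type} [AddCommMonoid M] (i j : Fin N) (f : Fin (N + 2) → M) :
    ∑ k ∈ Ioo (mid i) (mid j), f k = ∑ k ∈ Ioo i j, f (mid k) := by
  rw [Ioo_mid, sum_image fun a _ b _ h => mid_inj.mp h]

theorem sum_Ioo_zero_last {M : Type} [AddCommMonoid M] (f : Fin (N + 2) → M) :
    ∑ k ∈ Ioo 0 (Fin.last (N + 1)), f k = ∑ k : Fin N, f (mid k) := by
  have : Ioo 0 (Fin.last (N + 1)) = (univ : Finset (Fin N)).image mid := by
    ext k
    induction k using fin_cases_mid with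
    | zero => simp [mid_ne_zero]
    | mid k => simp [zero_lt_mid, mid_lt_last]
    | last => simp [mid_ne_last]
  rw [this, sum_image fun a _ b _ h => mid_inj.mp h]

variable {B : Type} [Ring B] [Algebra ℂ B]

/-- This drives the inductions. The outer pair `q`-commutes with the inner variables, and the right
side of its own cross relation is a multiple of the inner `Q'`. -/
theorem satRel_add_two_iff {f : Fin (N + 2) → B} :
    SatRel (N + 2) r f ↔
      (∀ j, f 0 * f (mid j) = r ^ 2 • (f (mid j) * f 0)) ∧
      (∀ j, f (mid j) * f (Fin.last (N + 1)) = r ^ 2 • (f (Fin.last (N + 1)) * f (mid j))) ∧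
      SatRel N r (fun j => f (mid j)) ∧
      f (Fin.last (N + 1)) * f 0 - f 0 * f (Fin.last (N + 1)) =
        crossCoeff r N • ∑ j, r ^ rhoTwo N j.rev • (f (mid j) * f (mid j.rev)) := by
  constructor
  · intro h
    refine ⟨fun j => h.comm _ _ (zero_lt_mid j) ?_, fun j => h.comm _ _ (mid_lt_last j) ?_,
      ⟨fun i j hij hj => h.comm _ _ (mid_lt_mid.mpr hij) ?_, fun i hi => ?_⟩, ?_⟩
    · rw [mid_rev]; exact (mid_ne_zero _).symm
    · rw [last_rev]; exact mid_ne_zero _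
    · rw [mid_rev]; exact fun e => hj (mid_inj.mp e)
    · have := h.cross (mid i) (by rw [mid_rev]; exact mid_lt_mid.mpr hi)
      simpa only [mid_rev, sum_Ioo_mid, rhoTwo_mid] using this
    · have := h.cross 0 (by rw [zero_rev]; exact zero_lt_last)
      simpa only [zero_rev, sum_Ioo_zero_last, rhoTwo_mid, rhoTwo_zero, mid_rev] using this
  · rintro ⟨h1, h2, h3, h4⟩
    constructor
    · intro i j hij hj
      induction i using fin_cases_mid with
      | zero =>
        induction j using fin_cases_mid with
        | zero => exact absurd hij (lt_irrefl _)
        | mid j => exact h1 j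
        | last => exact absurd last_rev.symm hj
      | mid i =>
        induction j using fin_cases_mid with
        | zero => exact absurd hij (not_lt.mpr (Fin.zero_le _))
        | mid j =>
          rw [mid_rev] at hj
          exact h3.comm i j (mid_lt_mid.mp hij) fun e => hj (congrArg mid e)
        | last => exact h2 i
      | last => exact absurd hij (not_lt.mpr (Fin.le_last _))
    · intro i hi
      induction i using fin_cases_mid with
      | zero =>
        simpa only [zero_rev, sum_Ioo_zero_last, rhoTwo_mid, rhoTwo_zero, mid_rev] using h4
      | mid i =>
        rw [mid_rev, mid_lt_mid] at hi
        simpa only [mid_rev, sum_Ioo_mid, rhoTwo_mid] using h3.cross i hi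
      | last => exact absurd hi (not_lt.mpr (Fin.le_last _))

variable [Generic r]

/-- The embedding `x_i ↦ x_{i+1}` of the algebra for `N` into the algebra for `N + 2`. -/
def emb (N : ℕ) (r : ℂ) [Generic r] : Alg N r →ₐ[ℂ] Alg (N + 2) r :=
  liftAlg _ (satRel_add_two_iff.mp (satRel_x (N := N + 2) (r := r))).2.2.1

@[simp]
theorem emb_x (i : Fin N) : emb N r (x N r i) = x (N + 2) r (mid i) := by simp [emb]

theorem emb_radius : emb N r (radius N r) =
    ∑ j, r ^ rhoTwo N j.rev • (x (N + 2) r (mid j) * x (N + 2) r (mid j.rev)) := by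
  simp [radius]

/-- The generator `x_1` of the algebra for `N + 2`. -/
abbrev xf (N : ℕ) (r : ℂ) : Alg (N + 2) r := x (N + 2) r 0

/-- The generator `x_{1'}` of the algebra for `N + 2`. -/
abbrev xl (N : ℕ) (r : ℂ) : Alg (N + 2) r := x (N + 2) r (Fin.last (N + 1))

theorem xf_mul_emb (p : Alg N r) : xf N r * emb N r p = emb N r (theta N r (r ^ 2) p) * xf N r := by
  have h := (satRel_add_two_iff.mp (satRel_x (N := N + 2) (r := r))).1
  induction p using alg_induction with
  | algebraMap c => simp [Algebra.commutes]
  | gen i => simp [h]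
  | mul a b ha hb => rw [map_mul, ← mul_assoc, ha, mul_assoc, hb]; simp [mul_assoc]
  | add a b ha hb => simp [mul_add, add_mul, ha, hb]

theorem emb_mul_xl (p : Alg N r) : emb N r p * xl N r = xl N r * emb N r (theta N r (r ^ 2) p) := by
  have h := (satRel_add_two_iff.mp (satRel_x (N := N + 2) (r := r))).2.1
  induction p using alg_induction with
  | algebraMap c => simp [Algebra.commutes]
  | gen i => simp [h]
  | mul a b ha hb => rw [map_mul, mul_assoc, hb, ← mul_assoc, ha]; simp [mul_assoc]
  | add a b ha hb => simp [mul_add, add_mul, ha, hb]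

theorem theta_theta_inv {z : ℂ} (hz : z ≠ 0) (p : Alg N r) :
    theta N r z (theta N r z⁻¹ p) = p := by
  rw [theta_theta, mul_inv_cancel₀ hz, theta_one]

theorem theta_inv_theta {z : ℂ} (hz : z ≠ 0) (p : Alg N r) :
    theta N r z⁻¹ (theta N r z p) = p := by
  rw [theta_theta, inv_mul_cancel₀ hz, theta_one]

theorem emb_mul_xf (p : Alg N r) :
    emb N r p * xf N r = xf N r * emb N r (theta N r (r ^ 2)⁻¹ p) := by
  rw [xf_mul_emb, theta_theta_inv (q_ne r)]

theorem xl_mul_emb (p : Alg N r) :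
    xl N r * emb N r p = emb N r (theta N r (r ^ 2)⁻¹ p) * xl N r := by
  rw [emb_mul_xl, theta_theta_inv (q_ne r)]

theorem xl_mul_xf : xl N r * xf N r = xf N r * xl N r + crossCoeff r N • emb N r (radius N r) := by
  have h := (satRel_add_two_iff.mp (satRel_x (N := N + 2) (r := r))).2.2.2
  rw [emb_radius, ← h]; abel

theorem theta_radius (z : ℂ) : theta N r z (radius N r) = z ^ 2 • radius N r := by
  simp only [radius, map_sum, map_smul, map_mul, theta_x, smul_mul_smul_comm, smul_sum]
  refine sum_congr rfl fun i _ => ?_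
  rw [smul_comm, sq]

/-- The coefficient of `x_1 x_{1'}` in `Q`. -/
def alphaC (N : ℕ) (r : ℂ) : ℂ := r ^ (N : ℤ) + r ^ (-(N : ℤ))

/-- The coefficient of the inner radius in `Q`. -/
def betaC (N : ℕ) (r : ℂ) : ℂ := 1 + r ^ (N : ℤ) * crossCoeff r N

theorem radius_add_two : radius (N + 2) r =
    alphaC N r • (xf N r * xl N r) + betaC N r • emb N r (radius N r) := by
  rw [radius, sum_fin_add_two]
  simp only [zero_rev, last_rev, mid_rev, rhoTwo_mid, rhoTwo_zero, rhoTwo_last]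
  rw [← emb_radius, xl_mul_xf, alphaC, betaC]
  module

/-- Moving `x_1` through `Q = α x_1 x_{1'} + β Q'` gives the factor `q ^ (-2)` on `Q'` and the
correction `α c Q'` with `c` the cross coefficient; this identity is the exact condition for the two
to cancel. -/
theorem alpha_mul_cross : alphaC N r * crossCoeff r N = betaC N r * (1 - (r ^ 2)⁻¹ ^ 2) := by
  have h0 := r_ne r
  have h1 : r ^ ((N : ℤ) - 2) + r ^ (-(N : ℤ) + 2) ≠ 0 := r_zpow_add_ne_zero r _ _
  have hw : r ^ (N : ℤ) ≠ 0 := zpow_ne_zero _ h0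
  rw [betaC, alphaC, crossCoeff, zpow_neg]
  rw [zpow_sub₀ h0, zpow_add₀ h0, zpow_neg] at *
  set w := r ^ (N : ℤ)
  norm_cast at *
  have h2 : w ^ 2 + r ^ 4 ≠ 0 := by
    intro h; apply h1; field_simp; linear_combination h
  field_simp
  ring

end Step

/-! ### Centrality of `Q` -/

section Central

variable {r : ℂ}

theorem radius_zero : radius 0 r = 0 := by simp [radius]

theorem radius_one : radius 1 r = x 1 r 0 * x 1 r 0 := by
  simp [radius, rhoTwo]

/-- For an inner generator the factors `q` and `q⁻¹` from `x_1` and `x_{1'}` cancel, and `Q'` is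
central by induction. For the outer generators the claim is `alpha_mul_cross`. -/
theorem radius_central [Generic r] (N : ℕ) (p : Alg N r) : radius N r * p = p * radius N r := by
  induction N using Nat.twoStepInduction with
  | zero => simp [radius_zero]
  | one =>
    induction p using alg_induction with
    | algebraMap c => simp [Algebra.commutes]
    | gen i => rw [radius_one, Subsingleton.elim i 0, mul_assoc]
    | mul a b ha hb => rw [← mul_assoc, ha, mul_assoc, hb, mul_assoc]
    | add a b ha hb => rw [mul_add, add_mul, ha, hb]
  | more N ih _ =>
    have hQ : ∀ p : Alg N r, emb N r (radius N r) * emb N r p = emb N r p * emb N r (radius N r) :=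
      fun p => by rw [← map_mul, ih, map_mul]
    have hc := alpha_mul_cross (N := N) (r := r)
    induction p using alg_induction with
    | algebraMap c => simp [Algebra.commutes]
    | gen i =>
      have e1 : xf N r * xl N r * xf N r = xf N r * (xf N r * xl N r) +
          crossCoeff r N • (xf N r * emb N r (radius N r)) := by
        rw [mul_assoc, xl_mul_xf, mul_add, mul_smul_comm]
      have e2 : emb N r (radius N r) * xf N r =
          (r ^ 2)⁻¹ ^ 2 • (xf N r * emb N r (radius N r)) := by
        rw [emb_mul_xf, theta_radius]; simp
      have e3 : xl N r * (xf N r * xl N r) = xf N r * xl N r * xl N r +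
          crossCoeff r N • (emb N r (radius N r) * xl N r) := by
        rw [← mul_assoc, xl_mul_xf, add_mul, smul_mul_assoc]
      have e4 : xl N r * emb N r (radius N r) =
          (r ^ 2)⁻¹ ^ 2 • (emb N r (radius N r) * xl N r) := by
        rw [xl_mul_emb, theta_radius]; simp
      rw [radius_add_two, add_mul, mul_add, smul_mul_assoc, smul_mul_assoc, mul_smul_comm,
        mul_smul_comm]
      induction i using fin_cases_mid with
      | zero =>
        rw [e1, e2, smul_add, smul_smul, smul_smul, hc]
        module
      | mid i =>
        have hi := hQ (x N r i)
        rw [emb_x] at hi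
        have h1 := emb_mul_xf (x N r i)
        have h2 := emb_mul_xl (x N r i)
        simp only [emb_x, theta_x, map_smul, mul_smul_comm] at h1 h2
        rw [hi, ← mul_assoc, h1, smul_mul_assoc, mul_assoc (xf N r) (x _ _ (mid i)), h2,
          mul_smul_comm, inv_smul_smul₀ (q_ne r), mul_assoc]
      | last =>
        rw [e3, e4, smul_add, smul_smul, smul_smul, hc]
        module
    | mul a b ha hb => rw [← mul_assoc, ha, mul_assoc, hb, mul_assoc]
    | add a b ha hb => rw [mul_add, add_mul, ha, hb]

end Central

/-! ### The triangular decomposition and the basis of monomials -/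

section Decomposition

variable {N : ℕ} {r : ℂ}

/-- The exponent vector `(a, ν, b)`. -/
def glue (a : ℕ) (ν : Fin N → ℕ) (b : ℕ) : Fin (N + 2) → ℕ :=
  Fin.cons (α := fun _ => ℕ) a (Fin.snoc (α := fun _ => ℕ) ν b)

@[simp] theorem glue_zero (a b : ℕ) (ν : Fin N → ℕ) : glue a ν b 0 = a := rfl

@[simp] theorem glue_mid (a b : ℕ) (ν : Fin N → ℕ) (i : Fin N) : glue a ν b (mid i) = ν i := by
  simp [glue, mid]

@[simp] theorem glue_last (a b : ℕ) (ν : Fin N → ℕ) : glue a ν b (Fin.last (N + 1)) = b := by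
  rw [glue, ← Fin.succ_last]; simp

theorem glue_eta (ν : Fin (N + 2) → ℕ) :
    glue (ν 0) (fun i => ν (mid i)) (ν (Fin.last (N + 1))) = ν := by
  ext i
  induction i using fin_cases_mid <;> simp

/-- Splitting off the outer exponents. -/
def glueEquiv (N : ℕ) : (Fin (N + 2) → ℕ) ≃ (ℕ × ℕ) × (Fin N → ℕ) where
  toFun ν := ((ν 0, ν (Fin.last (N + 1))), fun i => ν (mid i))
  invFun p := glue p.1.1 p.2 p.1.2
  left_inv := glue_eta
  right_inv p := by simp

variable [Generic r]

/-- The map `f ↦ x_1 ^ a f x_{1'} ^ b`. -/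
def tri (a b : ℕ) : Alg N r →ₗ[ℂ] Alg (N + 2) r :=
  LinearMap.mulRight ℂ (xl N r ^ b) ∘ₗ LinearMap.mulLeft ℂ (xf N r ^ a) ∘ₗ (emb N r).toLinearMap

theorem tri_apply (a b : ℕ) (f : Alg N r) : tri a b f = xf N r ^ a * emb N r f * xl N r ^ b := rfl

theorem mono_glue (a b : ℕ) (ν : Fin N → ℕ) :
    mono (N + 2) r (glue a ν b) = tri a b (mono N r ν) := by
  have h : (fun i : Fin N => x (N + 2) r i.castSucc.succ ^ glue a ν b i.castSucc.succ) =
      emb N r ∘ fun i => x N r i ^ ν i := by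
    ext i
    have := glue_mid a b ν i
    rw [mid] at this
    simp [this, mid]
  have h2 := glue_last a b ν
  rw [← Fin.succ_last] at h2
  rw [mono, List.ofFn_succ, List.prod_cons, List.ofFn_succ', List.concat_eq_append,
    List.prod_append, List.prod_singleton, h, ← List.map_ofFn, ← map_list_prod, tri_apply, h2,
    ← mul_assoc]
  rfl

/-- The coefficients `γ_a` in `x_{1'} x_1 ^ a = x_1 ^ a x_{1'} + γ_a x_1 ^ (a - 1) Q'`. -/
def gam (N : ℕ) (r : ℂ) (a : ℕ) : ℂ := crossCoeff r N * ∑ i ∈ range a, ((r ^ 2)⁻¹ ^ 2) ^ i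

omit [Generic r] in
@[simp] theorem gam_zero : gam N r 0 = 0 := by simp [gam]

omit [Generic r] in
theorem gam_succ (a : ℕ) : gam N r (a + 1) = gam N r a + crossCoeff r N * ((r ^ 2)⁻¹ ^ 2) ^ a := by
  rw [gam, sum_range_succ, mul_add, ← gam]

theorem theta_pow (z : ℂ) (a : ℕ) (p : Alg N r) :
    theta N r (z ^ (a + 1)) p = theta N r z (theta N r (z ^ a) p) := by
  rw [theta_theta, pow_succ']

theorem emb_mul_xf_pow (a : ℕ) (p : Alg N r) :
    emb N r p * xf N r ^ a = xf N r ^ a * emb N r (theta N r ((r ^ 2)⁻¹ ^ a) p) := by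
  induction a generalizing p with
  | zero => simp [theta_one]
  | succ a ih =>
    rw [pow_succ', ← mul_assoc, emb_mul_xf, mul_assoc, ih, theta_theta, ← pow_succ, ← mul_assoc]

theorem emb_mul_xl_pow (b : ℕ) (p : Alg N r) :
    emb N r p * xl N r ^ b = xl N r ^ b * emb N r (theta N r ((r ^ 2) ^ b) p) := by
  induction b generalizing p with
  | zero => simp [theta_one]
  | succ a ih =>
    rw [pow_succ', ← mul_assoc, emb_mul_xl, mul_assoc, ih, theta_theta, ← pow_succ, ← mul_assoc]

/-- Each passage of `x_{1'}` over one `x_1` leaves a `Q'`, and each `x_1` that this `Q'` then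
crosses costs `q ^ (-2)`; hence the geometric sum in `gam`. -/
theorem xl_mul_xf_pow (a : ℕ) : xl N r * xf N r ^ a =
    xf N r ^ a * xl N r + gam N r a • (xf N r ^ (a - 1) * emb N r (radius N r)) := by
  induction a with
  | zero => simp
  | succ a ih =>
    have e2 : emb N r (radius N r) * xf N r ^ a =
        ((r ^ 2)⁻¹ ^ 2) ^ a • (xf N r ^ a * emb N r (radius N r)) := by
      rw [emb_mul_xf_pow, theta_radius, ← pow_mul, mul_comm a, pow_mul]; simp
    have e3 : gam N r a • (xf N r * (xf N r ^ (a - 1) * emb N r (radius N r))) =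
        gam N r a • (xf N r ^ a * emb N r (radius N r)) := by
      rcases a with _ | a
      · simp
      · rw [← mul_assoc, ← pow_succ']; rfl
    rw [pow_succ', ← mul_assoc, xl_mul_xf, add_mul, mul_assoc, ih, smul_mul_assoc, e2, mul_add,
      mul_smul_comm, e3, gam_succ, Nat.add_sub_cancel, mul_assoc (xf N r)]
    module

theorem xf_mul_tri (a b : ℕ) (f : Alg N r) : xf N r * tri a b f = tri (a + 1) b f := by
  simp only [tri_apply, pow_succ', mul_assoc]

theorem emb_mul_tri (g : Alg N r) (a b : ℕ) (f : Alg N r) :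
    emb N r g * tri a b f = tri a b (theta N r ((r ^ 2)⁻¹ ^ a) g * f) := by
  simp only [tri_apply, ← mul_assoc, emb_mul_xf_pow, map_mul]

theorem x_mid_mul_tri (i : Fin N) (a b : ℕ) (f : Alg N r) :
    x (N + 2) r (mid i) * tri a b f = (r ^ 2)⁻¹ ^ a • tri a b (x N r i * f) := by
  rw [← emb_x, emb_mul_tri, theta_x, smul_mul_assoc, map_smul]

theorem xl_mul_tri (a b : ℕ) (f : Alg N r) :
    xl N r * tri a b f = tri a (b + 1) (theta N r (r ^ 2)⁻¹ f) +
      gam N r a • tri (a - 1) b (radius N r * f) := by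
  have h : xl N r * emb N r f * xl N r ^ b =
      emb N r (theta N r (r ^ 2)⁻¹ f) * xl N r ^ (b + 1) := by
    rw [xl_mul_emb, mul_assoc, pow_succ' (xl N r)]
  simp only [tri_apply]
  rw [← mul_assoc, ← mul_assoc, xl_mul_xf_pow, add_mul, add_mul, mul_assoc (xf N r ^ a),
    mul_assoc (xf N r ^ a), h, smul_mul_assoc, smul_mul_assoc, map_mul]
  simp only [mul_assoc]

theorem tri_zero_zero (f : Alg N r) : tri 0 0 f = emb N r f := by simp [tri_apply]

/-- The direct sum of copies of the algebra for `N` indexed by the outer exponents. -/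
def Dec (N : ℕ) (r : ℂ) : Type := ℕ × ℕ →₀ Alg N r

instance : AddCommGroup (Dec N r) := inferInstanceAs (AddCommGroup (ℕ × ℕ →₀ Alg N r))

instance : Module ℂ (Dec N r) := inferInstanceAs (Module ℂ (ℕ × ℕ →₀ Alg N r))

/-- The inclusion of the summand with outer exponents `a` and `b`. -/
def Dec.mk (a b : ℕ) : Alg N r →ₗ[ℂ] Dec N r := Finsupp.lsingle (a, b)

/-- The element with given components. -/
def Dec.of (v : ℕ × ℕ →₀ Alg N r) : Dec N r := v

omit [Generic r] in
theorem Dec.of_add (v w : ℕ × ℕ →₀ Alg N r) : Dec.of (v + w) = Dec.of v + Dec.of w := rfl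

omit [Generic r] in
theorem Dec.of_single (a b : ℕ) (f : Alg N r) : Dec.of (Finsupp.single (a, b) f) = Dec.mk a b f :=
  rfl

/-- The linear map on the direct sum with given restrictions to the summands. -/
def Dec.lift {M : Type} [AddCommGroup M] [Module ℂ M] (φ : ℕ → ℕ → Alg N r →ₗ[ℂ] M) :
    Dec N r →ₗ[ℂ] M :=
  Finsupp.lsum ℂ fun ab : ℕ × ℕ => φ ab.1 ab.2

/-- The projection to the summand with outer exponents `a` and `b`. -/
def Dec.proj (a b : ℕ) : Dec N r →ₗ[ℂ] Alg N r := Finsupp.lapply (a, b)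

omit [Generic r] in
@[simp] theorem Dec.lift_mk {M : Type} [AddCommGroup M] [Module ℂ M]
    (φ : ℕ → ℕ → Alg N r →ₗ[ℂ] M) (a b : ℕ) (f : Alg N r) :
    Dec.lift φ (Dec.mk a b f) = φ a b f := by
  rw [Dec.lift, Dec.mk]
  exact Finsupp.sum_single_index (by simp)

omit [Generic r] in
theorem Dec.hom_ext {M : Type} [AddCommGroup M] [Module ℂ M] {φ ψ : Dec N r →ₗ[ℂ] M}
    (h : ∀ a b f, φ (Dec.mk a b f) = ψ (Dec.mk a b f)) : φ = ψ :=
  Finsupp.lhom_ext fun ab f => h ab.1 ab.2 f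

omit [Generic r] in
theorem Dec.ext {m m' : Dec N r} (h : ∀ a b, Dec.proj a b m = Dec.proj a b m') : m = m' :=
  Finsupp.ext fun ab => h ab.1 ab.2

omit [Generic r] in
theorem Dec.proj_mk (a b c d : ℕ) (f : Alg N r) :
    Dec.proj a b (Dec.mk c d f) = if c = a ∧ d = b then f else 0 := by
  have : Dec.proj a b (Dec.mk c d f) = Finsupp.single (c, d) f (a, b) := rfl
  rw [this, Finsupp.single_apply]
  simp [Prod.ext_iff]

theorem mul_inv_pow_succ {z : ℂ} (hz : z ≠ 0) (a : ℕ) : z * z⁻¹ ^ (a + 1) = z⁻¹ ^ a := by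
  rw [pow_succ', mul_inv_cancel_left₀ hz]

/-- Left multiplication by `x_1` on the decomposition. -/
def opFirst (N : ℕ) (r : ℂ) : Module.End ℂ (Dec N r) := Dec.lift fun a b => Dec.mk (a + 1) b

/-- Left multiplication by an inner generator on the decomposition. -/
def opMid (N : ℕ) (r : ℂ) (i : Fin N) : Module.End ℂ (Dec N r) :=
  Dec.lift fun a b => Dec.mk a b ∘ₗ ((r ^ 2)⁻¹ ^ a • LinearMap.mulLeft ℂ (x N r i))

/-- Left multiplication by `x_{1'}` on the decomposition. -/
def opLast (N : ℕ) (r : ℂ) [Generic r] : Module.End ℂ (Dec N r) :=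
  Dec.lift fun a b => Dec.mk a (b + 1) ∘ₗ (theta N r (r ^ 2)⁻¹).toLinearMap +
    Dec.mk (a - 1) b ∘ₗ (gam N r a • LinearMap.mulLeft ℂ (radius N r))

omit [Generic r] in
theorem opFirst_mk (a b : ℕ) (f : Alg N r) :
    opFirst N r (Dec.mk a b f) = Dec.mk (a + 1) b f := by
  simp [opFirst]

omit [Generic r] in
theorem opMid_mk (i : Fin N) (a b : ℕ) (f : Alg N r) :
    opMid N r i (Dec.mk a b f) = (r ^ 2)⁻¹ ^ a • Dec.mk a b (x N r i * f) := by
  simp [opMid]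

theorem opLast_mk (a b : ℕ) (f : Alg N r) :
    opLast N r (Dec.mk a b f) = Dec.mk a (b + 1) (theta N r (r ^ 2)⁻¹ f) +
      gam N r a • Dec.mk (a - 1) b (radius N r * f) := by
  simp [opLast]

/-- The operators of left multiplication by the generators on the decomposition. -/
def opGen (N : ℕ) (r : ℂ) [Generic r] : Fin (N + 2) → Module.End ℂ (Dec N r) :=
  Fin.cons (α := fun _ => Module.End ℂ (Dec N r)) (opFirst N r)
    (Fin.snoc (α := fun _ => Module.End ℂ (Dec N r)) (opMid N r) (opLast N r))

theorem opGen_zero : opGen N r 0 = opFirst N r := rfl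

theorem opGen_mid (i : Fin N) : opGen N r (mid i) = opMid N r i := by
  simp [opGen, mid]

theorem opGen_last : opGen N r (Fin.last (N + 1)) = opLast N r := by
  rw [opGen, ← Fin.succ_last]; simp

omit [Generic r] in
theorem opMid_mul (i j : Fin N) (a b : ℕ) (f : Alg N r) :
    (opMid N r i * opMid N r j) (Dec.mk a b f) =
      ((r ^ 2)⁻¹ ^ a * (r ^ 2)⁻¹ ^ a) • Dec.mk a b (x N r i * x N r j * f) := by
  simp only [Module.End.mul_apply, opMid_mk, map_smul, smul_smul, mul_assoc]

/-- The operators copy `xf_mul_tri`, `x_mid_mul_tri` and `xl_mul_tri`. Verifying the relations for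
them makes the formal direct sum a module over the algebra for `N + 2`, from which the independence
of the summands is read off. -/
theorem satRel_opGen : SatRel (N + 2) r (opGen N r) := by
  have hq := q_ne r
  have hx := satRel_x (N := N) (r := r)
  rw [satRel_add_two_iff]
  simp only [opGen_zero, opGen_mid, opGen_last]
  refine ⟨fun j => Dec.hom_ext fun a b f => ?_, fun j => Dec.hom_ext fun a b f => ?_,
    ⟨fun i j hij hj => Dec.hom_ext fun a b f => ?_, fun i hi => Dec.hom_ext fun a b f => ?_⟩,
    Dec.hom_ext fun a b f => ?_⟩
  · simp only [Module.End.mul_apply, opFirst_mk, opMid_mk, LinearMap.smul_apply, smul_smul,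
      map_smul]
    rw [mul_inv_pow_succ hq]
  · simp only [Module.End.mul_apply, opLast_mk, opMid_mk, LinearMap.smul_apply, map_add,
      smul_smul, smul_add, map_smul, map_mul, theta_x, smul_mul_assoc]
    -- Centrality of the inner `Q'` is what lets `x_{1'}` `q`-commute with the inner generators.
    rw [← mul_assoc (radius N r) (x N r j), radius_central N (x N r j), mul_assoc (x N r j)]
    congr 1
    · rw [mul_left_comm, mul_inv_cancel₀ hq, mul_one]
    · rcases a with _ | a
      · simp
      · rw [Nat.add_sub_cancel, ← mul_assoc (r ^ 2), mul_inv_pow_succ hq, mul_comm]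
  · rw [LinearMap.smul_apply, opMid_mul, opMid_mul, hx.comm i j hij hj, smul_mul_assoc,
      map_smul, smul_comm]
  · simp only [LinearMap.sub_apply, LinearMap.smul_apply, LinearMap.sum_apply, opMid_mul]
    rw [← smul_sub, ← map_sub, ← sub_mul, hx.cross i hi]
    simp only [smul_mul_assoc, sum_mul, map_smul, map_sum, smul_sum]
    refine sum_congr rfl fun j _ => ?_
    module
  · have hQ : ∑ j : Fin N, r ^ rhoTwo N j.rev • ((opMid N r j * opMid N r j.rev) (Dec.mk a b f)) =
        ((r ^ 2)⁻¹ ^ a * (r ^ 2)⁻¹ ^ a) • Dec.mk a b (radius N r * f) := by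
      simp only [opMid_mul, radius, sum_mul, map_sum, smul_sum, smul_mul_assoc, map_smul]
      refine sum_congr rfl fun j _ => ?_
      module
    simp only [LinearMap.sub_apply, LinearMap.smul_apply, LinearMap.sum_apply]
    rw [hQ]
    simp only [Module.End.mul_apply, opLast_mk, opFirst_mk, map_add, map_smul, gam_succ,
      Nat.add_sub_cancel]
    rcases a with _ | a
    · simp
    · rw [Nat.add_sub_cancel, ← pow_mul, mul_comm 2, pow_mul, sq]
      module

/-- The left regular representation, transported to the decomposition. -/
def decRep (N : ℕ) (r : ℂ) [Generic r] : Alg (N + 2) r →ₐ[ℂ] Module.End ℂ (Dec N r) :=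
  liftAlg (opGen N r) satRel_opGen

/-- The map from the decomposition to the algebra for `N + 2`. -/
def fromDec (N : ℕ) (r : ℂ) [Generic r] : Dec N r →ₗ[ℂ] Alg (N + 2) r := Dec.lift tri

theorem fromDec_mk (a b : ℕ) (f : Alg N r) : fromDec N r (Dec.mk a b f) = tri a b f := by
  simp [fromDec]

theorem fromDec_decRep (p : Alg (N + 2) r) (m : Dec N r) :
    fromDec N r (decRep N r p m) = p * fromDec N r m := by
  induction p using alg_induction generalizing m with
  | algebraMap c => simp [Algebra.algebraMap_eq_smul_one]
  | gen i =>
    suffices h : fromDec N r ∘ₗ opGen N r i =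
        LinearMap.mulLeft ℂ (x (N + 2) r i) ∘ₗ fromDec N r by
      rw [decRep, liftAlg_x]; exact LinearMap.congr_fun h m
    refine Dec.hom_ext fun a b f => ?_
    simp only [LinearMap.comp_apply, LinearMap.mulLeft_apply, fromDec_mk]
    induction i using fin_cases_mid with
    | zero => rw [opGen_zero, opFirst_mk, fromDec_mk, xf_mul_tri]
    | mid i => rw [opGen_mid, opMid_mk, map_smul, fromDec_mk, x_mid_mul_tri]
    | last =>
      rw [opGen_last, opLast_mk, map_add, map_smul, fromDec_mk, fromDec_mk, xl_mul_tri]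
  | mul a b ha hb => rw [map_mul, Module.End.mul_apply, ha, hb, mul_assoc]
  | add a b ha hb => rw [map_add, LinearMap.add_apply, map_add, ha, hb, add_mul]

theorem decRep_emb (p : Alg N r) (b : ℕ) (f : Alg N r) :
    decRep N r (emb N r p) (Dec.mk 0 b f) = Dec.mk 0 b (p * f) := by
  induction p using alg_induction generalizing f with
  | algebraMap c => simp [Algebra.algebraMap_eq_smul_one]
  | gen i => rw [emb_x, decRep, liftAlg_x, opGen_mid, opMid_mk]; simp
  | mul p p' hp hp' => rw [map_mul, map_mul, Module.End.mul_apply, hp', hp, mul_assoc]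
  | add p p' hp hp' => rw [map_add, map_add, LinearMap.add_apply, hp', hp, add_mul, map_add]

/-- Acting on the vector `1` in the place `(0, 0)` recovers the component, so `fromDec` is
injective; surjectivity follows from `fromDec_decRep` at the same vector. -/
theorem decRep_tri (a b : ℕ) (f : Alg N r) :
    decRep N r (tri a b f) (Dec.mk 0 0 1) = Dec.mk a b f := by
  have h1 : decRep N r (xl N r ^ b) (Dec.mk 0 0 1) = Dec.mk 0 b 1 := by
    induction b with
    | zero => simp
    | succ b ih =>
      rw [pow_succ', map_mul, Module.End.mul_apply, ih, decRep, liftAlg_x, opGen_last, opLast_mk]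
      simp
  have h2 : decRep N r (xf N r ^ a) (Dec.mk 0 b f) = Dec.mk a b f := by
    induction a with
    | zero => simp
    | succ a ih =>
      rw [pow_succ', map_mul, Module.End.mul_apply, ih, decRep, liftAlg_x, opGen_zero, opFirst_mk]
  rw [tri_apply, map_mul, map_mul, Module.End.mul_apply, Module.End.mul_apply, h1, decRep_emb,
    mul_one, h2]

/-- The triangular decomposition of the algebra for `N + 2`. -/
def decEquiv (N : ℕ) (r : ℂ) [Generic r] : Dec N r ≃ₗ[ℂ] Alg (N + 2) r :=
  LinearEquiv.ofLinearMap (fromDec N r)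
    (LinearMap.applyₗ (Dec.mk 0 0 1) ∘ₗ (decRep N r).toLinearMap)
    (by
      ext p
      have := fromDec_decRep p (Dec.mk 0 0 1)
      rw [fromDec_mk, tri_zero_zero, map_one (emb N r), mul_one] at this
      exact this)
    (Dec.hom_ext fun a b f => by
      rw [LinearMap.comp_apply, fromDec_mk]
      exact decRep_tri a b f)

theorem decEquiv_mk (a b : ℕ) (f : Alg N r) : decEquiv N r (Dec.mk a b f) = tri a b f :=
  fromDec_mk a b f

theorem hom_ext_tri {M : Type} [AddCommGroup M] [Module ℂ M] {φ ψ : Alg (N + 2) r →ₗ[ℂ] M}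
    (h : ∀ a b f, φ (tri a b f) = ψ (tri a b f)) : φ = ψ := by
  have : φ ∘ₗ (decEquiv N r).toLinearMap = ψ ∘ₗ (decEquiv N r).toLinearMap :=
    Dec.hom_ext fun a b f => by simpa [decEquiv_mk] using h a b f
  ext p
  obtain ⟨m, rfl⟩ := (decEquiv N r).surjective p
  exact LinearMap.congr_fun this m

/-- The coefficient of `x_1 ^ a ⋯ x_{1'} ^ b` in the triangular decomposition. -/
def comp (a b : ℕ) : Alg (N + 2) r →ₗ[ℂ] Alg N r :=
  Dec.proj a b ∘ₗ (decEquiv N r).symm.toLinearMap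

theorem comp_tri (a b c d : ℕ) (f : Alg N r) :
    comp a b (tri c d f) = if c = a ∧ d = b then f else 0 := by
  rw [← decEquiv_mk, comp, LinearMap.comp_apply, LinearEquiv.coe_coe,
    LinearEquiv.symm_apply_apply, Dec.proj_mk]

theorem comp_ext {p p' : Alg (N + 2) r} (h : ∀ a b, comp a b p = comp a b p') : p = p' :=
  (decEquiv N r).symm.injective (Dec.ext h)

/-! ### The basis of ordered monomials -/

omit [Generic r] in
theorem evalMono_single (ν : Fin N → ℕ) (c : ℂ) :
    evalMono N r (Finsupp.single ν c) = c • mono N r ν := by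
  simp [evalMono]

theorem evalMono_zero_bijective : Function.Bijective (evalMono 0 r) := by
  have hs : SatRel 0 r (fun i : Fin 0 => (i.elim0 : ℂ)) := ⟨fun i => i.elim0, fun i => i.elim0⟩
  have hm : ∀ ν, mono 0 r ν = 1 := fun ν => by simp [mono]
  constructor
  · have h : (liftAlg _ hs).toLinearMap ∘ₗ evalMono 0 r = Finsupp.lapply 0 :=
      Finsupp.lhom_ext fun ν c => by
        rw [LinearMap.comp_apply, evalMono_single, hm, Subsingleton.elim ν 0]
        simp
    intro v w hvw
    refine Finsupp.ext fun ν => ?_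
    rw [Subsingleton.elim ν 0]
    have := congrArg (liftAlg _ hs).toLinearMap hvw
    rw [← LinearMap.comp_apply, ← LinearMap.comp_apply, h] at this
    exact this
  · intro p
    induction p using alg_induction with
    | algebraMap c =>
      exact ⟨Finsupp.single 0 c, by rw [evalMono_single, hm, Algebra.algebraMap_eq_smul_one]⟩
    | gen i => exact i.elim0
    | mul a b ha hb =>
      obtain ⟨v, rfl⟩ := ha
      obtain ⟨w, rfl⟩ := hb
      refine ⟨Finsupp.single 0 (v 0 * w 0), ?_⟩
      have hv : ∀ v, evalMono 0 r v = v 0 • 1 := fun v => by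
        have : v = Finsupp.single 0 (v 0) := Finsupp.ext fun ν => by
          rw [Subsingleton.elim ν 0, Finsupp.single_eq_same]
        rw [this, evalMono_single, hm, Finsupp.single_eq_same]
      rw [hv, hv, hv, smul_mul_smul_comm, mul_one, Finsupp.single_eq_same]
    | add a b ha hb =>
      obtain ⟨v, rfl⟩ := ha
      obtain ⟨w, rfl⟩ := hb
      exact ⟨v + w, map_add _ _ _⟩

omit [Generic r] in
theorem mono_one (ν : Fin 1 → ℕ) : mono 1 r ν = x 1 r 0 ^ ν 0 := by simp [mono]

/-- For `N = 1` there are no relations. Independence is tested by coefficients after mapping the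
generator to `X` in `ℂ[X]`. -/
theorem evalMono_one_bijective : Function.Bijective (evalMono 1 r) := by
  have hs : SatRel 1 r (fun _ : Fin 1 => (Polynomial.X : Polynomial ℂ)) :=
    ⟨fun i j h => absurd h (by rw [Subsingleton.elim i j]; exact lt_irrefl _),
      fun i h => absurd h (by rw [Subsingleton.elim i.rev i]; exact lt_irrefl _)⟩
  constructor
  · have h : ∀ k : ℕ, Polynomial.lcoeff ℂ k ∘ₗ (liftAlg _ hs).toLinearMap ∘ₗ evalMono 1 r =
        Finsupp.lapply (fun _ => k) := fun k => Finsupp.lhom_ext fun ν c => by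
      have hν : ν = (fun _ => k) ↔ k = ν 0 :=
        ⟨fun h => by rw [h], fun h => funext fun i => by rw [h, Subsingleton.elim i 0]⟩
      simp only [LinearMap.comp_apply, evalMono_single, mono_one, map_smul,
        AlgHom.toLinearMap_apply, map_pow, liftAlg_x, Polynomial.lcoeff_apply,
        Polynomial.coeff_X_pow, Finsupp.lapply_apply, Finsupp.single_apply, hν]
      simp
    intro v w hvw
    ext ν
    have hν : ν = fun _ => ν 0 := funext fun i => by rw [Subsingleton.elim i 0]
    have := congrArg (Polynomial.lcoeff ℂ (ν 0) ∘ₗ (liftAlg _ hs).toLinearMap) hvw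
    rw [← LinearMap.comp_apply, ← LinearMap.comp_apply, LinearMap.comp_assoc, h, ← hν] at this
    exact this
  · have h1 : ∀ P : Polynomial ℂ, ∃ v, evalMono 1 r v = Polynomial.aeval (x 1 r 0) P := by
      intro P
      induction P using Polynomial.induction_on' with
      | add P P' hP hP' =>
        obtain ⟨v, hv⟩ := hP
        obtain ⟨w, hw⟩ := hP'
        exact ⟨v + w, by rw [map_add, map_add, hv, hw]⟩
      | monomial k c =>
        refine ⟨Finsupp.single (fun _ => k) c, ?_⟩
        rw [evalMono_single, mono_one, Polynomial.aeval_monomial, Algebra.smul_def]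
    have h2 : ∀ p : Alg 1 r, ∃ P : Polynomial ℂ, Polynomial.aeval (x 1 r 0) P = p := by
      intro p
      induction p using alg_induction with
      | algebraMap c => exact ⟨Polynomial.C c, Polynomial.aeval_C _ _⟩
      | gen i => exact ⟨Polynomial.X, by rw [Polynomial.aeval_X, Subsingleton.elim i 0]⟩
      | mul a b ha hb =>
        obtain ⟨P, rfl⟩ := ha
        obtain ⟨P', rfl⟩ := hb
        exact ⟨P * P', map_mul _ _ _⟩
      | add a b ha hb =>
        obtain ⟨P, rfl⟩ := ha
        obtain ⟨P', rfl⟩ := hb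
        exact ⟨P + P', map_add _ _ _⟩
    intro p
    obtain ⟨P, rfl⟩ := h2 p
    exact h1 P

theorem evalMono_bijective (N : ℕ) : Function.Bijective (evalMono N r) := by
  induction N using Nat.twoStepInduction with
  | zero => exact evalMono_zero_bijective
  | one => exact evalMono_one_bijective
  | more N ih _ =>
    -- Split off the outer exponents, curry, and use the basis for `N` in each component.
    let e : ((Fin (N + 2) → ℕ) →₀ ℂ) ≃ₗ[ℂ] (ℕ × ℕ →₀ Alg N r) :=
      Finsupp.domLCongr (glueEquiv N) ≪≫ₗ Finsupp.curryLinearEquiv ℂ ≪≫ₗ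
        Finsupp.mapRange.linearEquiv (LinearEquiv.ofBijective _ ih)
    have he : ∀ ν c, e (Finsupp.single ν c) =
        Finsupp.single (ν 0, ν (Fin.last (N + 1))) (c • mono N r fun i => ν (mid i)) := by
      intro ν c
      simp [e, glueEquiv, evalMono_single]
    have : ⇑(evalMono (N + 2) r) = fun v => decEquiv N r (Dec.of (e v)) := by
      funext v
      induction v using Finsupp.induction_linear with
      | zero => rw [map_zero, map_zero]; exact (map_zero (decEquiv N r)).symm
      | add v w hv hw => rw [map_add, hv, hw, map_add, Dec.of_add, map_add]
      | single ν c =>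
        rw [evalMono_single, he, Dec.of_single, decEquiv_mk, map_smul, ← mono_glue, glue_eta]
    rw [this]
    exact (decEquiv N r).bijective.comp e.bijective

theorem coords_mono (ν : Fin N → ℕ) : coords N r (mono N r ν) = Finsupp.single ν 1 := by
  have h : LinearMap.ker (evalMono N r) = ⊥ :=
    LinearMap.ker_eq_bot.mpr (evalMono_bijective N).injective
  have := LinearMap.leftInverse_apply_of_inj h (Finsupp.single ν 1)
  rwa [evalMono_single, one_smul] at this

theorem onMono_mono {M : Type} [AddCommGroup M] [Module ℂ M] (f : (Fin N → ℕ) → M)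
    (ν : Fin N → ℕ) : onMono N r f (mono N r ν) = f ν := by
  rw [onMono, LinearMap.comp_apply, coords_mono]; simp

theorem hom_ext_mono {M : Type} [AddCommGroup M] [Module ℂ M] {φ ψ : Alg N r →ₗ[ℂ] M}
    (h : ∀ ν, φ (mono N r ν) = ψ (mono N r ν)) : φ = ψ := by
  ext p
  obtain ⟨v, rfl⟩ := (evalMono_bijective N).surjective p
  induction v using Finsupp.induction_linear with
  | zero => simp
  | add v w hv hw => rw [map_add, map_add, map_add, hv, hw]
  | single ν c => rw [evalMono_single, map_smul, map_smul, h]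

theorem mono_induction {C : Alg N r → Prop} (mono : ∀ ν, C (mono N r ν))
    (add : ∀ a b, C a → C b → C (a + b)) (smul : ∀ (c : ℂ) a, C a → C (c • a)) (p : Alg N r) :
    C p := by
  obtain ⟨v, rfl⟩ := (evalMono_bijective N).surjective p
  induction v using Finsupp.induction_linear with
  | zero => rw [map_zero, ← zero_smul ℂ (QEuclid.mono N r 0)]; exact smul _ _ (mono 0)
  | add v w hv hw => rw [map_add]; exact add _ _ hv hw
  | single ν c => rw [evalMono_single]; exact smul _ _ (mono ν)

end Decomposition

/-! ### Sums and shifts of exponent vectors `(a, ν, b)` -/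

section GlueSums

variable {N : ℕ}

theorem sum_Ioi_zero_glue (a b : ℕ) (ν : Fin N → ℕ) :
    ∑ i ∈ Ioi (0 : Fin (N + 2)), glue a ν b i = (∑ i, ν i) + b := by
  have : Ioi (0 : Fin (N + 2)) = univ.filter fun i => 0 < i := by ext; simp
  rw [this, sum_filter, sum_fin_add_two]
  simp [zero_lt_mid]

theorem sum_Ioi_last_glue (a b : ℕ) (ν : Fin N → ℕ) :
    ∑ i ∈ Ioi (Fin.last (N + 1)), glue a ν b i = 0 :=
  sum_eq_zero fun i hi => absurd (mem_Ioi.mp hi) (not_lt.mpr (Fin.le_last i))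

theorem sum_Iio_zero_glue (a b : ℕ) (ν : Fin N → ℕ) :
    ∑ i ∈ Iio (0 : Fin (N + 2)), glue a ν b i = 0 :=
  sum_eq_zero fun i hi => absurd (mem_Iio.mp hi) (not_lt.mpr (Fin.zero_le i))

theorem sum_Ioi_mid_glue (a b : ℕ) (ν : Fin N → ℕ) (k : Fin N) :
    ∑ i ∈ Ioi (mid k), glue a ν b i = (∑ i ∈ Ioi k, ν i) + b := by
  have : Ioi (mid k) = univ.filter fun i => mid k < i := by ext; simp
  have h' : Ioi k = univ.filter fun i => k < i := by ext; simp
  rw [this, h', sum_filter, sum_filter, sum_fin_add_two]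
  simp [mid_lt_mid, mid_lt_last]

theorem sum_Ici_mid_glue (a b : ℕ) (ν : Fin N → ℕ) (k : Fin N) :
    ∑ i ∈ Ici (mid k), glue a ν b i = (∑ i ∈ Ici k, ν i) + b := by
  have : Ici (mid k) = univ.filter fun i => ¬ i < mid k := by ext; simp
  have h' : Ici k = univ.filter fun i => ¬ i < k := by ext; simp
  rw [this, h', sum_filter, sum_filter, sum_fin_add_two]
  simp [mid_lt_mid, zero_lt_mid, not_lt.mpr (Fin.le_last (mid k))]

theorem sum_Ici_zero_glue (a b : ℕ) (ν : Fin N → ℕ) :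
    ∑ i ∈ Ici (0 : Fin (N + 2)), glue a ν b i = a + (∑ i, ν i) + b := by
  have : Ici (0 : Fin (N + 2)) = univ := by ext; simp
  rw [this, sum_fin_add_two]
  simp

theorem sum_Iio_mid_glue (a b : ℕ) (ν : Fin N → ℕ) (k : Fin N) :
    ∑ i ∈ Iio (mid k), glue a ν b i = a + ∑ i ∈ Iio k, ν i := by
  have : Iio (mid k) = univ.filter fun i => i < mid k := by ext; simp
  have h' : Iio k = univ.filter fun i => i < k := by ext; simp
  rw [this, h', sum_filter, sum_filter, sum_fin_add_two]
  simp [mid_lt_mid, zero_lt_mid, not_lt.mpr (Fin.le_last (mid k))]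

theorem sum_Ico_zero_mid_glue (a b : ℕ) (ν : Fin N → ℕ) (k : Fin N) :
    ∑ i ∈ Ico 0 (mid k), glue a ν b i = a + ∑ i ∈ Iio k, ν i := by
  rw [← sum_Iio_mid_glue a b]
  congr 1

theorem sum_Ico_mid_mid_glue (a b : ℕ) (ν : Fin N → ℕ) (l k : Fin N) :
    ∑ i ∈ Ico (mid l) (mid k), glue a ν b i = ∑ i ∈ Ico l k, ν i := by
  have : Ico (mid l) (mid k) = univ.filter fun i => ¬ i < mid l ∧ i < mid k := by ext; simp
  have h' : Ico l k = univ.filter fun i => ¬ i < l ∧ i < k := by ext; simp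
  rw [this, h', sum_filter, sum_filter, sum_fin_add_two]
  simp [mid_lt_mid, zero_lt_mid, not_lt.mpr (Fin.le_last (mid k))]

theorem sum_glue (a b : ℕ) (ν : Fin N → ℕ) : ∑ i, glue a ν b i = a + (∑ i, ν i) + b := by
  simp [sum_fin_add_two]

theorem single_mid (k : Fin N) (n : ℕ) : Pi.single (mid k) n = glue 0 (Pi.single k n) 0 := by
  ext i
  induction i using fin_cases_mid with
  | zero => simp [(mid_ne_zero k).symm]
  | mid i => simp [Pi.single_apply, mid_inj]
  | last => simp [(mid_ne_last k).symm]

theorem single_zero (n : ℕ) : (Pi.single 0 n : Fin (N + 2) → ℕ) = glue n 0 0 := by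
  ext i
  induction i using fin_cases_mid with
  | zero => simp
  | mid i => simp [mid_ne_zero]
  | last => simp

theorem single_last (n : ℕ) :
    (Pi.single (Fin.last (N + 1)) n : Fin (N + 2) → ℕ) = glue 0 0 n := by
  ext i
  induction i using fin_cases_mid with
  | zero => simp
  | mid i => simp [mid_ne_last]
  | last => simp

theorem glue_sub (a b c d : ℕ) (ν μ : Fin N → ℕ) :
    glue a ν b - glue c μ d = glue (a - c) (ν - μ) (b - d) := by
  ext i
  induction i using fin_cases_mid <;> simp

theorem glue_add (a b c d : ℕ) (ν μ : Fin N → ℕ) :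
    glue a ν b + glue c μ d = glue (a + c) (ν + μ) (b + d) := by
  ext i
  induction i using fin_cases_mid <;> simp

theorem smul_glue (n a b : ℕ) (ν : Fin N → ℕ) :
    n • glue a ν b = glue (n * a) (n • ν) (n * b) := by
  ext i
  induction i using fin_cases_mid <;> simp

end GlueSums

/-! ### Diagonal automorphisms on monomials -/

section Scale

variable {N : ℕ} {r : ℂ} [Generic r]

omit [Generic r] in
theorem list_prod_smul {ι : Type} (l : List ι) (c : ι → ℂ) (y : ι → Alg N r) :
    (l.map fun i => c i • y i).prod = (l.map c).prod • (l.map y).prod := by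
  induction l with
  | nil => simp
  | cons i l ih => rw [List.map_cons, List.prod_cons, ih]; simp [smul_smul, mul_comm]

theorem scale_mono (s : Fin N → ℂ) (l : ℂ) (hs : ∀ i, s i * s i.rev = l) (ν : Fin N → ℕ) :
    scale s l hs (mono N r ν) = (∏ i, s i ^ ν i) • mono N r ν := by
  rw [mono, map_list_prod, List.map_ofFn]
  have h : (scale s l hs ∘ fun i => x N r i ^ ν i) = fun i => s i ^ ν i • x N r i ^ ν i := by
    funext i
    simp [scale, smul_pow]
  rw [h, ← List.map_id (List.ofFn fun i => s i ^ ν i • _), ← List.prod_ofFn]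
  simp only [List.ofFn_eq_map, List.map_id, list_prod_smul]

theorem theta_mono (z : ℂ) (ν : Fin N → ℕ) :
    theta N r z (mono N r ν) = z ^ (∑ i, ν i) • mono N r ν := by
  rw [theta, scale_mono, prod_pow_eq_pow_sum]

theorem theta_emb (z : ℂ) (p : Alg N r) :
    theta (N + 2) r z (emb N r p) = emb N r (theta N r z p) := by
  have : (theta (N + 2) r z).comp (emb N r) = (emb N r).comp (theta N r z) :=
    algHom_ext fun i => by simp
  exact DFunLike.congr_fun this p

theorem theta_tri (z : ℂ) (a b : ℕ) (f : Alg N r) :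
    theta (N + 2) r z (tri a b f) = z ^ (a + b) • tri a b (theta N r z f) := by
  simp only [tri_apply, map_mul, map_pow, theta_x, theta_emb, smul_pow, smul_mul_assoc,
    mul_smul_comm, smul_smul, pow_add, mul_comm (z ^ b)]

end Scale

/-! ### The normalized Laplace operator -/

section Lap

variable {N : ℕ} {r : ℂ}

/-- The `q`-number `[n]_q` for a natural number `n`. -/
def qn (r : ℂ) (n : ℕ) : ℂ := brkSym (r ^ 2) n

theorem qn_eq [Generic r] (n : ℕ) :
    qn r n = ((r ^ 2) ^ n - ((r ^ 2) ^ n)⁻¹) * r ^ 2 / (r ^ 4 - 1) := by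
  have hr := r_ne r
  have h4 := r_four_sub_one_ne r
  have h : r ^ 2 - (r ^ 2)⁻¹ = (r ^ 4 - 1) / r ^ 2 := by field_simp
  rw [qn, brkSym, zpow_neg, zpow_natCast, h, div_div_eq_mul_div]

@[simp] theorem qn_zero : qn r 0 = 0 := by simp [qn, brkSym]

/-- The value on `x ^ ν` of the Laplace operator divided by a power of `q` and a constant. -/
def lapMono (N : ℕ) (r : ℂ) (ν : Fin N → ℕ) : Alg N r :=
  ∑ j : Fin N with j < j.rev,
    (qn r (ν j) * qn r (ν j.rev) * r ^ (-rhoTwo N j)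
      * (r ^ 2) ^ ((∑ i ∈ Iio j, ν i) + ∑ i ∈ Ioi j.rev, ν i)) •
      mono N r (ν - Pi.single j 1 - Pi.single j.rev 1)
  + ∑ c : Fin N with c = c.rev,
    (brk (r ^ 2) ((ν c : ℤ) - 1) * brk (r ^ 2) (ν c) / (1 + r ^ 2)
      * (r ^ 2) ^ ((∑ i, ν i : ℕ) + 2 - 2 * (ν c : ℤ))) • mono N r (ν - 2 • Pi.single c 1)

/-- The Laplace operator up to a constant and a power of the grading automorphism. -/
def lap (N : ℕ) (r : ℂ) : Alg N r →ₗ[ℂ] Alg N r := onMono N r (lapMono N r)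

theorem zero_lt_zero_rev : (0 : Fin (N + 2)) < (0 : Fin (N + 2)).rev := by
  rw [zero_rev]; exact zero_lt_last

theorem mid_lt_rev_iff (j : Fin N) : mid j < (mid j).rev ↔ j < j.rev := by
  rw [mid_rev, mid_lt_mid]

theorem mid_eq_rev_iff (j : Fin N) : mid j = (mid j).rev ↔ j = j.rev := by
  rw [mid_rev, mid_inj]

theorem not_last_lt (i : Fin (N + 2)) : ¬ Fin.last (N + 1) < i := not_lt.mpr (Fin.le_last i)

theorem sum_filter_lt_rev {M : Type} [AddCommMonoid M] (f : Fin (N + 2) → M) :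
    ∑ j : Fin (N + 2) with j < j.rev, f j = f 0 + ∑ j : Fin N with j < j.rev, f (mid j) := by
  rw [sum_filter, sum_fin_add_two, sum_filter]
  simp only [mid_lt_rev_iff, if_pos zero_lt_zero_rev, if_neg (not_last_lt _), add_zero]

theorem sum_filter_eq_rev {M : Type} [AddCommMonoid M] (f : Fin (N + 2) → M) :
    ∑ j : Fin (N + 2) with j = j.rev, f j = ∑ j : Fin N with j = j.rev, f (mid j) := by
  rw [sum_filter, sum_fin_add_two, sum_filter]
  simp only [mid_eq_rev_iff, if_neg zero_lt_zero_rev.ne, last_rev, if_neg zero_lt_last.ne',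
    add_zero, zero_add]

variable [Generic r]

/-- The outer term of `lapMono` carries no power of `q` from the other exponents; every inner term,
the middle one included, picks up `q ^ (a+b)` from the outer exponents. -/
theorem lap_tri (a b : ℕ) (f : Alg N r) : lap (N + 2) r (tri a b f) =
    (qn r a * qn r b * r ^ (-(N : ℤ))) • tri (a - 1) (b - 1) f +
      (r ^ 2) ^ (a + b) • tri a b (lap N r f) := by
  suffices h : lap (N + 2) r ∘ₗ tri a b =
      (qn r a * qn r b * r ^ (-(N : ℤ))) • tri (a - 1) (b - 1) +
        (r ^ 2) ^ (a + b) • (tri a b ∘ₗ lap N r) from LinearMap.congr_fun h f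
  refine hom_ext_mono fun ν => ?_
  have hq := q_ne r
  simp only [LinearMap.comp_apply, LinearMap.add_apply, LinearMap.smul_apply, ← mono_glue]
  rw [lap, onMono_mono, lap, onMono_mono, lapMono, lapMono, sum_filter_lt_rev, sum_filter_eq_rev]
  simp only [zero_rev, mid_rev, glue_zero, glue_mid, glue_last, rhoTwo_zero, rhoTwo_mid,
    sum_Iio_zero_glue, sum_Ioi_last_glue, sum_Iio_mid_glue, sum_Ioi_mid_glue, single_zero,
    single_last, single_mid, smul_glue, glue_sub, sum_glue, map_add, map_sum, map_smul, smul_add,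
    smul_sum, smul_smul, mono_glue, tsub_zero, mul_zero, add_zero, pow_zero, mul_one]
  rw [add_assoc]
  congr 1
  congr 1
  · refine sum_congr rfl fun j _ => ?_
    congr 1
    ring
  · refine sum_congr rfl fun j _ => ?_
    congr 1
    have : ((a + ∑ i, ν i + b : ℕ) : ℤ) + 2 - 2 * (ν j : ℤ) =
        ((a + b : ℕ) : ℤ) + (((∑ i, ν i : ℕ) : ℤ) + 2 - 2 * (ν j : ℤ)) := by
      push_cast; ring
    rw [this, zpow_add₀ hq, zpow_natCast]
    ring

theorem partialOp_zero (a b : ℕ) (f : Alg N r) : partialOp (N + 2) r 0 (tri a b f) =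
    (qn r a * (r ^ 2) ^ b) • tri (a - 1) b (theta N r (r ^ 2) f) := by
  suffices h : partialOp (N + 2) r 0 ∘ₗ tri a b =
      (qn r a * (r ^ 2) ^ b) • (tri (a - 1) b ∘ₗ (theta N r (r ^ 2)).toLinearMap) from
    LinearMap.congr_fun h f
  refine hom_ext_mono fun ν => ?_
  simp only [LinearMap.comp_apply, LinearMap.smul_apply, AlgHom.toLinearMap_apply, theta_mono,
    map_smul, ← mono_glue]
  rw [partialOp, onMono_mono, partialMono, if_pos zero_lt_zero_rev]
  simp only [glue_zero, sum_Ioi_zero_glue, single_zero, glue_sub, tsub_zero, smul_smul]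
  congr 1
  rw [qn]; ring

/-- This is the origin of `lap`: the two sums in the formula for `∂_{1'}` add up to `x_1` times the
inner `L'`, up to the scalar shown. -/
theorem partialOp_last (a b : ℕ) (f : Alg N r) :
    partialOp (N + 2) r (Fin.last (N + 1)) (tri a b f) =
      (qn r b * (r ^ 2) ^ a) • tri a (b - 1) f +
        ((r ^ 2 - (r ^ 2)⁻¹) * r ^ (N : ℤ) * (r ^ 2) ^ (a + b)) • tri (a + 1) b (lap N r f) := by
  suffices h : partialOp (N + 2) r (Fin.last (N + 1)) ∘ₗ tri a b =
      (qn r b * (r ^ 2) ^ a) • tri a (b - 1) +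
        ((r ^ 2 - (r ^ 2)⁻¹) * r ^ (N : ℤ) * (r ^ 2) ^ (a + b)) • (tri (a + 1) b ∘ₗ lap N r) from
    LinearMap.congr_fun h f
  refine hom_ext_mono fun ν => ?_
  have hr := r_ne r
  have hq := q_ne r
  simp only [LinearMap.comp_apply, LinearMap.add_apply, LinearMap.smul_apply, ← mono_glue]
  have hf : ∀ j : Fin N, 0 < mid j ∧ mid j < (mid j).rev ↔ j < j.rev := fun j => by
    rw [mid_lt_rev_iff]; exact and_iff_right (zero_lt_mid j)
  rw [partialOp, onMono_mono, partialMono, lap, onMono_mono, lapMono, if_neg (not_last_lt _),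
    last_rev, if_neg zero_lt_last.ne', sum_filter_eq_rev, sum_filter, sum_fin_add_two]
  simp only [lt_irrefl, false_and, if_false, hf, not_last_lt, and_false, zero_add, add_zero]
  rw [← sum_filter]
  simp only [mid_rev, glue_zero, glue_mid, glue_last, rhoTwo_zero, rhoTwo_mid,
    sum_Ici_zero_glue, sum_Ioi_last_glue, sum_Ico_zero_mid_glue, sum_Ioi_mid_glue, single_zero,
    single_last, single_mid, smul_glue, glue_sub, glue_add, map_add, map_sum, map_smul, smul_add,
    smul_sum, smul_smul, mono_glue, tsub_zero, mul_zero, add_zero]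
  rw [add_assoc]
  congr 1
  congr 1
  · refine sum_congr rfl fun j _ => ?_
    congr 1
    rw [sub_eq_add_neg (N : ℤ), zpow_add₀ hr]
    simp only [qn]
    ring
  · refine sum_congr rfl fun j _ => ?_
    congr 1
    have h1 : ((a + ∑ i, ν i + b : ℕ) : ℤ) - 2 * (ν j : ℤ) =
        ((a + b : ℕ) : ℤ) + (((∑ i, ν i : ℕ) : ℤ) - 2 * (ν j : ℤ)) := by
      push_cast; ring
    have h2 : (((∑ i, ν i : ℕ) : ℤ) + 2 - 2 * (ν j : ℤ)) =
      (((∑ i, ν i : ℕ) : ℤ) - 2 * (ν j : ℤ)) + 2 := by ring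
    have h3 : r ^ ((N : ℤ) + 4) = r ^ (N : ℤ) * r ^ 4 := by rw [zpow_add₀ hr]; norm_cast
    have h4 : (r ^ 2) ^ (2 : ℤ) = r ^ 4 := by norm_cast; ring
    rw [h1, h2, h3, zpow_add₀ hq, zpow_add₀ hq _ 2, zpow_natCast (r ^ 2), h4]
    ring

theorem partialOp_mid (k : Fin N) (a b : ℕ) (f : Alg N r) :
    partialOp (N + 2) r (mid k) (tri a b f) = (r ^ 2) ^ b • tri a b (partialOp N r k f) := by
  suffices h : partialOp (N + 2) r (mid k) ∘ₗ tri a b =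
      (r ^ 2) ^ b • (tri a b ∘ₗ partialOp N r k) from LinearMap.congr_fun h f
  refine hom_ext_mono fun ν => ?_
  have hq := q_ne r
  simp only [LinearMap.comp_apply, LinearMap.smul_apply, ← mono_glue]
  rw [partialOp, onMono_mono, partialOp, onMono_mono, partialMono, partialMono]
  simp only [mid_rev, mid_lt_mid, mid_inj]
  split_ifs
  · simp only [glue_mid, sum_Ioi_mid_glue, single_mid, glue_sub, map_smul, smul_smul, mono_glue,
      tsub_zero]
    congr 1
    ring
  · simp only [glue_mid, sum_Ioi_mid_glue, single_mid, glue_sub, map_smul, smul_smul, mono_glue,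
      tsub_zero]
    congr 1
    ring
  · rw [sum_filter_eq_rev, sum_filter, sum_fin_add_two]
    have h0 : ¬ mid k.rev < 0 := not_lt.mpr (Fin.zero_le _)
    simp only [h0, false_and, if_false, not_last_lt, and_false, zero_add, add_zero]
    simp only [mid_rev, mid_lt_mid]
    rw [← sum_filter]
    simp only [glue_mid, rhoTwo_mid,
      sum_Ici_mid_glue, sum_Ico_mid_mid_glue, sum_Ioi_mid_glue, single_mid, smul_glue, glue_sub,
      glue_add, map_add, map_sum, map_smul, smul_add, smul_sum, smul_smul, mono_glue, tsub_zero,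
      mul_zero, add_zero]
    congr 1
    congr 1
    · congr 1
      ring
    · refine sum_congr rfl fun j _ => ?_
      congr 1
      ring
    · refine sum_congr rfl fun j _ => ?_
      congr 1
      have h1 : ((∑ i ∈ Ici k.rev, ν i + b : ℕ) : ℤ) - 2 * (ν j : ℤ) =
          (b : ℤ) + (((∑ i ∈ Ici k.rev, ν i : ℕ) : ℤ) - 2 * (ν j : ℤ)) := by
        push_cast; ring
      rw [h1, zpow_add₀ hq, zpow_natCast]
      ring

end Lap

/-! ### Degrees as eigenvalues of the grading automorphism -/

section Grading

variable {N : ℕ} {r : ℂ}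

/-- The value of the normalized Laplace operator on the powers of the generator for `N = 1`. -/
def lapOne (r : ℂ) (n : ℕ) : ℂ :=
  (1 - (r ^ 2) ^ n * (r ^ 2)⁻¹) * (1 - (r ^ 2) ^ n) * (r ^ 2) ^ 2 * ((r ^ 2) ^ n)⁻¹ /
    ((1 - r ^ 2) * (1 - r ^ 2) * (1 + r ^ 2))

@[simp] theorem lapOne_zero : lapOne r 0 = 0 := by simp [lapOne]

variable [Generic r]

@[simp] theorem lapOne_one : lapOne r 1 = 0 := by simp [lapOne, r_ne r]

theorem lap_zero (p : Alg 0 r) : lap 0 r p = 0 := by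
  suffices h : lap 0 r = 0 from LinearMap.congr_fun h p
  exact hom_ext_mono fun ν => by rw [lap, onMono_mono]; simp [lapMono]

theorem lap_one (n : ℕ) : lap 1 r (x 1 r 0 ^ n) = lapOne r n • x 1 r 0 ^ (n - 2) := by
  have h := mono_one (r := r) (fun _ => n)
  have hq := q_ne r
  rw [← h, lap, onMono_mono, lapMono]
  have h1 : (univ.filter fun j : Fin 1 => j < j.rev) = ∅ := by
    ext j; simp [Subsingleton.elim j.rev j]
  have h2 : (univ.filter fun j : Fin 1 => j = j.rev) = {0} := by
    ext j; simp [Subsingleton.elim j 0]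
  have h3 : (((1 * n : ℕ) : ℤ) + 2 - 2 * (n : ℤ)) = 2 - n := by push_cast; ring
  rw [h1, h2, sum_empty, zero_add, sum_singleton, mono_one]
  simp only [univ_unique, sum_const, card_singleton, smul_eq_mul, h3, Pi.sub_apply, Pi.smul_apply,
    Pi.single_eq_same, mul_one]
  congr 1
  rw [brk, brk, lapOne, zpow_sub₀ hq, zpow_sub₀ hq, zpow_natCast]
  rw [zpow_ofNat (r ^ 2) 2, zpow_one]
  simp only [div_eq_mul_inv, mul_inv]
  ring

theorem hom_ext_one {M : Type} [AddCommGroup M] [Module ℂ M] {φ ψ : Alg 1 r →ₗ[ℂ] M}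
    (h : ∀ n, φ (x 1 r 0 ^ n) = ψ (x 1 r 0 ^ n)) : φ = ψ :=
  hom_ext_mono fun ν => by rw [mono_one]; exact h _

/-- This says that `L` lowers the degree by two. -/
theorem theta_lap (z : ℂ) (p : Alg N r) :
    z ^ 2 • theta N r z (lap N r p) = lap N r (theta N r z p) := by
  induction N using Nat.twoStepInduction with
  | zero => simp [lap_zero]
  | one =>
    suffices h : z ^ 2 • ((theta 1 r z).toLinearMap ∘ₗ lap 1 r) =
        lap 1 r ∘ₗ (theta 1 r z).toLinearMap from LinearMap.congr_fun h p
    refine hom_ext_one fun n => ?_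
    simp only [LinearMap.smul_apply, LinearMap.comp_apply, AlgHom.toLinearMap_apply, lap_one,
      map_pow, theta_x, smul_pow, map_smul]
    rcases n with _ | _ | n
    · simp
    · simp
    · rw [show n + 1 + 1 - 2 = n from rfl, smul_smul, smul_smul, smul_smul]; congr 1; ring
  | more N ih _ =>
    suffices h : z ^ 2 • ((theta (N + 2) r z).toLinearMap ∘ₗ lap (N + 2) r) =
        lap (N + 2) r ∘ₗ (theta (N + 2) r z).toLinearMap from LinearMap.congr_fun h p
    refine hom_ext_tri fun a b f => ?_
    simp only [LinearMap.smul_apply, LinearMap.comp_apply, AlgHom.toLinearMap_apply, lap_tri,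
      map_smul, map_add, theta_tri, smul_add, ← ih, smul_smul]
    congr 1
    · rcases a with _ | a
      · simp
      rcases b with _ | b
      · simp
      simp only [Nat.add_sub_cancel]
      congr 1
      ring
    · congr 1
      ring

/-- `p` is homogeneous of degree `d`. -/
def IsHom (d : ℤ) (p : Alg N r) : Prop := theta N r (r ^ 2) p = (r ^ 2) ^ d • p

theorem q_zpow_inj {a b : ℤ} (h : (r ^ 2) ^ a = (r ^ 2) ^ b) : a = b := by
  have e : ∀ c : ℤ, (r ^ 2) ^ c = r ^ (2 * c) := fun c => by rw [zpow_mul]; norm_cast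
  rw [e, e] at h
  have := r_zpow_inj r h
  omega

theorem evalMono_coords (p : Alg N r) : evalMono N r (coords N r p) = p := by
  suffices h : evalMono N r ∘ₗ coords N r = LinearMap.id from LinearMap.congr_fun h p
  exact hom_ext_mono fun ν => by
    rw [LinearMap.comp_apply, coords_mono, evalMono_single, one_smul, LinearMap.id_apply]

theorem coords_theta (z : ℂ) (p : Alg N r) (ν : Fin N → ℕ) :
    coords N r (theta N r z p) ν = z ^ (∑ i, ν i) * coords N r p ν := by
  suffices h : Finsupp.lapply ν ∘ₗ coords N r ∘ₗ (theta N r z).toLinearMap =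
      z ^ (∑ i, ν i) • (Finsupp.lapply ν ∘ₗ coords N r) from LinearMap.congr_fun h p
  refine hom_ext_mono fun μ => ?_
  simp only [LinearMap.comp_apply, LinearMap.smul_apply, AlgHom.toLinearMap_apply, theta_mono,
    map_smul, coords_mono, Finsupp.lapply_apply, Finsupp.single_apply, smul_eq_mul]
  split_ifs with h
  · rw [h]
  · simp

theorem IsHom.degree_eq {d : ℤ} {p : Alg N r} (hp : IsHom d p) {ν : Fin N → ℕ}
    (hν : coords N r p ν ≠ 0) : ((∑ i, ν i : ℕ) : ℤ) = d := by
  have h1 := coords_theta (r ^ 2) p ν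
  rw [hp, map_smul, Finsupp.smul_apply, smul_eq_mul] at h1
  have h2 := mul_right_cancel₀ hν h1
  rw [← zpow_natCast] at h2
  exact (q_zpow_inj h2).symm

/-- Degrees are integers, so that `d - 2` needs no side condition; the price is this vanishing in
negative degree, used to discard the surplus terms of sums. -/
theorem IsHom.eq_zero_of_neg {d : ℤ} {p : Alg N r} (hp : IsHom d p) (hd : d < 0) : p = 0 := by
  rw [← evalMono_coords p]
  have : coords N r p = 0 := Finsupp.ext fun ν => by
    by_contra h
    have := hp.degree_eq h
    omega
  rw [this, map_zero]

theorem isHom_mono (ν : Fin N → ℕ) : IsHom ((∑ i, ν i : ℕ) : ℤ) (mono N r ν) := by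
  rw [IsHom, theta_mono, zpow_natCast]

theorem IsHom.zero (d : ℤ) : IsHom d (0 : Alg N r) := by simp [IsHom]

theorem IsHom.add {d : ℤ} {p p' : Alg N r} (hp : IsHom d p) (hp' : IsHom d p') :
    IsHom d (p + p') := by
  rw [IsHom, map_add, hp, hp', smul_add]

theorem IsHom.smul {d : ℤ} {p : Alg N r} (hp : IsHom d p) (c : ℂ) : IsHom d (c • p) := by
  rw [IsHom, map_smul, hp, smul_comm]

theorem IsHom.sub {d : ℤ} {p p' : Alg N r} (hp : IsHom d p) (hp' : IsHom d p') :
    IsHom d (p - p') := by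
  rw [IsHom, map_sub, hp, hp', smul_sub]

theorem IsHom.sum {d : ℤ} {ι : Type} (s : Finset ι) (p : ι → Alg N r)
    (hp : ∀ i ∈ s, IsHom d (p i)) : IsHom d (∑ i ∈ s, p i) := by
  rw [IsHom, map_sum, smul_sum]
  exact sum_congr rfl hp

theorem IsHom.mul {d e : ℤ} {p p' : Alg N r} (hp : IsHom d p) (hp' : IsHom e p') :
    IsHom (d + e) (p * p') := by
  rw [IsHom, map_mul, hp, hp', smul_mul_smul_comm, zpow_add₀ (q_ne r)]

theorem IsHom.pow {d : ℤ} {p : Alg N r} (hp : IsHom d p) (k : ℕ) : IsHom (k * d) (p ^ k) := by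
  rw [IsHom, map_pow, hp, smul_pow, mul_comm, zpow_mul, zpow_natCast]

theorem isHom_radius : IsHom 2 (radius N r) := by
  rw [IsHom, theta_radius]; norm_cast

theorem isHom_radius_pow (k : ℕ) : IsHom (2 * k) (radius N r ^ k) := by
  rw [mul_comm]; exact isHom_radius.pow k

theorem isHom_lap {d : ℤ} {p : Alg N r} (hp : IsHom d p) : IsHom (d - 2) (lap N r p) := by
  have hq := q_ne r
  have h := theta_lap (r ^ 2) p
  rw [hp, map_smul] at h
  rw [IsHom, zpow_sub₀ hq, div_eq_inv_mul, mul_smul, ← h, smul_smul]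
  have : (r ^ 2) ^ (2 : ℤ) = (r ^ 2) ^ 2 := by norm_cast
  rw [this, inv_mul_cancel₀ (pow_ne_zero _ hq), one_smul]

theorem IsHom.theta_inv {d : ℤ} {p : Alg N r} (hp : IsHom d p) :
    theta N r (r ^ 2)⁻¹ p = (r ^ 2) ^ (-d) • p := by
  have hq := q_ne r
  have h := theta_inv_theta hq p
  rw [hp, map_smul] at h
  rw [← h, smul_smul, ← zpow_add₀ hq, h]
  simp

theorem isHom_emb {d : ℤ} {f : Alg N r} (hf : IsHom d f) : IsHom d (emb N r f) := by
  rw [IsHom, theta_emb, hf, map_smul]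

theorem isHom_tri {d : ℤ} {f : Alg N r} (hf : IsHom d f) (a b : ℕ) :
    IsHom (a + b + d) (tri a b f) := by
  rw [IsHom, theta_tri, hf, map_smul, smul_smul, zpow_add₀ (q_ne r)]
  norm_cast

theorem mem_homog {m : ℕ} {p : Alg N r} : p ∈ homog N r m ↔ IsHom m p := by
  constructor
  · intro h
    induction h using Submodule.span_induction with
    | mem p hp =>
      obtain ⟨ν, rfl, rfl⟩ := hp
      exact isHom_mono ν
    | zero => exact IsHom.zero _
    | add p p' _ _ hp hp' => exact hp.add hp'
    | smul c p _ hp => exact hp.smul c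
  · intro h
    rw [← evalMono_coords p, evalMono, Finsupp.linearCombination_apply]
    refine Submodule.sum_mem _ fun ν hν => Submodule.smul_mem _ _ (Submodule.subset_span ?_)
    exact ⟨ν, by exact_mod_cast h.degree_eq (Finsupp.mem_support_iff.mp hν), rfl⟩

end Grading

/-! ### The Laplace operator -/

section Laplace

variable {N : ℕ} {r : ℂ} [Generic r]

/-- The constant which relates the two Laplace operators. -/
def lapConst (N : ℕ) (r : ℂ) : ℂ := ((r ^ 2) ^ ((N : ℤ) - 2) + 1) / r ^ 2

theorem lapConst_ne_zero (N : ℕ) : lapConst N r ≠ 0 := by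
  refine div_ne_zero ?_ (q_ne r)
  have := r_zpow_add_ne_zero r (2 * ((N : ℤ) - 2)) 0
  rw [zpow_mul, zpow_zero] at this
  exact_mod_cast this

theorem partialOp_one (n : ℕ) :
    partialOp 1 r 0 (x 1 r 0 ^ n) = brk (r ^ 2) n • x 1 r 0 ^ (n - 1) := by
  have h := mono_one (r := r) (fun _ => n)
  have h0 : (0 : Fin 1).rev = 0 := Subsingleton.elim _ _
  rw [← h, partialOp, onMono_mono, partialMono]
  simp [h0, mono_one]

theorem lap_theta_tri (a b : ℕ) (f : Alg N r) :
    lap (N + 2) r (theta (N + 2) r (r ^ 2) (tri a b f)) =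
    (r ^ 2) ^ (a + b) • ((qn r a * qn r b * r ^ (-(N : ℤ))) •
      tri (a - 1) (b - 1) (theta N r (r ^ 2) f) +
      (r ^ 2) ^ (a + b) • tri a b (lap N r (theta N r (r ^ 2) f))) := by
  rw [theta_tri, map_smul, lap_tri]

/-- The inner summands of `Δ_q` give `q ^ (2b) Δ_q'`, to which induction applies. The two outer
summands contribute the lowering term and multiples of `L' θ f`, which combine with the inner part
into the constant for `N + 2`. -/
theorem laplace_eq (p : Alg N r) :
    laplace N r p = lapConst N r • lap N r (theta N r (r ^ 2) p) := by
  have hr := r_ne r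
  have h1 := r_sq_sub_one_ne r
  have h2 := r_sq_add_one_ne r
  have h3 := r_four_sub_one_ne r
  induction N using Nat.twoStepInduction with
  | zero => simp [laplace, lap_zero]
  | one =>
    suffices h : laplace 1 r = lapConst 1 r • (lap 1 r ∘ₗ (theta 1 r (r ^ 2)).toLinearMap) from
      LinearMap.congr_fun h p
    refine hom_ext_one fun n => ?_
    have h0 : (0 : Fin 1).rev = 0 := Subsingleton.elim _ _
    simp only [laplace, univ_unique, sum_singleton, LinearMap.smul_apply, LinearMap.comp_apply,
      Fin.default_eq_zero, h0, partialOp_one, map_smul, AlgHom.toLinearMap_apply, map_pow,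
      theta_x, smul_pow, lap_one, smul_smul, Nat.sub_sub, rhoTwo_self h0.symm, lapConst]
    rcases n with _ | n
    · simp [brk]
    congr 1
    simp only [brk, lapOne, Nat.add_sub_cancel, zpow_natCast]
    have h4 : 1 - r ^ 2 ≠ 0 := by rw [← neg_sub]; exact neg_ne_zero.mpr h1
    have h5 : (1 : ℂ) + r ^ 2 ≠ 0 := by rw [add_comm]; exact h2
    norm_num
    field_simp
    ring
  | more N ih _ =>
    suffices h : laplace (N + 2) r =
        lapConst (N + 2) r • (lap (N + 2) r ∘ₗ (theta (N + 2) r (r ^ 2)).toLinearMap) from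
      LinearMap.congr_fun h p
    refine hom_ext_tri fun a b f => ?_
    have hmid : ∑ i : Fin N, r ^ rhoTwo (N + 2) (mid i) •
        (partialOp (N + 2) r (mid i) (partialOp (N + 2) r (mid i).rev (tri a b f))) =
        (r ^ 2) ^ (b + b) • tri a b (laplace N r f) := by
      simp only [mid_rev, partialOp_mid, map_smul, rhoTwo_mid, laplace, LinearMap.sum_apply,
        LinearMap.smul_apply, LinearMap.comp_apply, map_sum, smul_sum, smul_smul, pow_add]
      refine sum_congr rfl fun i _ => ?_
      congr 1
      ring
    have hθ := theta_lap (r ^ 2) f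
    have hθ' : theta N r (r ^ 2) (lap N r f) =
        ((r ^ 2) ^ 2)⁻¹ • lap N r (theta N r (r ^ 2) f) := by
      rw [← hθ, smul_smul, inv_mul_cancel₀ (pow_ne_zero _ (q_ne r)), one_smul]
    have hw : r ^ (N : ℤ) ≠ 0 := zpow_ne_zero _ hr
    have hK : lapConst (N + 2) r = (r ^ (N : ℤ) * r ^ (N : ℤ) + 1) / r ^ 2 := by
      rw [lapConst]
      congr 2
      rw [show ((N + 2 : ℕ) : ℤ) - 2 = N by push_cast; ring, zpow_natCast, zpow_natCast, ← pow_mul,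
        ← pow_add, two_mul]
    have hK' : lapConst N r = (r ^ (N : ℤ) * r ^ (N : ℤ) * ((r ^ 2) ^ 2)⁻¹ + 1) / r ^ 2 := by
      rw [lapConst, zpow_sub₀ (q_ne r), div_eq_mul_inv]
      congr 3
      · rw [zpow_natCast, zpow_natCast, ← pow_mul, ← pow_add, two_mul]
    simp only [LinearMap.smul_apply, LinearMap.comp_apply, AlgHom.toLinearMap_apply,
      lap_theta_tri]
    rw [laplace]
    simp only [LinearMap.sum_apply, LinearMap.smul_apply, LinearMap.comp_apply]
    rw [sum_fin_add_two, hmid, ih, zero_rev, last_rev, rhoTwo_zero, rhoTwo_last, hK, hK', zpow_neg]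
    simp only [partialOp_last, partialOp_zero, map_add, map_smul, hθ']
    generalize lap N r (theta N r (r ^ 2) f) = g
    generalize theta N r (r ^ 2) f = f'
    generalize r ^ (N : ℤ) = w at *
    -- The split removes the truncated `a - 1` and `b - 1`; in the zero cases the factor `[0]_q`
    -- kills the lowering term. What is left is an identity of rational functions for each
    -- coefficient.
    rcases a with _ | a <;> rcases b with _ | b <;>
    · simp only [qn_zero, Nat.add_sub_cancel, zero_mul, mul_zero, zero_smul]
      match_scalars <;> simp only [qn_eq] <;> field_simp <;> ring

end Laplace

/-! ### The commutator of `lap` and `Q` -/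

section Radius

variable {N : ℕ} {r : ℂ} [Generic r]

theorem rN_sq_add_ne (N : ℕ) : (r ^ (N : ℤ)) ^ 2 + r ^ 4 ≠ 0 := by
  have := r_zpow_add_ne_zero r (2 * (N : ℤ)) 4
  rw [mul_comm, zpow_mul] at this
  exact_mod_cast this

theorem rN_sq_add_one_ne (N : ℕ) : (r ^ (N : ℤ)) ^ 2 + 1 ≠ 0 := by
  have := r_zpow_add_ne_zero r (2 * (N : ℤ)) 0
  rw [mul_comm, zpow_mul] at this
  exact_mod_cast this

theorem crossCoeff_eq : crossCoeff r N =
    (r ^ 4 - 1) * r ^ (N : ℤ) / ((r ^ (N : ℤ)) ^ 2 + r ^ 4) := by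
  have hr := r_ne r
  have hw : r ^ (N : ℤ) ≠ 0 := zpow_ne_zero _ hr
  have h := rN_sq_add_ne (r := r) N
  have h' : r ^ ((N : ℤ) - 2) + r ^ (-(N : ℤ) + 2) =
      ((r ^ (N : ℤ)) ^ 2 + r ^ 4) / (r ^ (N : ℤ) * r ^ 2) := by
    rw [zpow_sub₀ hr, zpow_add₀ hr, zpow_neg, show r ^ (2 : ℤ) = r ^ 2 by norm_cast]
    generalize r ^ (N : ℤ) = w at *
    field_simp
  rw [crossCoeff, h']
  generalize r ^ (N : ℤ) = w at *
  field_simp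

theorem alphaC_eq : alphaC N r = ((r ^ (N : ℤ)) ^ 2 + 1) / r ^ (N : ℤ) := by
  have hw : r ^ (N : ℤ) ≠ 0 := zpow_ne_zero _ (r_ne r)
  rw [alphaC, zpow_neg]
  generalize r ^ (N : ℤ) = w at *
  field_simp

theorem betaC_eq : betaC N r =
    r ^ 4 * ((r ^ (N : ℤ)) ^ 2 + 1) / ((r ^ (N : ℤ)) ^ 2 + r ^ 4) := by
  have h := rN_sq_add_ne (r := r) N
  rw [betaC, crossCoeff_eq]
  generalize r ^ (N : ℤ) = w at *
  field_simp
  ring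

theorem betaC_ne_zero (N : ℕ) : betaC N r ≠ 0 := by
  rw [betaC_eq]
  exact div_ne_zero (mul_ne_zero (pow_ne_zero _ (r_ne r)) (rN_sq_add_one_ne N)) (rN_sq_add_ne N)

theorem gam_eq (a : ℕ) : gam N r a = r ^ (N : ℤ) * r ^ 4 / ((r ^ (N : ℤ)) ^ 2 + r ^ 4) *
    (1 - (((r ^ 2) ^ a) ^ 2)⁻¹) := by
  have hr := r_ne r
  have h := rN_sq_add_ne (r := r) N
  have h4 := r_four_sub_one_ne r
  have hg := mul_neg_geom_sum ((r ^ 2)⁻¹ ^ 2) a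
  have h1 : 1 - (r ^ 2)⁻¹ ^ 2 = (r ^ 4 - 1) / r ^ 4 := by field_simp
  have h2 : ((r ^ 2)⁻¹ ^ 2) ^ a = (((r ^ 2) ^ a) ^ 2)⁻¹ := by
    generalize r ^ 2 = Q
    rw [inv_pow, inv_pow, ← pow_mul, ← pow_mul, mul_comm 2 a]
  rw [h1, h2] at hg
  have h3 : ∑ i ∈ range a, ((r ^ 2)⁻¹ ^ 2) ^ i =
      r ^ 4 / (r ^ 4 - 1) * (1 - (((r ^ 2) ^ a) ^ 2)⁻¹) := by
    rw [← hg]; field_simp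
  rw [gam, crossCoeff_eq, h3]
  field_simp

/-- The `Q'` produced by `x_{1'} x_1 ^ a` and the `Q'` of the radius itself add up to exactly `β`,
whatever `a` is. This is what makes `Q` act on boundary components by a constant times `Q'`. -/
theorem radius_mul_tri (a b : ℕ) (f : Alg N r) : radius (N + 2) r * tri a b f =
    alphaC N r • tri (a + 1) (b + 1) (theta N r (r ^ 2)⁻¹ f) +
      betaC N r • tri a b (radius N r * f) := by
  have h1 : gam N r a • xf N r * tri (a - 1) b (radius N r * f) =
      gam N r a • tri a b (radius N r * f) := by
    rcases a with _ | a
    · simp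
    · rw [smul_mul_assoc, xf_mul_tri]; rfl
  have h2 : alphaC N r * gam N r a + betaC N r * (((r ^ 2) ^ a) ^ 2)⁻¹ = betaC N r := by
    have h := rN_sq_add_ne (r := r) N
    have hr := r_ne r
    have hw : r ^ (N : ℤ) ≠ 0 := zpow_ne_zero _ hr
    rw [alphaC_eq, betaC_eq, gam_eq]
    generalize r ^ (N : ℤ) = w at *
    field_simp
    ring
  rw [radius_add_two, add_mul, smul_mul_assoc, smul_mul_assoc, mul_assoc, xl_mul_tri, mul_add,
    mul_smul_comm, ← smul_mul_assoc, h1, xf_mul_tri, emb_mul_tri, theta_radius, smul_mul_assoc,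
    map_smul, smul_add, smul_smul, smul_smul, add_assoc, ← add_smul, inv_pow, inv_pow, h2]

/-- The constant in the commutator of the Laplace operator and `Q`. -/
def radConst (N : ℕ) (r : ℂ) : ℂ := (1 + (r ^ 2) ^ (2 - (N : ℤ))) / (r ^ 4 - 1)

theorem radConst_ne_zero (N : ℕ) : radConst N r ≠ 0 := by
  refine div_ne_zero ?_ (r_four_sub_one_ne r)
  have := r_zpow_add_ne_zero r 0 (2 * (2 - (N : ℤ)))
  rw [zpow_mul, zpow_zero] at this
  exact_mod_cast this

theorem radConst_eq (N : ℕ) :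
    radConst N r = ((r ^ (N : ℤ)) ^ 2 + r ^ 4) / ((r ^ (N : ℤ)) ^ 2 * (r ^ 4 - 1)) := by
  have hw : r ^ (N : ℤ) ≠ 0 := zpow_ne_zero _ (r_ne r)
  have h4 := r_four_sub_one_ne r
  have e : (r ^ 2) ^ N = (r ^ (N : ℤ)) ^ 2 := by
    rw [zpow_natCast, ← pow_mul, ← pow_mul, mul_comm]
  rw [radConst, zpow_sub₀ (q_ne r), zpow_natCast (r ^ 2), e,
    show (r ^ 2) ^ (2 : ℤ) = r ^ 4 by norm_cast; ring]
  generalize r ^ (N : ℤ) = w at *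
  field_simp

theorem theta_eq_self (z : ℂ) (p : Alg 0 r) : theta 0 r z p = p := by
  have : theta 0 r z = AlgHom.id ℂ _ := algHom_ext fun i => i.elim0
  exact DFunLike.congr_fun this p

/-- On degree `d` the right-hand correction is a scalar, so `Q` and `L` behave like the raising and
lowering operators of a `q`-deformed `sl_2`. -/
theorem lap_radius_mul (p : Alg N r) : lap N r (radius N r * p) = radius N r * lap N r p +
    radConst N r • ((r ^ 2) ^ N • theta N r (r ^ 2) p - theta N r (r ^ 2)⁻¹ p) := by
  have hr := r_ne r
  have h4 := r_four_sub_one_ne r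
  have h2 := r_sq_sub_one_ne r
  have h1 := r_sq_add_one_ne r
  induction N using Nat.twoStepInduction with
  | zero => simp [lap_zero, theta_eq_self]
  | one =>
    suffices h : lap 1 r ∘ₗ LinearMap.mulLeft ℂ (radius 1 r) =
        LinearMap.mulLeft ℂ (radius 1 r) ∘ₗ lap 1 r + radConst 1 r •
          ((r ^ 2) ^ 1 • (theta 1 r (r ^ 2)).toLinearMap - (theta 1 r (r ^ 2)⁻¹).toLinearMap) from
      LinearMap.congr_fun h p
    refine hom_ext_one fun n => ?_
    simp only [LinearMap.comp_apply, LinearMap.add_apply, LinearMap.sub_apply,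
      LinearMap.smul_apply, LinearMap.mulLeft_apply, AlgHom.toLinearMap_apply, radius_one, lap_one,
      map_pow, theta_x, smul_pow, mul_smul_comm]
    have e1 : x 1 r 0 * x 1 r 0 * x 1 r 0 ^ n = x 1 r 0 ^ (n + 2) := by
      rw [← sq, ← pow_add, add_comm]
    have e2 : lapOne r n • (x 1 r 0 * x 1 r 0 * x 1 r 0 ^ (n - 2)) = lapOne r n • x 1 r 0 ^ n := by
      rcases n with _ | _ | n
      · simp
      · simp
      · rw [← sq, ← pow_add, add_comm 2]; rfl
    rw [e1, e2, lap_one, Nat.add_sub_cancel]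
    have h5 : 1 - r ^ 2 ≠ 0 := by rw [← neg_sub]; exact neg_ne_zero.mpr h2
    have h6 : (1 : ℂ) + r ^ 2 ≠ 0 := by rw [add_comm]; exact h1
    have h7 : radConst 1 r = 1 / (r ^ 2 - 1) := by
      rw [radConst]
      norm_num
      field_simp
      ring
    rw [h7]
    match_scalars
    simp only [lapOne, pow_add, inv_pow]
    field_simp
    ring
  | more N ih _ =>
    suffices h : lap (N + 2) r ∘ₗ LinearMap.mulLeft ℂ (radius (N + 2) r) =
        LinearMap.mulLeft ℂ (radius (N + 2) r) ∘ₗ lap (N + 2) r + radConst (N + 2) r •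
          ((r ^ 2) ^ (N + 2) • (theta (N + 2) r (r ^ 2)).toLinearMap -
            (theta (N + 2) r (r ^ 2)⁻¹).toLinearMap) from
      LinearMap.congr_fun h p
    refine hom_ext_tri fun a b f => ?_
    have hθ := theta_lap (r ^ 2)⁻¹ f
    have hθ' : theta N r (r ^ 2)⁻¹ (lap N r f) =
        (r ^ 2) ^ 2 • lap N r (theta N r (r ^ 2)⁻¹ f) := by
      rw [← hθ, smul_smul, inv_pow, mul_inv_cancel₀ (pow_ne_zero _ (q_ne r)), one_smul]
    have hw : r ^ (N : ℤ) ≠ 0 := zpow_ne_zero _ hr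
    have hN := rN_sq_add_ne (r := r) N
    have e : (r ^ 2) ^ N = (r ^ (N : ℤ)) ^ 2 := by
      rw [zpow_natCast, ← pow_mul, ← pow_mul, mul_comm]
    have hB := radConst_eq (r := r) N
    have hB' : radConst (N + 2) r =
        ((r ^ (N : ℤ)) ^ 2 + 1) / ((r ^ (N : ℤ)) ^ 2 * (r ^ 4 - 1)) := by
      rw [radConst, show (2 - ((N + 2 : ℕ) : ℤ)) = -(N : ℤ) by push_cast; ring, zpow_neg,
        zpow_natCast (r ^ 2), e]
      generalize r ^ (N : ℤ) = w at *
      field_simp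
    simp only [LinearMap.comp_apply, LinearMap.add_apply, LinearMap.sub_apply,
      LinearMap.smul_apply, LinearMap.mulLeft_apply, AlgHom.toLinearMap_apply, radius_mul_tri,
      lap_tri, map_add, map_sub, map_smul, mul_add, theta_tri, ih, hθ', hB, hB',
      alphaC_eq, betaC_eq, pow_add (r ^ 2) N 2, e, zpow_neg,
      inv_pow]
    generalize lap N r (theta N r (r ^ 2)⁻¹ f) = g
    generalize theta N r (r ^ 2) f = f'
    generalize r ^ (N : ℤ) = w at *
    rcases a with _ | a <;> rcases b with _ | b <;>
    · simp only [qn_zero, Nat.add_sub_cancel, zero_mul, mul_zero, zero_smul]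
      match_scalars <;> (try simp only [qn_eq]) <;> field_simp <;> ring

end Radius

/-! ### The `q`-Serre relation between `lap` and a generator -/

section Serre

variable {N : ℕ} {r : ℂ} [Generic r]

-- Left multiplication by `x_{1'}` involves `Q'`, so this case rests on `lap_radius_mul` for the
-- inner variables and not on the relation for smaller `N`.
set_option maxHeartbeats 1600000 in
theorem lap_serre_last :
    lap (N + 2) r ∘ₗ lap (N + 2) r ∘ₗ LinearMap.mulLeft ℂ (xl N r) +
      LinearMap.mulLeft ℂ (xl N r) ∘ₗ lap (N + 2) r ∘ₗ lap (N + 2) r =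
    (r ^ 2 + (r ^ 2)⁻¹) •
      (lap (N + 2) r ∘ₗ LinearMap.mulLeft ℂ (xl N r) ∘ₗ lap (N + 2) r) := by
  refine hom_ext_tri fun a b f => ?_
  have hr := r_ne r
  have h4 := r_four_sub_one_ne r
  have hw : r ^ (N : ℤ) ≠ 0 := zpow_ne_zero _ hr
  have hN := rN_sq_add_ne (r := r) N
  have e : (r ^ 2) ^ N = (r ^ (N : ℤ)) ^ 2 := by
    rw [zpow_natCast, ← pow_mul, ← pow_mul, mul_comm]
  have h1 : ∀ g : Alg N r, theta N r (r ^ 2)⁻¹ (lap N r g) =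
      (r ^ 2) ^ 2 • lap N r (theta N r (r ^ 2)⁻¹ g) := fun g => by
    rw [← theta_lap, smul_smul, inv_pow, mul_inv_cancel₀ (pow_ne_zero _ (q_ne r)), one_smul]
  have h2 : ∀ g : Alg N r, theta N r (r ^ 2) (lap N r g) =
      ((r ^ 2) ^ 2)⁻¹ • lap N r (theta N r (r ^ 2) g) := fun g => by
    rw [← theta_lap, smul_smul, inv_mul_cancel₀ (pow_ne_zero _ (q_ne r)), one_smul]
  simp only [LinearMap.comp_apply, LinearMap.add_apply, LinearMap.smul_apply,
    LinearMap.mulLeft_apply, xl_mul_tri, lap_tri, map_add, map_sub, map_smul,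
    zpow_neg, lap_radius_mul, h1, h2, gam_eq, radConst_eq, e]
  generalize r ^ (N : ℤ) = w at *
  generalize radius N r * lap N r (lap N r f) = g1
  generalize radius N r * lap N r f = g2
  generalize radius N r * f = g3
  generalize lap N r (lap N r (theta N r (r ^ 2)⁻¹ f)) = g4
  generalize lap N r (theta N r (r ^ 2)⁻¹ f) = g5
  generalize lap N r (theta N r (r ^ 2) f) = g6
  generalize theta N r (r ^ 2)⁻¹ f = g7
  generalize theta N r (r ^ 2) f = g8
  -- Two applications of `L` can lower each exponent by two, so exponents `0` and `1` are both
  -- special.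
  rcases a with _ | _ | a <;> rcases b with _ | _ | b <;>
  · simp only [qn_zero, Nat.add_sub_cancel, zero_mul, mul_zero, zero_smul]
    match_scalars <;> (try simp only [qn_eq]) <;> field_simp <;> ring

/-- For `x_1` this is a computation with `q`-numbers, and for inner generators it reduces to the
relation for `N`. It serves as a substitute for the vanishing of the double commutator of the
classical Laplacian with a coordinate. -/
theorem lap_serre (i : Fin N) (p : Alg N r) :
    lap N r (lap N r (x N r i * p)) + x N r i * lap N r (lap N r p) =
      (r ^ 2 + (r ^ 2)⁻¹) • lap N r (x N r i * lap N r p) := by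
  have hr := r_ne r
  have h4 := r_four_sub_one_ne r
  have h2 := r_sq_sub_one_ne r
  have h1 := r_sq_add_one_ne r
  induction N using Nat.twoStepInduction with
  | zero => exact i.elim0
  | one =>
    rw [Subsingleton.elim i 0]
    suffices h : lap 1 r ∘ₗ lap 1 r ∘ₗ LinearMap.mulLeft ℂ (x 1 r 0) +
        LinearMap.mulLeft ℂ (x 1 r 0) ∘ₗ lap 1 r ∘ₗ lap 1 r = (r ^ 2 + (r ^ 2)⁻¹) •
        (lap 1 r ∘ₗ LinearMap.mulLeft ℂ (x 1 r 0) ∘ₗ lap 1 r) from LinearMap.congr_fun h p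
    refine hom_ext_one fun n => ?_
    simp only [LinearMap.comp_apply, LinearMap.add_apply, LinearMap.smul_apply,
      LinearMap.mulLeft_apply, ← pow_succ', lap_one, map_smul]
    have h5 : 1 - r ^ 2 ≠ 0 := by rw [← neg_sub]; exact neg_ne_zero.mpr h2
    have h6 : (1 : ℂ) + r ^ 2 ≠ 0 := by rw [add_comm]; exact h1
    rcases n with _ | _ | _ | n
    · simp
    · simp
    · simp only [Nat.reduceAdd, Nat.reduceSub, lapOne_zero, lapOne_one, zero_smul, smul_zero,
        add_zero]
    · have e1 : n + 1 + 1 + 1 + 1 - 2 - 2 = n := by omega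
      have e2 : lapOne r (n + 1 + 1 + 1 - 2) • x 1 r 0 ^ (n + 1 + 1 + 1 - 2 - 2 + 1) =
          lapOne r (n + 1 + 1 + 1 - 2) • x 1 r 0 ^ n := by
        rcases n with _ | n
        · simp
        · rfl
      have e3 : n + 1 + 1 + 1 - 2 + 1 - 2 = n := by omega
      rw [e1, e2, e3]
      simp only [show n + 1 + 1 + 1 + 1 - 2 = n + 2 by omega,
        show n + 1 + 1 + 1 - 2 = n + 1 by omega]
      match_scalars
      simp only [lapOne, pow_add]
      field_simp
      ring
  | more N ih _ =>
    have hw : r ^ (N : ℤ) ≠ 0 := zpow_ne_zero _ hr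
    have hN := rN_sq_add_ne (r := r) N
    suffices h : lap (N + 2) r ∘ₗ lap (N + 2) r ∘ₗ LinearMap.mulLeft ℂ (x (N + 2) r i) +
        LinearMap.mulLeft ℂ (x (N + 2) r i) ∘ₗ lap (N + 2) r ∘ₗ lap (N + 2) r =
        (r ^ 2 + (r ^ 2)⁻¹) •
          (lap (N + 2) r ∘ₗ LinearMap.mulLeft ℂ (x (N + 2) r i) ∘ₗ lap (N + 2) r) from
      LinearMap.congr_fun h p
    refine hom_ext_tri fun a b f => ?_
    simp only [LinearMap.comp_apply, LinearMap.add_apply, LinearMap.smul_apply,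
      LinearMap.mulLeft_apply]
    induction i using fin_cases_mid with
    | zero =>
      simp only [xf_mul_tri, lap_tri, map_add, map_smul, mul_add, mul_smul_comm, zpow_neg]
      generalize r ^ (N : ℤ) = w at *
      rcases a with _ | _ | a <;> rcases b with _ | _ | b <;>
      · simp only [qn_zero, Nat.add_sub_cancel, zero_mul, mul_zero, zero_smul]
        match_scalars <;> (try simp only [qn_eq]) <;> field_simp <;> ring
    | mid i =>
      have hi : lap N r (lap N r (x N r i * f)) =
          (r ^ 2 + (r ^ 2)⁻¹) • lap N r (x N r i * lap N r f) - x N r i * lap N r (lap N r f) := by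
        rw [← ih i f, add_sub_cancel_right]
      simp only [x_mid_mul_tri, lap_tri, map_add, map_smul, mul_add, mul_smul_comm, hi, map_sub,
        zpow_neg, inv_pow]
      generalize r ^ (N : ℤ) = w at *
      rcases a with _ | _ | a <;> rcases b with _ | _ | b <;>
      · simp only [qn_zero, Nat.add_sub_cancel, zero_mul, mul_zero, zero_smul]
        match_scalars <;> (try simp only [qn_eq]) <;> field_simp <;> ring
    | last => exact LinearMap.congr_fun lap_serre_last (tri a b f)

end Serre

/-! ### The `*`-operation and its commutation with `lap` -/

section Star

variable {N : ℕ} {r : ℂ} [Generic r] {σ : ℂ →+* ℂ}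

theorem tri_induction {C : Alg (N + 2) r → Prop} (tri : ∀ a b f, C (tri a b f))
    (add : ∀ p p', C p → C p' → C (p + p')) (p : Alg (N + 2) r) : C p := by
  obtain ⟨m, rfl⟩ := (decEquiv N r).surjective p
  have : ∀ v : ℕ × ℕ →₀ Alg N r, C (decEquiv N r (Dec.of v)) := by
    intro v
    induction v using Finsupp.induction_linear with
    | zero =>
      have := tri 0 0 0
      rw [map_zero] at this
      rwa [show decEquiv N r (Dec.of 0) = 0 from map_zero (decEquiv N r)]
    | add v w hv hw => rw [Dec.of_add, map_add]; exact add _ _ hv hw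
    | single ab f => rw [show Dec.of (Finsupp.single ab f) = Dec.mk ab.1 ab.2 f from rfl, decEquiv_mk]; exact tri _ _ _
  exact this m

/-- The `*`-operation as a map of the algebra to itself. -/
def st (hσ : Fixes N r σ) (p : Alg N r) : Alg N r := (starHom N (r_ne r) hσ p).unop

variable (hσ : Fixes N r σ)

theorem st_add (p p' : Alg N r) : st hσ (p + p') = st hσ p + st hσ p' := by simp [st]

theorem st_mul (p p' : Alg N r) : st hσ (p * p') = st hσ p' * st hσ p := by simp [st]

theorem st_one : st hσ (1 : Alg N r) = 1 := by simp [st]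

theorem st_zero : st hσ (0 : Alg N r) = 0 := by simp [st]

theorem st_pow (p : Alg N r) (k : ℕ) : st hσ (p ^ k) = st hσ p ^ k := by simp [st]

theorem starHom_mk (w : FreeAlgebra ℂ (Fin N)) :
    starHom N (r_ne r) hσ (RingQuot.mkAlgHom ℂ (Rel N r) w) = starFree N r σ w := by
  have : RingQuot.mkAlgHom ℂ (Rel N r) w = RingQuot.mkRingHom (Rel N r) w := by
    rw [← RingQuot.mkAlgHom_coe ℂ]; rfl
  rw [this, starHom, RingQuot.lift_mkRingHom_apply]

theorem st_x (i : Fin N) : st hσ (x N r i) = r ^ rhoTwo N i.rev • x N r i.rev := by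
  rw [st, x, starHom_mk, starFree_ι]; rfl

theorem st_smul (c : ℂ) (p : Alg N r) : st hσ (c • p) = σ c • st hσ p := by
  obtain ⟨w, rfl⟩ := RingQuot.mkAlgHom_surjective ℂ (Rel N r) p
  rw [st, st, ← map_smul, starHom_mk, starHom_mk, starFree_smul]; rfl

theorem st_algebraMap (c : ℂ) :
    st hσ (algebraMap ℂ (Alg N r) c) = algebraMap ℂ (Alg N r) (σ c) := by
  rw [Algebra.algebraMap_eq_smul_one, st_smul, st_one, Algebra.algebraMap_eq_smul_one]

omit [Generic r] in
theorem Fixes.inner (hσ : Fixes (N + 2) r σ) : Fixes N r σ :=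
  ⟨hσ.1, fun h => hσ.2 (h.add_even even_two)⟩

theorem st_st (hinv : ∀ c, σ (σ c) = c) (p : Alg N r) : st hσ (st hσ p) = p := by
  induction p using alg_induction with
  | algebraMap c => rw [st_algebraMap, st_algebraMap, hinv]
  | gen i =>
    rw [st_x, st_smul, st_x, hσ.rho, Fin.rev_rev, smul_smul, rhoTwo_rev, ← zpow_add₀ (r_ne r)]
    simp
  | mul a b ha hb => rw [st_mul, st_mul, ha, hb]
  | add a b ha hb => rw [st_add, st_add, ha, hb]

theorem theta_st (p : Alg N r) :
    theta N r (r ^ 2) (st hσ p) = st hσ (theta N r (r ^ 2) p) := by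
  induction p using alg_induction with
  | algebraMap c => rw [st_algebraMap, AlgHom.commutes, AlgHom.commutes, st_algebraMap]
  | gen i => rw [theta_x, st_smul, st_x, map_smul, theta_x, hσ.1, smul_comm]
  | mul a b ha hb => rw [st_mul, map_mul, map_mul, ha, hb, st_mul]
  | add a b ha hb => rw [st_add, map_add, map_add, ha, hb, st_add]

theorem isHom_st {d : ℤ} {p : Alg N r} (hp : IsHom d p) : IsHom d (st hσ p) := by
  rw [IsHom, theta_st, hp, st_smul, map_zpow₀, hσ.1]

theorem st_emb (hσ : Fixes (N + 2) r σ) (p : Alg N r) :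
    st hσ (emb N r p) = emb N r (st hσ.inner p) := by
  induction p using alg_induction with
  | algebraMap c => rw [st_algebraMap, AlgHom.commutes, AlgHom.commutes, st_algebraMap]
  | gen i => rw [emb_x, st_x, st_x, map_smul, emb_x, mid_rev, rhoTwo_mid]
  | mul a b ha hb => rw [st_mul, map_mul, map_mul, ← ha, ← hb, st_mul]
  | add a b ha hb => rw [map_add, st_add, st_add, map_add, ha, hb]

theorem st_xf (hσ : Fixes (N + 2) r σ) : st hσ (xf N r) = (r ^ (N : ℤ))⁻¹ • xl N r := by
  rw [st_x, zero_rev, rhoTwo_last, zpow_neg]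

theorem st_xl (hσ : Fixes (N + 2) r σ) : st hσ (xl N r) = r ^ (N : ℤ) • xf N r := by
  rw [st_x, last_rev, rhoTwo_zero]

theorem st_tri (hσ : Fixes (N + 2) r σ) (a b : ℕ) (f : Alg N r) :
    st hσ (tri a b f) = ((r ^ (N : ℤ)) ^ b * ((r ^ (N : ℤ)) ^ a)⁻¹) • tri b a (st hσ.inner f) := by
  rw [tri_apply, st_mul, st_mul, st_pow, st_pow, st_emb, st_xf, st_xl, smul_pow, smul_pow,
    mul_smul_comm, smul_mul_assoc, mul_smul_comm, smul_smul, tri_apply, inv_pow, mul_assoc]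

theorem Fixes.qn (hσ : Fixes N r σ) (n : ℕ) : σ (qn r n) = qn r n := by
  have h : σ (r ^ 4) = r ^ 4 := by
    rw [show r ^ 4 = (r ^ 2) ^ 2 by ring, map_pow, hσ.1]
  simp only [qn_eq, map_div₀, map_mul, map_sub, map_inv₀, map_one, h]
  rw [map_pow, hσ.1]

/-- The `*`-operation exchanges the outer exponents, and `lap_tri` is symmetric in them. The powers
of `q ^ ρ_1` agree because `a - b` does not change under lowering. -/
theorem lap_st (p : Alg N r) : lap N r (st hσ p) = st hσ (lap N r p) := by
  induction N using Nat.twoStepInduction with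
  | zero => rw [lap_zero, lap_zero, st_zero]
  | one =>
    have hx : st hσ (x 1 r 0) = x 1 r 0 := by
      rw [st_x, Subsingleton.elim (Fin.rev 0) 0, rhoTwo_self (Subsingleton.elim _ _), zpow_zero,
        one_smul]
    have hc : ∀ n, σ (lapOne r n) = lapOne r n := fun n => by
      have : ∀ k : ℕ, σ ((r ^ 2) ^ k) = (r ^ 2) ^ k := fun k => by rw [map_pow, hσ.1]
      simp only [lapOne, map_div₀, map_mul, map_sub, map_add, map_one, map_inv₀, this, hσ.1]
    induction p using mono_induction with
    | mono ν => rw [mono_one, st_pow, hx, lap_one, st_smul, st_pow, hx, hc]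
    | add a b ha hb => rw [st_add, map_add, map_add, ha, hb, st_add]
    | smul c a ha => rw [st_smul, map_smul, map_smul, st_smul, ha]
  | more N ih _ =>
    have hN : σ (r ^ (N : ℤ)) = r ^ (N : ℤ) := by
      have := hσ.rho (0 : Fin (N + 2))
      rwa [rhoTwo_zero] at this
    have hw : r ^ (N : ℤ) ≠ 0 := zpow_ne_zero _ (r_ne r)
    induction p using tri_induction with
    | tri a b f =>
      simp only [st_tri, map_smul, lap_tri, st_add, st_smul, ih, smul_add, smul_smul, map_mul,
        hσ.qn, zpow_neg, map_inv₀, hN, map_pow, hσ.1]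
      congr 1
      · rcases a with _ | a
        · simp
        rcases b with _ | b
        · simp
        simp only [Nat.add_sub_cancel]
        congr 1
        field_simp
        ring
      · congr 1
        ring
    | add a b ha hb => rw [st_add, map_add, map_add, ha, hb, st_add]

theorem lap_iterate_st (j : ℕ) (p : Alg N r) :
    (lap N r)^[j] (st hσ p) = st hσ ((lap N r)^[j] p) := by
  induction j generalizing p with
  | zero => rfl
  | succ j ih => rw [Function.iterate_succ_apply, lap_st, ih, Function.iterate_succ_apply]

end Star

/-! ### Products with harmonic polynomials -/

section Nilpotency

variable {N : ℕ} {r : ℂ} [Generic r]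

omit [Generic r] in
theorem lap_iterate_zero (j : ℕ) : (lap N r)^[j] 0 = 0 := by
  induction j with
  | zero => rfl
  | succ j ih => rw [Function.iterate_succ_apply, map_zero, ih]

omit [Generic r] in
theorem lap_iterate_add (j : ℕ) (p p' : Alg N r) :
    (lap N r)^[j] (p + p') = (lap N r)^[j] p + (lap N r)^[j] p' := by
  induction j generalizing p p' with
  | zero => rfl
  | succ j ih => simp only [Function.iterate_succ_apply, map_add, ih]

omit [Generic r] in
theorem lap_iterate_smul (j : ℕ) (c : ℂ) (p : Alg N r) :
    (lap N r)^[j] (c • p) = c • (lap N r)^[j] p := by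
  induction j generalizing p with
  | zero => rfl
  | succ j ih => simp only [Function.iterate_succ_apply, map_smul, ih]

/-- By the Serre relation all powers of `L` but one can be moved across `x_i`. Hence multiplication
by a generator raises the order of nilpotency by at most one. -/
theorem lap_iterate_x_mul (i : Fin N) (j : ℕ) : ∃ a b : ℂ, ∀ h : Alg N r,
    (lap N r)^[j + 1] (x N r i * h) =
      a • lap N r (x N r i * (lap N r)^[j] h) + b • (x N r i * (lap N r)^[j + 1] h) := by
  induction j with
  | zero => exact ⟨1, 0, fun h => by simp⟩
  | succ j ih =>
    obtain ⟨a, b, hab⟩ := ih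
    refine ⟨a * (r ^ 2 + (r ^ 2)⁻¹) + b, -a, fun h => ?_⟩
    have hs := lap_serre i ((lap N r)^[j] h)
    rw [Function.iterate_succ_apply', hab, map_add, map_smul, map_smul, eq_sub_of_add_eq hs,
      Function.iterate_succ_apply' _ (j + 1), Function.iterate_succ_apply']
    module

theorem lap_iterate_x_mul_eq_zero (i : Fin N) {j : ℕ} {h : Alg N r}
    (hh : (lap N r)^[j] h = 0) : (lap N r)^[j + 1] (x N r i * h) = 0 := by
  obtain ⟨a, b, hab⟩ := lap_iterate_x_mul (r := r) i j
  rw [hab, Function.iterate_succ_apply', hh]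
  simp

theorem lap_iterate_x_pow_mul_eq_zero (i : Fin N) {j : ℕ} {h : Alg N r}
    (hh : (lap N r)^[j] h = 0) (k : ℕ) : (lap N r)^[j + k] (x N r i ^ k * h) = 0 := by
  induction k with
  | zero => simpa using hh
  | succ k ih =>
    rw [pow_succ', mul_assoc]
    exact lap_iterate_x_mul_eq_zero i ih

theorem lap_iterate_mul_eq_zero {d : ℕ} {p : Alg N r} (hp : IsHom d p) {j : ℕ} {h : Alg N r}
    (hh : (lap N r)^[j] h = 0) : (lap N r)^[j + d] (p * h) = 0 := by
  have hp' := mem_homog.mpr hp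
  clear hp
  induction hp' using Submodule.span_induction with
  | mem p hp =>
    obtain ⟨ν, rfl, rfl⟩ := hp
    have : ∀ l : List (Fin N), (lap N r)^[j + (l.map ν).sum]
        ((l.map fun i => x N r i ^ ν i).prod * h) = 0 := by
      intro l
      induction l with
      | nil => simpa using hh
      | cons i l ih =>
        rw [List.map_cons, List.map_cons, List.sum_cons, List.prod_cons, mul_assoc,
          add_comm (ν i), ← add_assoc]
        exact lap_iterate_x_pow_mul_eq_zero i ih _
    have h := this (List.finRange N)
    rwa [← List.ofFn_eq_map, ← List.ofFn_eq_map, List.sum_ofFn] at h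
  | zero => rw [zero_mul, lap_iterate_zero]
  | add p p' _ _ hp hp' => rw [add_mul, lap_iterate_add, hp, hp', add_zero]
  | smul c p _ hp => rw [smul_mul_assoc, lap_iterate_smul, hp, smul_zero]

/-- The scalar by which the commutator of the Laplace operator and `Q` acts in degree `d`. -/
def radEig (N : ℕ) (r : ℂ) (d : ℤ) : ℂ :=
  radConst N r * ((r ^ 2) ^ N * (r ^ 2) ^ d - (r ^ 2) ^ (-d))

theorem lap_radius_mul_of_isHom {d : ℤ} {p : Alg N r} (hp : IsHom d p) :
    lap N r (radius N r * p) = radius N r * lap N r p + radEig N r d • p := by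
  rw [lap_radius_mul, hp, hp.theta_inv, radEig]
  module

/-- Since the commutator with `Q` is scalar in each degree, `Q` has degree two but raises the order
of nilpotency by only one; `lap_iterate_mul_eq_zero` alone would be too weak for powers of `Q`. -/
theorem lap_iterate_radius_mul (j : ℕ) {d : ℤ} {p : Alg N r} (hp : IsHom d p) :
    ∃ c : ℂ, (lap N r)^[j + 1] (radius N r * p) =
      radius N r * (lap N r)^[j + 1] p + c • (lap N r)^[j] p := by
  induction j generalizing d p with
  | zero => exact ⟨_, lap_radius_mul_of_isHom hp⟩
  | succ j ih =>
    obtain ⟨c, hc⟩ := ih (isHom_lap hp)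
    refine ⟨c + radEig N r d, ?_⟩
    rw [Function.iterate_succ_apply, lap_radius_mul_of_isHom hp, lap_iterate_add,
      lap_iterate_smul, hc, Function.iterate_succ_apply _ (j + 1), ← Function.iterate_succ_apply _ j]
    module

theorem lap_iterate_radius_pow_mul_eq_zero {d : ℤ} {p : Alg N r} (hp : IsHom d p) {j : ℕ}
    (h : (lap N r)^[j] p = 0) (s : ℕ) : (lap N r)^[j + s] (radius N r ^ s * p) = 0 := by
  induction s with
  | zero => simpa using h
  | succ s ih =>
    obtain ⟨c, hc⟩ := lap_iterate_radius_mul (j + s) ((isHom_radius_pow s).mul hp)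
    rw [pow_succ', mul_assoc, ← add_assoc, hc, Function.iterate_succ_apply', ih]
    simp

end Nilpotency

/-! ### The invariant functional -/

section Functional

/-- The sum of the exponents `ν_1, …, ν_n` and `ν_{n+1} / 2`. -/
def halfDeg (N : ℕ) (ν : Fin N → ℕ) : ℕ :=
  (∑ i : Fin N with i < i.rev, ν i) + ∑ c : Fin N with c = c.rev, ν c / 2

open Classical in
/-- The values of the invariant functional without the factor depending only on the degree. -/
def haarRedMono (N : ℕ) (r : ℂ) (ν : Fin N → ℕ) : ℂ :=
  if (∀ i : Fin N, ν i = ν i.rev) ∧ ∀ c : Fin N, c = c.rev → Even (ν c) then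
    ((∏ i : Fin N with i < i.rev, qPoch ((r ^ 2) ^ (-2 : ℤ)) ((r ^ 2) ^ (-2 : ℤ)) (ν i))
        * qPoch (r ^ 2)⁻¹ ((r ^ 2) ^ (-2 : ℤ)) (∑ c : Fin N with c = c.rev, ν c / 2)
        * (1 + r ^ 2) ^ (∑ c : Fin N with c = c.rev, ν c / 2)) /
      r ^ ((∑ i : Fin N with i < i.rev, rhoTwo N i * ν i)
        + 2 * ((∑ c : Fin N with c = c.rev, ν c / 2 : ℕ) : ℤ))
  else 0

/-- The invariant functional without the factor depending only on the degree. -/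
def haarRed (N : ℕ) (r : ℂ) : Alg N r →ₗ[ℂ] ℂ := onMono N r (haarRedMono N r)

/-- The factor of the invariant functional which depends only on the degree. -/
def haarConst (N : ℕ) (r : ℂ) (t : ℕ) : ℂ :=
  ((1 + (r ^ 2) ^ ((N : ℤ) - 2)) ^ t * qPoch ((r ^ 2) ^ (-(N : ℤ))) ((r ^ 2) ^ (-2 : ℤ)) t)⁻¹

theorem haarMono_eq (N : ℕ) (r : ℂ) (ν : Fin N → ℕ) :
    haarMono N r ν = haarConst N r (halfDeg N ν) * haarRedMono N r ν := by
  simp only [haarMono, haarRedMono, haarConst, halfDeg]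
  split_ifs with h
  · simp only [div_eq_mul_inv, mul_inv, Nat.cast_sum]
    ring
  · rw [mul_zero]

variable {N : ℕ}

theorem sum_eq_two_mul_halfDeg {ν : Fin N → ℕ} (h1 : ∀ i : Fin N, ν i = ν i.rev)
    (h2 : ∀ c : Fin N, c = c.rev → Even (ν c)) : ∑ i, ν i = 2 * halfDeg N ν := by
  have e1 : ∑ i : Fin N with i.rev < i, ν i = ∑ i : Fin N with i < i.rev, ν i := by
    rw [sum_filter, sum_filter, ← Equiv.sum_comp Fin.revPerm]
    refine sum_congr rfl fun i _ => ?_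
    simp only [Fin.revPerm_apply, Fin.rev_rev, ← h1]
  have e2 : ∑ c : Fin N with c = c.rev, ν c = 2 * ∑ c : Fin N with c = c.rev, ν c / 2 := by
    rw [mul_sum]
    refine sum_congr rfl fun c hc => ?_
    have := h2 c (mem_filter.mp hc).2
    exact (Nat.two_mul_div_two_of_even this).symm
  have e3 : ∑ i, ν i = ∑ i : Fin N with i < i.rev, ν i + ∑ i : Fin N with i.rev < i, ν i +
      ∑ c : Fin N with c = c.rev, ν c := by
    rw [sum_filter, sum_filter, sum_filter, ← sum_add_distrib, ← sum_add_distrib]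
    refine sum_congr rfl fun i _ => ?_
    rcases lt_trichotomy i i.rev with h | h | h
    · simp [h, h.not_gt, h.ne]
    · simp [← h]
    · simp [h, h.not_gt, h.ne']
  rw [e3, e1, e2, halfDeg]
  ring

variable {r : ℂ} [Generic r]

/-- Vanishing on homogeneous elements may thus be deduced from `haarRed`, which has a clean
recursion in `N`. The split-off factor depends on `N`, and for `N = 0` its denominator vanishes when
`t > 0`. Exponents contributing to the functional have even total degree, so the rounding in `d / 2`
is harmless. -/
theorem haar_eq {d : ℕ} {p : Alg N r} (hp : IsHom d p) :
    haar N r p = haarConst N r (d / 2) * haarRed N r p := by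
  have hp' := mem_homog.mpr hp
  clear hp
  induction hp' using Submodule.span_induction with
  | mem p hp =>
    obtain ⟨ν, rfl, rfl⟩ := hp
    rw [haar, haarRed, onMono_mono, onMono_mono, haarMono_eq]
    by_cases h : (∀ i : Fin N, ν i = ν i.rev) ∧ ∀ c : Fin N, c = c.rev → Even (ν c)
    · rw [sum_eq_two_mul_halfDeg h.1 h.2, Nat.mul_div_cancel_left _ two_pos]
    · rw [haarRedMono, if_neg h, mul_zero, mul_zero]
  | zero => simp
  | add p p' _ _ hp hp' => rw [map_add, map_add, hp, hp', mul_add]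
  | smul c p _ hp => rw [map_smul, map_smul, hp, smul_eq_mul, smul_eq_mul, mul_left_comm]

theorem prod_filter_lt_rev {M : Type} [CommMonoid M] (f : Fin (N + 2) → M) :
    ∏ j : Fin (N + 2) with j < j.rev, f j = f 0 * ∏ j : Fin N with j < j.rev, f (mid j) := by
  rw [prod_filter, prod_fin_add_two, prod_filter]
  simp only [mid_lt_rev_iff, if_pos zero_lt_zero_rev, if_neg (not_last_lt _), mul_one]

theorem haarRedMono_glue (a b : ℕ) (ν : Fin N → ℕ) : haarRedMono (N + 2) r (glue a ν b) =
    if a = b then qPoch ((r ^ 2) ^ (-2 : ℤ)) ((r ^ 2) ^ (-2 : ℤ)) a * ((r ^ (N : ℤ)) ^ a)⁻¹ *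
      haarRedMono N r ν else 0 := by
  have hr := r_ne r
  have h1 : (∀ i : Fin (N + 2), glue a ν b i = glue a ν b i.rev) ↔
      a = b ∧ ∀ i : Fin N, ν i = ν i.rev := by
    constructor
    · intro h
      refine ⟨by simpa using h 0, fun i => by simpa [mid_rev] using h (mid i)⟩
    · rintro ⟨rfl, h⟩ i
      induction i using fin_cases_mid with
      | zero => simp
      | mid i => simpa [mid_rev] using h i
      | last => simp
  have h2 : (∀ c : Fin (N + 2), c = c.rev → Even (glue a ν b c)) ↔
      ∀ c : Fin N, c = c.rev → Even (ν c) := by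
    constructor
    · intro h c hc
      simpa using h (mid c) ((mid_eq_rev_iff c).mpr hc)
    · intro h c
      induction c using fin_cases_mid with
      | zero => intro hc; exact absurd hc zero_lt_zero_rev.ne
      | mid c => intro hc; simpa using h c ((mid_eq_rev_iff c).mp hc)
      | last => intro hc; rw [last_rev] at hc; exact absurd hc zero_lt_last.ne'
  by_cases hab : a = b
  swap
  · rw [haarRedMono, if_neg (fun h => hab (h1.mp h.1).1), if_neg hab]
  rw [if_pos hab]
  subst hab
  by_cases h : (∀ i : Fin N, ν i = ν i.rev) ∧ ∀ c : Fin N, c = c.rev → Even (ν c)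
  · rw [haarRedMono, haarRedMono, if_pos h, if_pos ⟨h1.mpr ⟨rfl, h.1⟩, h2.mpr h.2⟩,
      prod_filter_lt_rev, sum_filter_lt_rev, sum_filter_eq_rev]
    simp only [glue_zero, glue_mid, rhoTwo_zero, rhoTwo_mid]
    rw [add_assoc, zpow_add₀ hr, zpow_mul, zpow_natCast (r ^ (N : ℤ)), div_eq_mul_inv,
      div_eq_mul_inv, mul_inv]
    ring
  · rw [haarRedMono, haarRedMono, if_neg h, if_neg fun h' => h ⟨(h1.mp h'.1).2, h2.mp h'.2⟩,
      mul_zero]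

theorem haarRed_tri (a b : ℕ) (f : Alg N r) : haarRed (N + 2) r (tri a b f) =
    if a = b then qPoch ((r ^ 2) ^ (-2 : ℤ)) ((r ^ 2) ^ (-2 : ℤ)) a * ((r ^ (N : ℤ)) ^ a)⁻¹ *
      haarRed N r f else 0 := by
  have h : haarRed (N + 2) r ∘ₗ tri a b =
      (if a = b then qPoch ((r ^ 2) ^ (-2 : ℤ)) ((r ^ 2) ^ (-2 : ℤ)) a * ((r ^ (N : ℤ)) ^ a)⁻¹
        else 0) • haarRed N r := by
    refine hom_ext_mono fun ν => ?_
    rw [LinearMap.comp_apply, LinearMap.smul_apply, ← mono_glue, haarRed, haarRed, onMono_mono,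
      onMono_mono, haarRedMono_glue, smul_eq_mul, ite_mul, zero_mul]
  have := LinearMap.congr_fun h f
  rwa [LinearMap.comp_apply, LinearMap.smul_apply, smul_eq_mul, ite_mul, zero_mul] at this

theorem haarRed_one (n : ℕ) : haarRed 1 r (x 1 r 0 ^ n) =
    if Even n then qPoch (r ^ 2)⁻¹ ((r ^ 2) ^ (-2 : ℤ)) (n / 2) *
      ((1 + r ^ 2) / r ^ 2) ^ (n / 2) else 0 := by
  have h := mono_one (r := r) (fun _ => n)
  have h0 : ∀ c : Fin 1, c = c.rev := fun c => Subsingleton.elim _ _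
  have h1 : (univ.filter fun j : Fin 1 => j < j.rev) = ∅ := by
    ext j; simp [← h0 j]
  have h2 : (univ.filter fun j : Fin 1 => j = j.rev) = {0} := by
    ext j; simp [Subsingleton.elim j 0]
  rw [← h, haarRed, onMono_mono, haarRedMono, h1, h2]
  simp only [implies_true, true_and, forall_const, ← h0, prod_empty, sum_empty, sum_singleton,
    one_mul, zero_add, div_pow]
  split_ifs
  · rw [zpow_mul, zpow_natCast, show r ^ (2 : ℤ) = r ^ 2 by norm_cast, mul_div_assoc]
  · rfl

omit [Generic r] in
theorem qPoch_succ (a p : ℂ) (k : ℕ) : qPoch a p (k + 1) = qPoch a p k * (1 - a * p ^ k) := by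
  rw [qPoch, prod_range_succ, qPoch]

/-- On degree `d` the right side is `(q ^ d - 1)` times the functional; so for `d ≠ 0` the value at
`p` is determined by the value at `L p`. -/
theorem haarRed_lap (p : Alg N r) : (r ^ 2 - (r ^ 2)⁻¹) ^ 2 * haarRed N r (lap N r p) =
    haarRed N r (theta N r (r ^ 2) p) - haarRed N r p := by
  have hr := r_ne r
  have h1 := r_sq_sub_one_ne r
  have h2 := r_sq_add_one_ne r
  have h4 := r_four_sub_one_ne r
  have hm2 : (r ^ 2) ^ (-2 : ℤ) = (r ^ 4)⁻¹ := by rw [zpow_neg]; norm_cast; ring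
  induction N using Nat.twoStepInduction with
  | zero => rw [lap_zero, theta_eq_self, map_zero, mul_zero, sub_self]
  | one =>
    suffices h : (r ^ 2 - (r ^ 2)⁻¹) ^ 2 • (haarRed 1 r ∘ₗ lap 1 r) =
        haarRed 1 r ∘ₗ (theta 1 r (r ^ 2)).toLinearMap - haarRed 1 r from LinearMap.congr_fun h p
    refine hom_ext_one fun n => ?_
    simp only [LinearMap.smul_apply, LinearMap.sub_apply, LinearMap.comp_apply,
      AlgHom.toLinearMap_apply, lap_one, map_pow, theta_x, smul_pow, map_smul, smul_eq_mul]
    rcases Nat.even_or_odd' n with ⟨s, rfl | rfl⟩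
    · rcases s with _ | s
      · simp
      · rw [show 2 * (s + 1) - 2 = 2 * s by omega, haarRed_one, haarRed_one, if_pos (by simp),
          if_pos (by simp), Nat.mul_div_cancel_left _ two_pos, Nat.mul_div_cancel_left _ two_pos,
          qPoch_succ, pow_succ ((1 + r ^ 2) / r ^ 2), hm2, lapOne]
        generalize qPoch _ _ s = P
        have h5 : (1 : ℂ) - r ^ 2 ≠ 0 := by rw [← neg_sub]; exact neg_ne_zero.mpr h1
        have h6 : (1 : ℂ) + r ^ 2 ≠ 0 := by rw [add_comm]; exact h2
        have e : (r ^ 2) ^ (2 * (s + 1)) = (r ^ 4) ^ s * r ^ 4 := by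
          rw [← pow_mul, ← pow_mul, ← pow_add]; ring_nf
        rw [e, inv_pow]
        have hv : (r ^ 4) ^ s ≠ 0 := pow_ne_zero _ (pow_ne_zero _ hr)
        generalize (r ^ 4) ^ s = v at *
        generalize ((1 + r ^ 2) / r ^ 2) ^ s = c
        field_simp
        ring
    · rcases s with _ | s
      · rw [haarRed_one (2 * 0 + 1), if_neg (by simp)]
        simp
      · rw [show 2 * (s + 1) + 1 - 2 = 2 * s + 1 by omega, haarRed_one, haarRed_one,
          if_neg (by simp), if_neg (by simp)]
        simp
  | more N ih _ =>
    suffices h : (r ^ 2 - (r ^ 2)⁻¹) ^ 2 • (haarRed (N + 2) r ∘ₗ lap (N + 2) r) =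
        haarRed (N + 2) r ∘ₗ (theta (N + 2) r (r ^ 2)).toLinearMap - haarRed (N + 2) r from
      LinearMap.congr_fun h p
    refine hom_ext_tri fun a b f => ?_
    have hf := ih f
    simp only [LinearMap.smul_apply, LinearMap.sub_apply, LinearMap.comp_apply,
      AlgHom.toLinearMap_apply, lap_tri, theta_tri, map_add, map_smul, smul_eq_mul, haarRed_tri]
    by_cases hab : a = b
    swap
    · simp only [if_neg hab]
      rcases a with _ | a
      · simp
      rcases b with _ | b
      · simp
      rw [if_neg (by omega)]
      simp
    subst hab
    simp only [if_true]
    rw [show haarRed N r (lap N r f) = (haarRed N r (theta N r (r ^ 2) f) - haarRed N r f) /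
      (r ^ 2 - (r ^ 2)⁻¹) ^ 2 by
        rw [← hf, mul_div_cancel_left₀ _ (pow_ne_zero _ (q_sub_inv_ne r))], zpow_neg]
    have hw : r ^ (N : ℤ) ≠ 0 := zpow_ne_zero _ hr
    generalize r ^ (N : ℤ) = w at *
    have hk := q_sub_inv_ne r
    have hk' : r ^ 2 - (r ^ 2)⁻¹ = (r ^ 4 - 1) / r ^ 2 := by field_simp
    rcases a with _ | a
    · rw [hk']
      simp only [qn_zero, zero_mul, zero_add, pow_zero]
      field_simp
    · rw [Nat.add_sub_cancel, qn_eq, qPoch_succ, hm2, hk']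
      generalize qPoch _ _ a = P
      have e : (r ^ 4) ^ a = (r ^ 2) ^ a * (r ^ 2) ^ a := by
        rw [← mul_pow]; ring
      rw [inv_pow, e]
      simp only [pow_add, pow_one]
      have hv : (r ^ 2) ^ a ≠ 0 := pow_ne_zero _ (pow_ne_zero _ hr)
      generalize (r ^ 2) ^ a = v at *
      field_simp
      ring

/-- Apply `haarRed_lap` repeatedly: the value at `p` is a multiple of the value at `L ^ j p`,
provided that the degrees `d, d - 2, …, d - 2(j-1)` met on the way are nonzero. The bound makes them
all positive. -/
theorem haarRed_eq_zero_of_lap_iterate {j : ℕ} {d : ℤ} {p : Alg N r} (hp : IsHom d p)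
    (hj : (lap N r)^[j] p = 0) (hd : 2 * (j : ℤ) ≤ d + 1) : haarRed N r p = 0 := by
  induction j generalizing d p with
  | zero => rw [show p = 0 from hj, map_zero]
  | succ j ih =>
    have h := haarRed_lap p
    rw [Function.iterate_succ_apply] at hj
    push_cast at hd
    rw [ih (isHom_lap hp) hj (by omega), hp, map_smul, smul_eq_mul, mul_zero] at h
    have h' : ((r ^ 2) ^ d - 1) * haarRed N r p = 0 := by rw [sub_mul, one_mul, ← h]
    refine (mul_eq_zero.mp h').resolve_left (sub_ne_zero.mpr fun e => ?_)
    rw [← zpow_zero (r ^ 2)] at e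
    have := q_zpow_inj e
    omega

/-- The element has degree `l + l' + 2s` and is killed by `L ^ (1 + min(l,l') + s)`. The bound of
`haarRed_eq_zero_of_lap_iterate` then reads `2 min(l,l') + 1 ≤ l + l'`, which is `l ≠ l'`. -/
theorem haarRed_harmonic_mul_eq_zero {σ : ℂ →+* ℂ} (hσ : Fixes N r σ)
    (hinv : ∀ c, σ (σ c) = c) {l l' : ℕ} {h h' : Alg N r} (hl : IsHom l h) (hl' : IsHom l' h')
    (hh : lap N r h = 0) (hh' : lap N r h' = 0) (hne : l ≠ l') (s : ℕ) :
    haarRed N r (radius N r ^ s * (st hσ h * h')) = 0 := by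
  have hd := (isHom_st hσ hl).mul hl'
  rcases Nat.lt_or_gt_of_ne hne with hlt | hlt
  · have h1 := lap_iterate_mul_eq_zero (j := 1) (isHom_st hσ hl) hh'
    have h2 := lap_iterate_radius_pow_mul_eq_zero hd h1 s
    exact haarRed_eq_zero_of_lap_iterate ((isHom_radius_pow s).mul hd) h2 (by push_cast; omega)
  · have h1 := lap_iterate_mul_eq_zero (j := 1) (isHom_st hσ hl') hh
    -- Nilpotency is controlled for left multiplication only; when `h` has the larger degree, the
    -- product is reversed by `*`, with which `L` commutes.
    have h3 : (lap N r)^[1 + l'] (st hσ h * h') = 0 := by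
      have e : st hσ h * h' = st hσ (st hσ h' * h) := by rw [st_mul, st_st hσ hinv]
      rw [e, lap_iterate_st, h1, st_zero]
    have h2 := lap_iterate_radius_pow_mul_eq_zero hd h3 s
    exact haarRed_eq_zero_of_lap_iterate ((isHom_radius_pow s).mul hd) h2 (by push_cast; omega)

end Functional

/-! ### The decomposition of polynomials into harmonic ones -/

section Fischer

variable {N : ℕ} {r : ℂ} [Generic r]

/-- The scalar with `L (Q ^ s p) = Q ^ s L p + radSum s d • Q ^ (s - 1) p` for `p` of degree `d`. -/
def radSum (N : ℕ) (r : ℂ) (s : ℕ) (d : ℤ) : ℂ := ∑ i ∈ range s, radEig N r (d + 2 * i)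

theorem lap_radius_pow_mul (s : ℕ) {d : ℤ} {p : Alg N r} (hp : IsHom d p) :
    lap N r (radius N r ^ s * p) =
      radius N r ^ s * lap N r p + radSum N r s d • (radius N r ^ (s - 1) * p) := by
  induction s with
  | zero => simp [radSum]
  | succ s ih =>
    rw [pow_succ', mul_assoc, lap_radius_mul_of_isHom ((isHom_radius_pow s).mul hp), ih, mul_add,
      ← mul_assoc, mul_smul_comm, radSum.eq_def N r (s + 1), sum_range_succ, ← radSum, add_smul,
      add_assoc, Nat.add_sub_cancel, add_comm d]
    congr 2
    rcases s with _ | s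
    · simp [radSum]
    · rw [Nat.add_sub_cancel, pow_succ', mul_assoc]

theorem radSum_eq (s : ℕ) (d : ℤ) : radSum N r s d = radConst N r / (r ^ 4 - 1) *
    (((r ^ 2) ^ s) ^ 2 - 1) *
      ((r ^ (N : ℤ)) ^ 2 * (r ^ 2) ^ d - r ^ 4 / ((r ^ 2) ^ d * ((r ^ 2) ^ s) ^ 2)) := by
  have hr := r_ne r
  have h4 := r_four_sub_one_ne r
  have hd : (r ^ 2) ^ d ≠ 0 := zpow_ne_zero _ (q_ne r)
  have hN : (r ^ 2) ^ N = (r ^ (N : ℤ)) ^ 2 := by rw [zpow_natCast, ← pow_mul, ← pow_mul, mul_comm]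
  induction s with
  | zero => simp [radSum]
  | succ s ih =>
    have hs : (r ^ 2) ^ s ≠ 0 := pow_ne_zero _ (q_ne r)
    have e : (r ^ 2) ^ (d + 2 * (s : ℤ)) = (r ^ 2) ^ d * ((r ^ 2) ^ s) ^ 2 := by
      rw [zpow_add₀ (q_ne r), mul_comm 2, zpow_mul]
      norm_cast
    rw [radSum, sum_range_succ, ← radSum, ih, radEig, zpow_neg, e, hN, pow_succ (r ^ 2) s]
    generalize (r ^ 2) ^ d = D at *
    generalize (r ^ 2) ^ s = S at *
    generalize r ^ (N : ℤ) = w at *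
    field_simp
    ring

/-- The closed form has the factors `q ^ (2s) - 1` and `q ^ (N+d) - q ^ (2-d-2s)`. For `s ≥ 1`, `d ≥
0` the second can vanish only if `N = 0`, which is why `N = 0` is treated apart below. -/
theorem radSum_ne_zero {s : ℕ} {d : ℤ} (hs : s ≠ 0) (h : (N : ℤ) + 2 * d + 2 * s ≠ 2) :
    radSum N r s d ≠ 0 := by
  have hr := r_ne r
  have e1 : ((r ^ 2) ^ s) ^ 2 = r ^ (4 * (s : ℤ)) := by
    rw [← pow_mul, ← pow_mul, ← zpow_natCast]; congr 1; push_cast; ring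
  have e2 : (r ^ (N : ℤ)) ^ 2 * (r ^ 2) ^ d = r ^ (2 * (N : ℤ) + 2 * d) := by
    rw [zpow_add₀ hr, zpow_mul' r 2, zpow_mul r 2]; norm_cast
  have e3 : r ^ 4 / ((r ^ 2) ^ d * ((r ^ 2) ^ s) ^ 2) = r ^ (4 - (2 * d + 4 * (s : ℤ))) := by
    rw [e1, zpow_sub₀ hr, zpow_add₀ hr, zpow_mul r 2]; norm_cast
  rw [radSum_eq, e3, e2, e1]
  refine mul_ne_zero (mul_ne_zero (div_ne_zero (radConst_ne_zero N) (r_four_sub_one_ne r)) ?_) ?_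
  · exact sub_ne_zero.mpr (r_zpow_ne_one r (by omega))
  · exact sub_ne_zero.mpr fun e => h (by have := r_zpow_inj r e; omega)

theorem IsHom.eq_zero_of_ne_zero {d : ℤ} {p : Alg 0 r} (hp : IsHom d p) (hd : d ≠ 0) : p = 0 := by
  rw [IsHom, theta_eq_self] at hp
  by_contra h
  have h1 : (1 - (r ^ 2) ^ d) • p = 0 := by
    rw [show (1 - (r ^ 2) ^ d) • p = p - (r ^ 2) ^ d • p by module, ← hp, sub_self]
  have h2 := (smul_eq_zero.mp h1).resolve_right h
  exact hd (q_zpow_inj (r := r) (by rw [zpow_zero, ← sub_eq_zero.mp h2]))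

/-- Decompose `L f = ∑ Q ^ s g_s` by induction on the degree. Each `Q ^ s g_s` is `L` of a multiple
of `Q ^ (s+1) g_s`, and subtracting these multiples from `f` leaves a harmonic rest. The sum is
asserted for every large `n`, so that one range later serves all components. -/
theorem exists_harmonic_decomposition {l : ℤ} {f : Alg N r} (hf : IsHom l f) :
    ∃ h : ℕ → Alg N r, (∀ s : ℕ, IsHom (l - 2 * s) (h s)) ∧ (∀ s, lap N r (h s) = 0) ∧
      ∀ n : ℕ, l < 2 * n → f = ∑ s ∈ range n, radius N r ^ s * h s := by
  by_cases hl : l < 0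
  · exact ⟨0, fun s => IsHom.zero _, fun s => map_zero _, fun n _ => by
      simp [hf.eq_zero_of_neg hl]⟩
  rcases Nat.eq_zero_or_pos N with rfl | hN
  · refine ⟨fun s => if s = 0 then f else 0, fun s => ?_, fun s => lap_zero _, fun n hn => ?_⟩
    · rcases s with _ | s
      · simpa using hf
      · exact IsHom.zero _
    · rw [sum_eq_single 0 (fun s _ hs => by simp [hs])
        (fun h => absurd (mem_range.mpr (by omega)) h)]
      simp
  obtain ⟨k, hk⟩ : ∃ k : ℕ, l < k := ⟨l.toNat + 1, by omega⟩
  induction k using Nat.strong_induction_on generalizing l f with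
  | _ k ih =>
    have hlap := isHom_lap hf
    have hrec : ∃ g : ℕ → Alg N r, (∀ s : ℕ, IsHom (l - 2 - 2 * s) (g s)) ∧
        (∀ s, lap N r (g s) = 0) ∧
        ∀ n : ℕ, l - 2 < 2 * n → lap N r f = ∑ s ∈ range n, radius N r ^ s * g s := by
      by_cases hl2 : l - 2 < 0
      · exact ⟨0, fun s => IsHom.zero _, fun s => map_zero _, fun n _ => by
          simp [hlap.eq_zero_of_neg hl2]⟩
      · exact ih (k - 1) (by omega) hlap hl2 (by omega)
    obtain ⟨g, hg, hg0, hsum⟩ := hrec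
    let c : ℕ → ℂ := fun s => (radSum N r (s + 1) (l - 2 - 2 * s))⁻¹
    have hterm : ∀ s, lap N r (radius N r ^ (s + 1) * (c s • g s)) = radius N r ^ s * g s := by
      intro s
      by_cases hs : l - 2 - 2 * (s : ℤ) < 0
      · rw [(hg s).eq_zero_of_neg hs]; simp
      · rw [mul_smul_comm, map_smul, lap_radius_pow_mul _ (hg s), hg0, mul_zero, zero_add,
          Nat.add_sub_cancel, smul_smul, inv_mul_cancel₀, one_smul]
        exact radSum_ne_zero (Nat.succ_ne_zero s) (by push_cast; omega)
    -- Any sufficiently large cutoff would do: terms with `2s > l - 2` have negative degree and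
    -- vanish (`hzero`).
    let n₀ : ℕ := l.toNat
    let h : ℕ → Alg N r := fun s => match s with
      | 0 => f - ∑ s ∈ range n₀, radius N r ^ (s + 1) * (c s • g s)
      | s + 1 => c s • g s
    have hdeg : ∀ s, IsHom l (radius N r ^ (s + 1) * (c s • g s)) := by
      intro s
      have := (isHom_radius_pow (s + 1)).mul ((hg s).smul (c s))
      convert this using 1
      push_cast
      ring
    have hzero : ∀ s : ℕ, l - 2 < 2 * (s : ℤ) → radius N r ^ (s + 1) * (c s • g s) = 0 := by
      intro s hs
      rw [(hg s).eq_zero_of_neg (by omega)]; simp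
    refine ⟨h, fun s => ?_, fun s => ?_, fun n hn => ?_⟩
    · rcases s with _ | s
      · have := hf.sub (IsHom.sum (range n₀) _ fun s _ => hdeg s)
        simpa [h] using this
      · have := (hg s).smul (c s)
        convert this using 1
        push_cast
        ring
    · rcases s with _ | s
      · change lap N r (f - _) = 0
        rw [map_sub, map_sum, sum_congr rfl fun s _ => hterm s, ← hsum n₀ (by omega), sub_self]
      · change lap N r (c s • g s) = 0
        rw [map_smul, hg0, smul_zero]
    · obtain ⟨n, rfl⟩ : ∃ n', n = n' + 1 := ⟨n - 1, by omega⟩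
      rw [sum_range_succ', pow_zero, one_mul]
      change f = ∑ s ∈ range n, radius N r ^ (s + 1) * (c s • g s) + (f - _)
      have : ∀ a b : ℕ, l - 2 < 2 * (a : ℤ) → l - 2 < 2 * (b : ℤ) → a ≤ b →
          ∑ s ∈ range a, radius N r ^ (s + 1) * (c s • g s) =
          ∑ s ∈ range b, radius N r ^ (s + 1) * (c s • g s) := by
        intro a b ha hb hab
        refine sum_subset (range_mono hab) fun s _ hs => hzero s ?_
        rw [mem_range] at hs
        omega
      have e : ∑ s ∈ range n, radius N r ^ (s + 1) * (c s • g s) =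
          ∑ s ∈ range n₀, radius N r ^ (s + 1) * (c s • g s) := by
        push_cast at hn
        rcases le_total n n₀ with hle | hle
        · exact this _ _ (by omega) (by omega) hle
        · exact (this _ _ (by omega) (by omega) hle).symm
      rw [e]
      abel

/-- Applying `L` lowers each power of `Q` by one and removes the term `s = 0`, so induction on `n`
applies. The conclusion concerns `Q ^ s h_s` instead of `h_s`, since `Q = 0` for `N = 0`. -/
theorem radius_pow_mul_eq_zero_of_sum_range {l : ℤ} {h : ℕ → Alg N r}
    (hh : ∀ s : ℕ, IsHom (l - 2 * s) (h s)) (h0 : ∀ s, lap N r (h s) = 0) {n : ℕ}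
    (hsum : ∑ s ∈ range n, radius N r ^ s * h s = 0) :
    ∀ s < n, radius N r ^ s * h s = 0 := by
  rcases Nat.eq_zero_or_pos N with rfl | hN
  · intro s hs
    by_cases hl : l - 2 * (s : ℤ) = 0
    · rw [← hsum]
      refine (sum_eq_single (f := fun s => radius 0 r ^ s * h s) s (fun t _ ht => ?_)
        fun h => absurd (mem_range.mpr hs) h).symm
      rw [(hh t).eq_zero_of_ne_zero (by omega), mul_zero]
    · rw [(hh s).eq_zero_of_ne_zero hl, mul_zero]
  induction n generalizing l h with
  | zero => intro s hs; omega
  | succ n ih =>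
    have hl := congrArg (lap N r) hsum
    have hc : ∀ s : ℕ, IsHom (l - 2 - 2 * s) (radSum N r (s + 1) (l - 2 - 2 * s) • h (s + 1)) := by
      intro s
      have := (hh (s + 1)).smul (radSum N r (s + 1) (l - 2 - 2 * s))
      convert this using 1
      push_cast
      ring
    rw [map_sum, map_zero, sum_congr rfl fun s _ => lap_radius_pow_mul s (hh s),
      sum_range_succ'] at hl
    simp only [h0, mul_zero, zero_add, Nat.add_sub_cancel] at hl
    have h1 := ih (h := fun s => radSum N r (s + 1) (l - 2 - 2 * s) • h (s + 1)) hc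
      (fun s => by rw [map_smul, h0, smul_zero]) (by
        rw [show radSum N r 0 (l - 2 * ((0 : ℕ) : ℤ)) = 0 by simp [radSum], zero_smul,
          add_zero] at hl
        rw [← hl]
        refine sum_congr rfl fun s _ => ?_
        rw [mul_smul_comm]
        congr 2
        push_cast
        ring)
    have h2 : ∀ s < n, radius N r ^ (s + 1) * h (s + 1) = 0 := by
      intro s hs
      by_cases hd : l - 2 * ((s + 1 : ℕ) : ℤ) < 0
      · rw [(hh _).eq_zero_of_neg hd, mul_zero]
      · have := h1 s hs
        rw [mul_smul_comm] at this
        have := (smul_eq_zero.mp this).resolve_left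
          (radSum_ne_zero (Nat.succ_ne_zero s) (by push_cast at hd ⊢; omega))
        rw [pow_succ', mul_assoc, this, mul_zero]
    intro s hs
    rcases s with _ | s
    · rw [sum_range_succ', sum_eq_zero fun s hs => h2 s (mem_range.mp hs), zero_add] at hsum
      exact hsum
    · exact h2 s (by omega)

theorem radius_pow_mul_eq_zero_of_sum {ι : Type} {S : Finset ι} {e : ι → ℕ}
    (he : Set.InjOn e S) {l : ℤ} {h : ι → Alg N r} (hh : ∀ i ∈ S, IsHom (l - 2 * e i) (h i))
    (h0 : ∀ i ∈ S, lap N r (h i) = 0) (hsum : ∑ i ∈ S, radius N r ^ e i * h i = 0) :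
    ∀ i ∈ S, radius N r ^ e i * h i = 0 := by
  classical
  intro i hi
  have hlt : ∀ i ∈ S, e i < S.sup e + 1 := fun i hi => Nat.lt_succ_of_le (le_sup hi)
  have h1 := radius_pow_mul_eq_zero_of_sum_range (l := l) (n := S.sup e + 1)
    (h := fun s => ∑ i ∈ S with e i = s, h i)
    (fun s : ℕ => IsHom.sum _ _ fun i hi => by
      rw [mem_filter] at hi
      rw [← hi.2]
      exact hh i hi.1)
    (fun s => by
      rw [map_sum]
      exact sum_eq_zero fun i hi => h0 i (mem_filter.mp hi).1)
    (by
      rw [← hsum, ← sum_fiberwise_of_maps_to fun i hi => mem_range.mpr (hlt i hi)]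
      refine sum_congr rfl fun s _ => ?_
      rw [mul_sum]
      exact sum_congr rfl fun i hi => by rw [(mem_filter.mp hi).2]) (e i) (hlt i hi)
  rwa [show (∑ j ∈ S with e j = e i, h j) = h i from by
    rw [← sum_singleton h i]
    refine sum_congr ?_ fun _ _ => rfl
    ext j
    rw [mem_filter, mem_singleton]
    exact ⟨fun hj => he hj.1 hi hj.2, by rintro rfl; exact ⟨hi, rfl⟩⟩] at h1

end Fischer

/-! ### Boundary components -/

section Boundary

variable {N : ℕ} {r : ℂ} [Generic r]

theorem isHom_comp {d : ℤ} {p : Alg (N + 2) r} (hp : IsHom d p) (i j : ℕ) :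
    IsHom (d - i - j) (comp i j p) := by
  have key : (r ^ 2) ^ (i + j) • ((theta N r (r ^ 2)).toLinearMap ∘ₗ comp i j) =
      comp i j ∘ₗ (theta (N + 2) r (r ^ 2)).toLinearMap := by
    refine hom_ext_tri fun a b f => ?_
    simp only [LinearMap.smul_apply, LinearMap.comp_apply, AlgHom.toLinearMap_apply, theta_tri,
      map_smul, comp_tri]
    split_ifs with h
    · rw [h.1, h.2]
    · simp
  have h := LinearMap.congr_fun key p
  simp only [LinearMap.smul_apply, LinearMap.comp_apply, AlgHom.toLinearMap_apply] at h
  rw [hp, map_smul] at h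
  have hq : (r ^ 2) ^ (i + j) ≠ 0 := pow_ne_zero _ (q_ne r)
  rw [IsHom, sub_sub, zpow_sub₀ (q_ne r), div_eq_inv_mul, mul_smul, ← h, smul_smul,
    ← Nat.cast_add, zpow_natCast, inv_mul_cancel₀ hq, one_smul]

theorem comp_lap (i j : ℕ) (p : Alg (N + 2) r) : comp i j (lap (N + 2) r p) =
    (qn r (i + 1) * qn r (j + 1) * r ^ (-(N : ℤ))) • comp (i + 1) (j + 1) p +
      (r ^ 2) ^ (i + j) • lap N r (comp i j p) := by
  suffices h : comp i j ∘ₗ lap (N + 2) r =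
      (qn r (i + 1) * qn r (j + 1) * r ^ (-(N : ℤ))) • comp (i + 1) (j + 1) +
      (r ^ 2) ^ (i + j) • (lap N r ∘ₗ comp i j) from LinearMap.congr_fun h p
  refine hom_ext_tri fun a b f => ?_
  simp only [LinearMap.add_apply, LinearMap.smul_apply, LinearMap.comp_apply, lap_tri, map_add,
    map_smul, comp_tri]
  congr 1
  · rcases a with _ | a
    · simp
    rcases b with _ | b
    · simp
    simp only [Nat.add_sub_cancel, Nat.add_right_cancel_iff]
    split_ifs with h
    · rw [h.1, h.2]
    · simp
  · split_ifs with h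
    · rw [h.1, h.2]
    · simp

theorem qn_succ_ne_zero (n : ℕ) : qn r (n + 1) ≠ 0 := by
  rw [qn_eq]
  refine div_ne_zero (mul_ne_zero ?_ (q_ne r)) (r_four_sub_one_ne r)
  rw [sub_ne_zero, ← zpow_natCast, ← zpow_neg]
  intro h
  have := q_zpow_inj h
  omega

/-- In `comp_lap` the coefficient of the component at `(i+1, j+1)` is nonzero, so zeros propagate
along diagonals from the boundary. -/
theorem eq_zero_of_boundary {p : Alg (N + 2) r} (hp : lap (N + 2) r p = 0)
    (h : ∀ i j : ℕ, i = 0 ∨ j = 0 → comp i j p = 0) : p = 0 := by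
  refine comp_ext fun i j => ?_
  rw [map_zero]
  induction i generalizing j with
  | zero => exact h 0 j (Or.inl rfl)
  | succ i ih =>
    rcases j with _ | j
    · exact h _ 0 (Or.inr rfl)
    · have h1 := comp_lap i j p
      rw [hp, map_zero, ih j, map_zero, smul_zero, add_zero] at h1
      exact (smul_eq_zero.mp h1.symm).resolve_left (mul_ne_zero
        (mul_ne_zero (qn_succ_ne_zero i) (qn_succ_ne_zero j)) (zpow_ne_zero _ (r_ne r)))

/-- The `α`-part of `Q` raises both exponents and never reaches the boundary. -/
theorem comp_radius_mul {i j : ℕ} (h : i = 0 ∨ j = 0) (p : Alg (N + 2) r) :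
    comp i j (radius (N + 2) r * p) = betaC N r • (radius N r * comp i j p) := by
  suffices h : comp i j ∘ₗ LinearMap.mulLeft ℂ (radius (N + 2) r) =
      betaC N r • (LinearMap.mulLeft ℂ (radius N r) ∘ₗ comp i j) from LinearMap.congr_fun h p
  refine hom_ext_tri fun a b f => ?_
  simp only [LinearMap.smul_apply, LinearMap.comp_apply, LinearMap.mulLeft_apply, radius_mul_tri,
    map_add, map_smul, comp_tri]
  rw [if_neg (by omega), smul_zero, zero_add]
  split_ifs <;> simp

theorem comp_radius_pow_mul {i j : ℕ} (h : i = 0 ∨ j = 0) (k : ℕ) (p : Alg (N + 2) r) :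
    comp i j (radius (N + 2) r ^ k * p) = betaC N r ^ k • (radius N r ^ k * comp i j p) := by
  induction k with
  | zero => simp
  | succ k ih =>
    rw [pow_succ', mul_assoc, comp_radius_mul h, ih, mul_smul_comm, smul_smul, ← mul_assoc,
      ← pow_succ', ← pow_succ']

end Boundary

/-! ### Harmonic polynomials in the inner variables -/

section Inner

variable {N : ℕ} {r : ℂ} [Generic r]

/-- In degree `m`, `Δ_q` is `L` times the nonzero scalar `lapConst * q ^ m`. -/
theorem mem_harm {m : ℕ} {p : Alg N r} : p ∈ harm N r m ↔ IsHom m p ∧ lap N r p = 0 := by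
  rw [harm, Submodule.mem_inf, mem_homog, LinearMap.mem_ker]
  refine and_congr_right fun hp => ?_
  rw [laplace_eq, hp, map_smul, smul_smul, smul_eq_zero, or_iff_right]
  exact mul_ne_zero (lapConst_ne_zero N) (zpow_ne_zero _ (q_ne r))

theorem emb_injective : Function.Injective (emb N r) := by
  intro f g h
  have := congrArg (comp 0 0) h
  rwa [← tri_zero_zero, ← tri_zero_zero, comp_tri, comp_tri, if_pos ⟨rfl, rfl⟩,
    if_pos ⟨rfl, rfl⟩] at this

omit [Generic r] in
theorem innerIdx_eq : innerIdx (N + 2) = univ.image (mid : Fin N → Fin (N + 2)) := by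
  ext i
  simp only [innerIdx, mem_filter, mem_univ, true_and, mem_image]
  induction i using fin_cases_mid with
  | zero => simp [mid_ne_zero]
  | mid i =>
    have := i.isLt
    simp [mid_inj]
  | last => simp [mid_ne_last]

omit [Generic r] in
theorem adjoin_range_x : Algebra.adjoin ℂ (Set.range (x N r)) = ⊤ := by
  refine eq_top_iff.mpr fun p _ => ?_
  induction p using alg_induction with
  | algebraMap c => exact Subalgebra.algebraMap_mem _ c
  | gen i => exact Algebra.subset_adjoin ⟨i, rfl⟩
  | mul a b ha hb => exact mul_mem (ha trivial) (hb trivial)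
  | add a b ha hb => exact add_mem (ha trivial) (hb trivial)

theorem innerAlg_eq : innerAlg (N + 2) r = (emb N r).range := by
  have h : x (N + 2) r '' (innerIdx (N + 2) : Set (Fin (N + 2))) =
      emb N r '' Set.range (x N r) := by
    rw [innerIdx_eq, coe_image, coe_univ, Set.image_univ, ← Set.range_comp, ← Set.range_comp]
    exact congrArg Set.range (funext fun i => (emb_x i).symm)
  rw [innerAlg, h, ← AlgHom.map_adjoin, adjoin_range_x, Algebra.map_top]

theorem innerLaplace_emb (f : Alg N r) :
    innerLaplace (N + 2) r (emb N r f) = emb N r (laplace N r f) := by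
  rw [innerLaplace, innerIdx_eq, sum_image fun i _ j _ h => mid_inj.mp h, laplace,
    LinearMap.sum_apply, LinearMap.sum_apply, map_sum]
  refine sum_congr rfl fun i _ => ?_
  simp only [LinearMap.smul_apply, LinearMap.comp_apply, ← tri_zero_zero, mid_rev, partialOp_mid,
    pow_zero, one_smul, rhoTwo_mid, map_smul]

theorem mem_innerHarm {l : ℕ} {p : Alg (N + 2) r} : p ∈ innerHarm (N + 2) r l ↔
    ∃ h : Alg N r, IsHom l h ∧ lap N r h = 0 ∧ emb N r h = p := by
  rw [innerHarm, Submodule.mem_inf, Submodule.mem_inf, Subalgebra.mem_toSubmodule, innerAlg_eq,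
    mem_homog, LinearMap.mem_ker]
  constructor
  · rintro ⟨⟨h1, ⟨h, rfl⟩⟩, h2⟩
    have hh : IsHom l h := emb_injective (by
      rw [← theta_emb, map_smul]; exact h1)
    refine ⟨h, hh, ?_, rfl⟩
    have h3 := innerLaplace_emb h
    rw [show innerLaplace (N + 2) r (emb N r h) = 0 from h2] at h3
    exact (mem_harm.mp ⟨mem_homog.mpr hh, emb_injective (by rw [← h3, map_zero])⟩).2
  · rintro ⟨h, h1, h2, rfl⟩
    refine ⟨⟨isHom_emb h1, ⟨h, rfl⟩⟩, ?_⟩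
    rw [innerLaplace_emb, LinearMap.mem_ker.mp (mem_harm.mpr ⟨h1, h2⟩).2, map_zero]

end Inner

/-! ### The polynomials `t^{N,m}_{a b}` -/

section TPoly

variable {N : ℕ} {r : ℂ} [Generic r]

/-- The coefficients of `t^{N+2,m}_{a b} h`, for `h` of degree `l` in the inner variables, with
respect to the elements `Q ^ k x_1 ^ (a - k) h x_{1'} ^ (b - k)`. -/
def tExp (N : ℕ) (r : ℂ) (a b l k : ℕ) : ℂ :=
  tCoeff (N + 2) r (a + b + l) a b k * (((r ^ 2) ^ l) ^ (b - k))⁻¹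

theorem xl_pow_mul_emb {l : ℕ} {h : Alg N r} (hh : IsHom l h) (b : ℕ) :
    xl N r ^ b * emb N r h = (((r ^ 2) ^ l) ^ b)⁻¹ • (emb N r h * xl N r ^ b) := by
  have hq : ((r ^ 2) ^ l) ^ b ≠ 0 := pow_ne_zero _ (pow_ne_zero _ (q_ne r))
  have hθ : theta N r ((r ^ 2) ^ b) h = ((r ^ 2) ^ l) ^ b • h := by
    induction b with
    | zero => simp [theta_one]
    | succ b ih =>
      rw [theta_pow, ih (pow_ne_zero _ (pow_ne_zero _ (q_ne r))), map_smul, hh, smul_smul,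
        zpow_natCast, ← pow_succ]
  rw [emb_mul_xl_pow, hθ, map_smul, mul_smul_comm, smul_smul, inv_mul_cancel₀ hq, one_smul]

theorem tPoly_mul_emb {l : ℕ} {h : Alg N r} (hh : IsHom l h) (hN : 2 ≤ N + 2) (a b : ℕ) :
    tPoly hN r (a + b + l) a b * emb N r h = ∑ k ∈ range (min a b + 1),
      tExp N r a b l k • (radius (N + 2) r ^ k * tri (a - k) (b - k) h) := by
  rw [tPoly, sum_mul]
  refine sum_congr rfl fun k _ => ?_
  change (tCoeff (N + 2) r (a + b + l) a b k • (radius (N + 2) r ^ k * xf N r ^ (a - k) *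
    x (N + 2) r (Fin.rev 0) ^ (b - k))) * emb N r h = _
  rw [zero_rev, smul_mul_assoc, mul_assoc, xl_pow_mul_emb hh, mul_smul_comm, smul_smul, tExp,
    tri_apply]
  simp only [mul_assoc]

theorem isHom_tPoly_mul_emb {l : ℕ} {h : Alg N r} (hh : IsHom l h) (hN : 2 ≤ N + 2) (a b : ℕ) :
    IsHom (a + b + l : ℕ) (tPoly hN r (a + b + l) a b * emb N r h) := by
  rw [tPoly_mul_emb hh]
  refine IsHom.sum _ _ fun k hk => IsHom.smul ?_ _
  have hk' : k ≤ a ∧ k ≤ b := by rw [mem_range] at hk; omega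
  convert (isHom_radius_pow k).mul (isHom_tri hh (a - k) (b - k)) using 1
  push_cast [hk'.1, hk'.2]
  ring

omit [Generic r] in
theorem tCoeff_succ (N m a b k : ℕ) : tCoeff N r m a b (k + 1) = tCoeff N r m a b k *
    ((1 - (r ^ 2) ^ (-2 * (a : ℤ)) * ((r ^ 2) ^ 2) ^ k) *
      (1 - (r ^ 2) ^ (-2 * (b : ℤ)) * ((r ^ 2) ^ 2) ^ k) /
      ((1 - (r ^ 2) ^ 2 * ((r ^ 2) ^ 2) ^ k) *
        (1 - (r ^ 2) ^ (-(N : ℤ) - 2 * m + 4) * ((r ^ 2) ^ 2) ^ k)) *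
      (r ^ (2 - (N : ℤ) - 4 * ((m : ℤ) - a - b) + 4) / (1 + (r ^ 2) ^ ((N : ℤ) - 2)))) := by
  have h : r ^ ((2 - (N : ℤ) - 4 * ((m : ℤ) - a - b) + 4) * ((k + 1 : ℕ) : ℤ)) =
      r ^ ((2 - (N : ℤ) - 4 * ((m : ℤ) - a - b) + 4) * (k : ℤ)) *
        r ^ (2 - (N : ℤ) - 4 * ((m : ℤ) - a - b) + 4) := by
    rw [zpow_mul, zpow_mul, zpow_natCast, zpow_natCast, pow_succ]
  simp only [tCoeff, qPoch_succ, h, pow_succ (1 + (r ^ 2) ^ ((N : ℤ) - 2)), div_eq_mul_inv,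
    mul_inv]
  ring

theorem one_sub_ne_zero {e : ℤ} {c : ℂ} (hc : c = r ^ e) (he : e ≠ 0) : 1 - c ≠ 0 := by
  rw [hc]; exact sub_ne_zero.mpr (r_zpow_ne_one r he).symm

/-- As `k ≤ min(a,b)`, the numerators have not yet reached their zero factor. The denominator in `m`
is safe because `2k ≤ a + b ≤ m` keeps its exponents negative. -/
theorem tCoeff_ne_zero {m a b k : ℕ} (hk : k ≤ min a b) (hm : a + b ≤ m) :
    tCoeff (N + 2) r m a b k ≠ 0 := by
  have hr := r_ne r
  induction k with
  | zero => simp [tCoeff, qPoch]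
  | succ k ih =>
    rw [tCoeff_succ]
    have e : ∀ z : ℤ, (r ^ 2) ^ z * ((r ^ 2) ^ 2) ^ k = r ^ (2 * z + 4 * k) := by
      intro z
      rw [zpow_add₀ hr, zpow_mul, zpow_mul]; norm_cast; rw [← pow_mul r 2 2]
    have e2 : (r ^ 2) ^ 2 * ((r ^ 2) ^ 2) ^ k = r ^ (4 + 4 * (k : ℤ)) := by
      rw [zpow_add₀ hr, zpow_mul]; norm_cast; rw [← pow_mul r 2 2]
    refine mul_ne_zero (ih (by omega)) (mul_ne_zero (div_ne_zero (mul_ne_zero ?_ ?_)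
      (mul_ne_zero ?_ ?_)) (div_ne_zero (zpow_ne_zero _ hr) ?_))
    · exact one_sub_ne_zero (e _) (by omega)
    · exact one_sub_ne_zero (e _) (by omega)
    · exact one_sub_ne_zero e2 (by omega)
    · exact one_sub_ne_zero (e _) (by push_cast; omega)
    · have := r_zpow_add_ne_zero r 0 (2 * (((N + 2 : ℕ) : ℤ) - 2))
      rw [zpow_mul, zpow_zero] at this
      exact_mod_cast this

theorem tExp_ne_zero {a b k : ℕ} (l : ℕ) (hk : k ≤ min a b) : tExp N r a b l k ≠ 0 :=
  mul_ne_zero (tCoeff_ne_zero hk (Nat.le_add_right _ _))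
    (inv_ne_zero (pow_ne_zero _ (pow_ne_zero _ (q_ne r))))

/-- This is the requirement that the coefficient of `Q ^ k x_1 ^ (a-k-1) h x_{1'} ^ (b-k-1)` in `L
(t h)` be zero. The two factors in the closed form of `radSum` are, up to units, the two denominator
factors that `tCoeff` gains from `k` to `k + 1`. -/
theorem tExp_recursion {a b k : ℕ} (l : ℕ) (hk : k < min a b) :
    tExp N r a b l k * (qn r (a - k) * qn r (b - k) * r ^ (-(N : ℤ))) +
      tExp N r a b l (k + 1) *
        radSum (N + 2) r (k + 1) (((a + b + l : ℕ) : ℤ) - 2 * ((k + 1 : ℕ) : ℤ)) = 0 := by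
  -- With `a = k + u + 1` and `b = k + v + 1` no truncated subtraction remains, and all powers are
  -- monomials in `r`, `r ^ N` and the powers of `q` with exponents `u, v, k, l`.
  obtain ⟨u, rfl⟩ : ∃ u, a = k + (u + 1) := ⟨a - k - 1, by omega⟩
  obtain ⟨v, rfl⟩ : ∃ v, b = k + (v + 1) := ⟨b - k - 1, by omega⟩
  have hr := r_ne r
  have h4 := r_four_sub_one_ne r
  have hq := q_ne r
  have hw1 := rN_sq_add_one_ne (r := r) N
  have e1 : ∀ u : ℕ, (r ^ 2) ^ (-2 * ((k + (u + 1) : ℕ) : ℤ)) * ((r ^ 2) ^ 2) ^ k =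
      (((r ^ 2) ^ u) ^ 2 * r ^ 4)⁻¹ := by
    intro u
    simp only [← zpow_natCast, ← zpow_mul, ← zpow_add₀ hr, ← zpow_neg]
    congr 1; push_cast; ring
  have e2 : (r ^ 2) ^ 2 * ((r ^ 2) ^ 2) ^ k = r ^ 4 * ((r ^ 2) ^ k) ^ 2 := by
    rw [← pow_mul, ← pow_mul, ← pow_mul, ← pow_mul]; ring
  have e3 : (r ^ 2) ^ (-((N + 2 : ℕ) : ℤ) - 2 * ((k + (u + 1) + (k + (v + 1)) + l : ℕ) : ℤ) + 4) *
      ((r ^ 2) ^ 2) ^ k = ((r ^ (N : ℤ)) ^ 2 * r ^ 4 * ((r ^ 2) ^ k) ^ 2 * ((r ^ 2) ^ u) ^ 2 *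
        ((r ^ 2) ^ v) ^ 2 * ((r ^ 2) ^ l) ^ 2)⁻¹ := by
    simp only [← zpow_natCast, ← zpow_mul, ← zpow_add₀ hr, ← zpow_neg]
    congr 1; push_cast; ring
  have e4 : r ^ (2 - ((N + 2 : ℕ) : ℤ) - 4 * (((k + (u + 1) + (k + (v + 1)) + l : ℕ) : ℤ) -
      ((k + (u + 1) : ℕ) : ℤ) - ((k + (v + 1) : ℕ) : ℤ)) + 4) =
      r ^ 4 * (r ^ (N : ℤ) * ((r ^ 2) ^ l) ^ 2)⁻¹ := by
    simp only [← zpow_natCast, ← zpow_mul, ← zpow_add₀ hr, ← zpow_neg]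
    congr 1; push_cast; ring
  have e5 : (r ^ 2) ^ (((N + 2 : ℕ) : ℤ) - 2) = (r ^ (N : ℤ)) ^ 2 := by
    simp only [← zpow_natCast, ← zpow_mul]
    congr 1; push_cast; ring
  have e6 : (r ^ 2) ^ (((k + (u + 1) + (k + (v + 1)) + l : ℕ) : ℤ) - 2 * ((k + 1 : ℕ) : ℤ)) =
      (r ^ 2) ^ u * (r ^ 2) ^ v * (r ^ 2) ^ l := by
    simp only [← zpow_natCast, ← zpow_mul, ← zpow_add₀ hr]
    congr 1; push_cast; ring
  have e7 : r ^ ((N + 2 : ℕ) : ℤ) = r ^ (N : ℤ) * r ^ 2 := by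
    rw [Nat.cast_add, zpow_add₀ hr]; norm_cast
  have n1 : 1 - r ^ 4 * ((r ^ 2) ^ k) ^ 2 ≠ 0 := by
    refine one_sub_ne_zero (r := r) (e := 4 + 4 * (k : ℤ)) ?_ (by omega)
    simp only [← zpow_natCast, ← zpow_mul, ← zpow_add₀ hr]
    congr 1; push_cast; ring
  have n2 : (r ^ (N : ℤ)) ^ 2 * r ^ 4 * ((r ^ 2) ^ k) ^ 2 * ((r ^ 2) ^ u) ^ 2 *
        ((r ^ 2) ^ v) ^ 2 * ((r ^ 2) ^ l) ^ 2 - 1 ≠ 0 := by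
    rw [← neg_sub, neg_ne_zero]
    refine one_sub_ne_zero (r := r) (e := 2 * N + 4 + 4 * (k : ℤ) + 4 * u + 4 * v + 4 * l) ?_ (by omega)
    simp only [← zpow_natCast, ← zpow_mul, ← zpow_add₀ hr]
    congr 1; push_cast; ring
  rw [tExp, tExp, tCoeff_succ, e1, e1, e2, e3, e4, e5, radSum_eq, radConst_eq, e6, e7,
    show k + (u + 1) - k = u + 1 by omega, show k + (v + 1) - k = v + 1 by omega,
    show k + (v + 1) - (k + 1) = v by omega, qn_eq, qn_eq, zpow_neg, pow_succ (r ^ 2) u,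
    pow_succ (r ^ 2) v, pow_succ (r ^ 2) k, pow_succ ((r ^ 2) ^ l) v]
  generalize tCoeff _ _ _ _ _ _ = C
  have hw : r ^ (N : ℤ) ≠ 0 := zpow_ne_zero _ hr
  have hu : (r ^ 2) ^ u ≠ 0 := pow_ne_zero _ hq
  have hv : (r ^ 2) ^ v ≠ 0 := pow_ne_zero _ hq
  have hk : (r ^ 2) ^ k ≠ 0 := pow_ne_zero _ hq
  have hl : (r ^ 2) ^ l ≠ 0 := pow_ne_zero _ hq
  have hlv : ((r ^ 2) ^ l) ^ v ≠ 0 := pow_ne_zero _ hl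
  clear e1 e2 e3 e4 e5 e6 e7
  generalize ((r ^ 2) ^ l) ^ v = Z at *
  generalize (r ^ 2) ^ u = U at *
  generalize (r ^ 2) ^ v = V at *
  generalize (r ^ 2) ^ k = Y at *
  generalize (r ^ 2) ^ l = L at *
  generalize r ^ (N : ℤ) = w at *
  have hw1' : 1 + w ^ 2 ≠ 0 := by rw [add_comm]; exact hw1
  rw [show 1 - (w ^ 2 * r ^ 4 * Y ^ 2 * U ^ 2 * V ^ 2 * L ^ 2)⁻¹ =
    (w ^ 2 * r ^ 4 * Y ^ 2 * U ^ 2 * V ^ 2 * L ^ 2 - 1) /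
      (w ^ 2 * r ^ 4 * Y ^ 2 * U ^ 2 * V ^ 2 * L ^ 2) by field_simp]
  -- The two denominator factors are kept opaque while clearing denominators, so that their
  -- nonvanishing `n1`, `n2` applies, and are expanded only for the final polynomial identity.
  generalize hX : w ^ 2 * r ^ 4 * Y ^ 2 * U ^ 2 * V ^ 2 * L ^ 2 - 1 = X at *
  generalize hT : 1 - r ^ 4 * Y ^ 2 = T at *
  field_simp
  rw [← hX, ← hT]
  ring

end TPoly

/-! ### The direct sum decomposition -/

section Decomposition

variable {N : ℕ} {r : ℂ} [Generic r]

theorem lap_tPoly_mul_emb {l : ℕ} {h : Alg N r} (hh : IsHom l h) (h0 : lap N r h = 0)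
    (hN : 2 ≤ N + 2) (a b : ℕ) :
    lap (N + 2) r (tPoly hN r (a + b + l) a b * emb N r h) = 0 := by
  have hdeg : ∀ k ≤ min a b,
      IsHom (((a + b + l : ℕ) : ℤ) - 2 * (k : ℤ)) (tri (a - k) (b - k) h) := by
    intro k hk
    have hk' : k ≤ a ∧ k ≤ b := by omega
    convert isHom_tri hh (a - k) (b - k) using 1
    push_cast [hk'.1, hk'.2]
    ring
  have hterm : ∀ k ∈ range (min a b + 1),
      lap (N + 2) r (tExp N r a b l k • (radius (N + 2) r ^ k * tri (a - k) (b - k) h)) =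
      (tExp N r a b l k * (qn r (a - k) * qn r (b - k) * r ^ (-(N : ℤ)))) •
        (radius (N + 2) r ^ k * tri (a - k - 1) (b - k - 1) h) +
      (tExp N r a b l k * radSum (N + 2) r k (((a + b + l : ℕ) : ℤ) - 2 * (k : ℤ))) •
        (radius (N + 2) r ^ (k - 1) * tri (a - k) (b - k) h) := by
    intro k hk
    rw [mem_range] at hk
    rw [map_smul, lap_radius_pow_mul k (hdeg k (by omega)), lap_tri, h0, map_zero, smul_zero,
      add_zero, mul_smul_comm, smul_add, smul_smul, smul_smul]
  rw [tPoly_mul_emb hh, map_sum, sum_congr rfl hterm, sum_add_distrib, sum_range_succ,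
    sum_range_succ']
  -- The lowering part of the last term and the commutator part of the first term vanish; the
  -- remaining terms pair up by `tExp_recursion`.
  have z1 : qn r (a - min a b) * qn r (b - min a b) = 0 := by
    rcases le_total a b with h | h
    · rw [min_eq_left h, Nat.sub_self, qn_zero, zero_mul]
    · rw [min_eq_right h, Nat.sub_self, qn_zero, mul_zero]
  rw [z1, show radSum (N + 2) r 0 (((a + b + l : ℕ) : ℤ) - 2 * ((0 : ℕ) : ℤ)) = 0 by simp [radSum]]
  simp only [zero_mul, mul_zero, zero_smul, add_zero]
  rw [← sum_add_distrib]
  refine sum_eq_zero fun k hk => ?_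
  rw [Nat.add_sub_cancel, Nat.sub_sub, Nat.sub_sub, ← add_smul,
    tExp_recursion l (mem_range.mp hk), zero_smul]

/-- The scalar by which the leading boundary component of `t^{N+2,m}_{a b} h` is multiplied. -/
def bdConst (N : ℕ) (r : ℂ) (a b l : ℕ) : ℂ := tExp N r a b l (min a b) * betaC N r ^ min a b

theorem bdConst_ne_zero (a b l : ℕ) : bdConst N r a b l ≠ 0 :=
  mul_ne_zero (tExp_ne_zero l le_rfl) (pow_ne_zero _ (betaC_ne_zero N))

/-- The term with index `k` sits at `(a-k, b-k)`, and powers of `Q` do not move it along the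
boundary; only `k = min(a,b)` is a boundary place. Truncated subtraction writes that place as `(a -
b, b - a)`. -/
theorem comp_tPoly_mul_emb {l : ℕ} {h : Alg N r} (hh : IsHom l h) (hN : 2 ≤ N + 2) (a b : ℕ)
    {i j : ℕ} (hij : i = 0 ∨ j = 0) :
    comp i j (tPoly hN r (a + b + l) a b * emb N r h) =
      if a - b = i ∧ b - a = j then bdConst N r a b l • (radius N r ^ min a b * h) else 0 := by
  rw [tPoly_mul_emb hh, map_sum]
  simp only [map_smul, comp_radius_pow_mul hij, comp_tri]
  rw [sum_eq_single (min a b)]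
  · have : (a - min a b = i ∧ b - min a b = j) ↔ (a - b = i ∧ b - a = j) := by omega
    simp only [this]
    split_ifs
    · rw [smul_smul, bdConst]
    · simp
  · intro k hk hne
    rw [mem_range] at hk
    rw [if_neg (by omega)]
    simp
  · intro h
    exact absurd (mem_range.mpr (by omega)) h

theorem mem_summand {m a b : ℕ} (hab : a + b ≤ m) (hN : 2 ≤ N + 2) {p : Alg (N + 2) r} :
    p ∈ summand hN r m a b ↔ ∃ h : Alg N r, IsHom (m - a - b : ℕ) h ∧ lap N r h = 0 ∧
      tPoly hN r (a + b + (m - a - b)) a b * emb N r h = p := by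
  rw [summand, Submodule.mem_map, show a + b + (m - a - b) = m by omega]
  constructor
  · rintro ⟨g, hg, rfl⟩
    obtain ⟨h, h1, h2, rfl⟩ := mem_innerHarm.mp hg
    exact ⟨h, h1, h2, rfl⟩
  · rintro ⟨h, h1, h2, rfl⟩
    exact ⟨emb N r h, mem_innerHarm.mpr ⟨h, h1, h2, rfl⟩, rfl⟩

theorem summand_le_harm {m a b : ℕ} (hab : a + b ≤ m) (hN : 2 ≤ N + 2) :
    summand hN r m a b ≤ harm (N + 2) r m := by
  intro p hp
  obtain ⟨h, h1, h2, rfl⟩ := (mem_summand hab hN).mp hp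
  refine mem_harm.mpr ⟨?_, lap_tPoly_mul_emb h1 h2 hN a b⟩
  have := isHom_tPoly_mul_emb h1 hN a b
  rwa [show a + b + (m - a - b) = m by omega] at this ⊢

/-- At a fixed boundary place only pairs with a fixed difference contribute, and they are told apart
by `min(a,b)`. Uniqueness of the inner decomposition kills each contribution, hence all boundary
components of each summand's element. -/
theorem iSupIndep_summand (hN : 2 ≤ N + 2) (m : ℕ) :
    iSupIndep fun p : {p : ℕ × ℕ // p.1 + p.2 ≤ m} => summand hN r m p.1.1 p.1.2 := by
  rw [iSupIndep_iff_finsetSum_eq_zero_imp_eq_zero]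
  intro S v hv hsum
  have hex : ∀ p : {p : ℕ × ℕ // p.1 + p.2 ≤ m}, ∃ h : Alg N r,
      IsHom (m - p.1.1 - p.1.2 : ℕ) h ∧ lap N r h = 0 ∧ (p ∈ S →
        tPoly hN r (p.1.1 + p.1.2 + (m - p.1.1 - p.1.2)) p.1.1 p.1.2 * emb N r h = v p) := by
    intro p
    by_cases hp : p ∈ S
    · obtain ⟨h, h1, h2, h3⟩ := (mem_summand p.2 hN).mp (hv p hp)
      exact ⟨h, h1, h2, fun _ => h3⟩
    · exact ⟨0, IsHom.zero _, map_zero _, fun h => absurd h hp⟩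
  choose h h1 h2 h3 using hex
  intro p hp
  rw [← h3 p hp]
  refine eq_zero_of_boundary (lap_tPoly_mul_emb (h1 p) (h2 p) hN _ _) fun i j hij => ?_
  rw [comp_tPoly_mul_emb (h1 p) hN _ _ hij]
  split_ifs with hpij
  swap
  · rfl
  have hcomp := congrArg (comp i j) hsum
  rw [map_sum, map_zero, sum_congr rfl fun p hp => by
    rw [← h3 p hp, comp_tPoly_mul_emb (h1 p) hN _ _ hij], ← sum_filter] at hcomp
  have := radius_pow_mul_eq_zero_of_sum (l := (m : ℤ) - i - j)
    (S := S.filter fun p => p.1.1 - p.1.2 = i ∧ p.1.2 - p.1.1 = j)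
    (e := fun p => min p.1.1 p.1.2)
    (h := fun p => bdConst N r p.1.1 p.1.2 (m - p.1.1 - p.1.2) • h p)
    (fun p hp p' hp' e => by
      have h1 := (mem_filter.mp hp).2
      have h2 := (mem_filter.mp hp').2
      change min p.1.1 p.1.2 = min p'.1.1 p'.1.2 at e
      refine Subtype.ext (Prod.ext ?_ ?_) <;> omega)
    (fun p hp => by
      have e1 := (mem_filter.mp hp).2
      have e2 := p.2
      convert (h1 p).smul (bdConst N r p.1.1 p.1.2 (m - p.1.1 - p.1.2)) using 1
      omega)
    (fun p _ => by rw [map_smul, h2, smul_zero])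
    (by rw [← hcomp]; exact sum_congr rfl fun p _ => by rw [mul_smul_comm])
    p (mem_filter.mpr ⟨hp, hpij⟩)
  rwa [mul_smul_comm] at this

/-- Decompose every boundary component into `Q' ^ s h_s` and build from each piece the element of a
summand with that boundary component. The sum is harmonic with the same boundary as `p`, hence
equals `p`. -/
theorem harm_le_iSup_summand (hN : 2 ≤ N + 2) (m : ℕ) : harm (N + 2) r m ≤
    ⨆ p : {p : ℕ × ℕ // p.1 + p.2 ≤ m}, summand hN r m p.1.1 p.1.2 := by
  intro p hp
  obtain ⟨hm, h0⟩ := mem_harm.mp hp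
  choose h h1 h2 h3 using fun ij : ℕ × ℕ =>
    exists_harmonic_decomposition (isHom_comp hm ij.1 ij.2)
  have hdeg : ∀ (ij : ℕ × ℕ) (s : ℕ), ij.1 + ij.2 + 2 * s ≤ m →
      IsHom (m - (ij.1 + s) - (ij.2 + s) : ℕ) (h ij s) := by
    intro ij s hs
    convert h1 ij s using 1
    omega
  -- For `(i, j)` on the boundary, the pair `(i+s, j+s)` has minimum `s`; division by `bdConst`
  -- makes the boundary component exactly `Q' ^ s h_s`. In the other case `h_s` has negative degree
  -- and is zero.
  let T : ℕ × ℕ → ℕ → Alg (N + 2) r := fun ij s =>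
    if ij.1 + ij.2 + 2 * s ≤ m then
      (bdConst N r (ij.1 + s) (ij.2 + s) (m - (ij.1 + s) - (ij.2 + s)))⁻¹ •
        (tPoly hN r (ij.1 + s + (ij.2 + s) + (m - (ij.1 + s) - (ij.2 + s))) (ij.1 + s) (ij.2 + s) *
          emb N r (h ij s))
    else 0
  let B : Finset (ℕ × ℕ) := (range (m + 1) ×ˢ range (m + 1)).filter fun ij => ij.1 = 0 ∨ ij.2 = 0
  have hlap : ∀ ij s, lap (N + 2) r (T ij s) = 0 := by
    intro ij s
    simp only [T]
    split_ifs with hs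
    · rw [map_smul, lap_tPoly_mul_emb (hdeg ij s hs) (h2 ij s), smul_zero]
    · exact map_zero _
  have hcomp : ∀ ij ∈ B, ∀ s i j, i = 0 ∨ j = 0 →
      comp i j (T ij s) = if ij = (i, j) then radius N r ^ s * h ij s else 0 := by
    rintro ⟨i', j'⟩ hB s i j hij
    have hB' : i' = 0 ∨ j' = 0 := (mem_filter.mp hB).2
    have hd : i' + j' + 2 * s ≤ m → IsHom (m - (i' + s) - (j' + s) : ℕ) (h (i', j') s) :=
      hdeg (i', j') s
    simp only [T]
    split_ifs with hs he he
    · obtain ⟨rfl, rfl⟩ := Prod.mk.inj he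
      rw [map_smul, comp_tPoly_mul_emb (hd hs) hN _ _ hij, if_pos (by omega), smul_smul,
        inv_mul_cancel₀ (bdConst_ne_zero _ _ _), one_smul]
      congr 2
      omega
    · rw [map_smul, comp_tPoly_mul_emb (hd hs) hN _ _ hij, if_neg, smul_zero]
      rintro ⟨e1, e2⟩
      exact he (Prod.ext (by change i' = i; omega) (by change j' = j; omega))
    · rw [(h1 (i', j') s).eq_zero_of_neg (by change ¬ i' + j' + 2 * s ≤ m at hs; dsimp only; omega),
        map_zero, mul_zero]
    · exact map_zero _
  have key : p = ∑ ij ∈ B, ∑ s ∈ range (m + 1), T ij s := by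
    rw [← sub_eq_zero]
    refine eq_zero_of_boundary ?_ fun i j hij => ?_
    · rw [map_sub, h0, map_sum, sum_eq_zero, sub_zero]
      intro ij _
      rw [map_sum]
      exact sum_eq_zero fun s _ => hlap ij s
    · rw [map_sub, map_sum, sub_eq_zero]
      by_cases hB : (i, j) ∈ B
      · rw [sum_eq_single_of_mem (i, j) hB fun ij hij' hne => by
          rw [map_sum]
          exact sum_eq_zero fun s _ => by rw [hcomp ij hij' s i j hij, if_neg hne]]
        rw [map_sum, h3 (i, j) (m + 1) (by push_cast; omega)]
        exact sum_congr rfl fun s _ => by rw [hcomp _ hB s i j hij, if_pos rfl]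
      · have hlt : (m : ℤ) - i - j < 0 := by
          by_contra hge
          refine hB (mem_filter.mpr ⟨mem_product.mpr ⟨mem_range.mpr ?_, mem_range.mpr ?_⟩, hij⟩)
          · change i < m + 1; omega
          · change j < m + 1; omega
        rw [(isHom_comp hm i j).eq_zero_of_neg hlt, sum_eq_zero]
        intro ij hij'
        rw [map_sum]
        refine sum_eq_zero fun s _ => ?_
        rw [hcomp ij hij' s i j hij, if_neg]
        rintro rfl
        exact hB hij'
  rw [key]
  refine Submodule.sum_mem _ fun ij _ => Submodule.sum_mem _ fun s _ => ?_
  simp only [T]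
  split_ifs with hs
  · refine Submodule.smul_mem _ _ (Submodule.mem_iSup_of_mem
      ⟨(ij.1 + s, ij.2 + s), by change ij.1 + s + (ij.2 + s) ≤ m; omega⟩ ?_)
    exact (mem_summand (m := m) (a := ij.1 + s) (b := ij.2 + s) (by omega) hN).mpr ⟨h ij s, hdeg ij s hs, h2 ij s, rfl⟩
  · exact Submodule.zero_mem _

end Decomposition

/-! ### Orthogonality -/

section Orthogonality

variable {N : ℕ} {r : ℂ} [Generic r]

/-- The span of the elements `x_1 ^ a Q'^s z x_{1'} ^ b` with `a - b = w`, where `Q'` is the inner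
squared `q`-radius. -/
def triSpan (w : ℤ) (z : Alg N r) : Submodule ℂ (Alg (N + 2) r) :=
  Submodule.span ℂ {p | ∃ a b s : ℕ, (a : ℤ) - b = w ∧ p = tri a b (radius N r ^ s * z)}

theorem tri_mem_triSpan (a b s : ℕ) (z : Alg N r) :
    tri a b (radius N r ^ s * z) ∈ triSpan ((a : ℤ) - b) z :=
  Submodule.subset_span ⟨a, b, s, rfl, rfl⟩

theorem map_mem_triSpan {w w' : ℤ} {z z' : Alg N r} (φ : Alg (N + 2) r →ₗ[ℂ] Alg (N + 2) r)
    (hφ : ∀ a b s : ℕ, (a : ℤ) - b = w → φ (tri a b (radius N r ^ s * z)) ∈ triSpan w' z')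
    {p : Alg (N + 2) r} (hp : p ∈ triSpan w z) : φ p ∈ triSpan w' z' := by
  have : triSpan w z ≤ (triSpan w' z').comap φ := by
    refine Submodule.span_le.mpr ?_
    rintro _ ⟨a, b, s, hw, rfl⟩
    exact hφ a b s hw
  exact this hp

theorem theta_inv_radius_pow_mul {d : ℤ} {z : Alg N r} (hz : IsHom d z) (s : ℕ) :
    theta N r (r ^ 2)⁻¹ (radius N r ^ s * z) =
      (r ^ 2) ^ (-(2 * s + d)) • (radius N r ^ s * z) :=
  ((isHom_radius_pow s).mul hz).theta_inv

theorem radius_mul_mem_triSpan {d : ℤ} {z : Alg N r} (hz : IsHom d z) {w : ℤ}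
    {p : Alg (N + 2) r} (hp : p ∈ triSpan w z) : radius (N + 2) r * p ∈ triSpan w z := by
  refine map_mem_triSpan (LinearMap.mulLeft ℂ _) (fun a b s hw => ?_) hp
  rw [LinearMap.mulLeft_apply, radius_mul_tri, theta_inv_radius_pow_mul hz, map_smul, smul_smul,
    ← mul_assoc, ← pow_succ']
  refine add_mem (Submodule.smul_mem _ _ ?_) (Submodule.smul_mem _ _ ?_)
  · convert tri_mem_triSpan (a + 1) (b + 1) s z using 2
    push_cast; omega
  · rw [← hw]; exact tri_mem_triSpan a b (s + 1) z

theorem radius_pow_mul_mem_triSpan {d : ℤ} {z : Alg N r} (hz : IsHom d z) {w : ℤ}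
    {p : Alg (N + 2) r} (hp : p ∈ triSpan w z) (k : ℕ) :
    radius (N + 2) r ^ k * p ∈ triSpan w z := by
  induction k with
  | zero => simpa using hp
  | succ k ih => rw [pow_succ', mul_assoc]; exact radius_mul_mem_triSpan hz ih

theorem tPoly_mul_emb_mem_triSpan {l : ℕ} {h : Alg N r} (hh : IsHom l h) (hN : 2 ≤ N + 2)
    (a b : ℕ) : tPoly hN r (a + b + l) a b * emb N r h ∈ triSpan ((a : ℤ) - b) h := by
  rw [tPoly_mul_emb hh]
  refine Submodule.sum_mem _ fun k hk => Submodule.smul_mem _ _ ?_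
  rw [mem_range] at hk
  refine radius_pow_mul_mem_triSpan hh ?_ k
  have := tri_mem_triSpan (a - k) (b - k) 0 h
  rw [pow_zero, one_mul] at this
  convert this using 2
  omega

theorem xf_pow_mul_mem_triSpan {w : ℤ} {z : Alg N r} {p : Alg (N + 2) r} (hp : p ∈ triSpan w z)
    (k : ℕ) : xf N r ^ k * p ∈ triSpan (k + w) z := by
  induction k with
  | zero => simpa using hp
  | succ k ih =>
    rw [pow_succ', mul_assoc]
    refine map_mem_triSpan (LinearMap.mulLeft ℂ (xf N r)) (fun a b s hw => ?_) ih
    rw [LinearMap.mulLeft_apply, xf_mul_tri]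
    convert tri_mem_triSpan (a + 1) b s z using 2
    push_cast; omega

theorem xl_pow_mul_mem_triSpan {d : ℤ} {w : ℤ} {z : Alg N r} (hz : IsHom d z)
    {p : Alg (N + 2) r} (hp : p ∈ triSpan w z) (k : ℕ) :
    xl N r ^ k * p ∈ triSpan (-k + w) z := by
  induction k with
  | zero => simpa using hp
  | succ k ih =>
    rw [pow_succ', mul_assoc]
    refine map_mem_triSpan (LinearMap.mulLeft ℂ (xl N r)) (fun a b s hw => ?_) ih
    rw [LinearMap.mulLeft_apply, xl_mul_tri, theta_inv_radius_pow_mul hz, map_smul, ← mul_assoc,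
      ← pow_succ']
    refine add_mem (Submodule.smul_mem _ _ ?_) ?_
    · convert tri_mem_triSpan a (b + 1) s z using 2
      push_cast; omega
    · rcases a with _ | a
      · simp
      · rw [Nat.add_sub_cancel]
        refine Submodule.smul_mem _ _ ?_
        convert tri_mem_triSpan a b (s + 1) z using 2
        push_cast at hw ⊢; omega

theorem radius_pow_central (s : ℕ) (p : Alg N r) : radius N r ^ s * p = p * radius N r ^ s :=
  (Commute.pow_left (radius_central N p) s).eq

theorem emb_mul_mem_triSpan {d : ℤ} {w : ℤ} {z g : Alg N r} (hg : IsHom d g)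
    {p : Alg (N + 2) r} (hp : p ∈ triSpan w z) : emb N r g * p ∈ triSpan w (g * z) := by
  have hθ : ∀ a : ℕ, theta N r ((r ^ 2)⁻¹ ^ a) g = ((r ^ 2) ^ (-d)) ^ a • g := by
    intro a
    induction a with
    | zero => simp [theta_one]
    | succ a ih => rw [theta_pow, ih, map_smul, hg.theta_inv, smul_smul, ← pow_succ]
  refine map_mem_triSpan (LinearMap.mulLeft ℂ (emb N r g)) (fun a b s hw => ?_) hp
  rw [LinearMap.mulLeft_apply, emb_mul_tri, hθ, smul_mul_assoc, map_smul, ← mul_assoc,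
    ← radius_pow_central, mul_assoc, ← hw]
  exact Submodule.smul_mem _ _ (tri_mem_triSpan a b s _)

/-- Multiply the right factor successively by `x_{1'} ^ b`, `z`, `Q' ^ s` and `x_1 ^ a`. Reordering
`x_{1'}` past `x_1` only creates powers of `Q'` and preserves the difference of the outer exponents.
-/
theorem mul_mem_triSpan {d e : ℤ} {w w' : ℤ} {z z' : Alg N r} (hz : IsHom d z) (hz' : IsHom e z')
    {p p' : Alg (N + 2) r} (hp : p ∈ triSpan w z) (hp' : p' ∈ triSpan w' z') :
    p * p' ∈ triSpan (w + w') (z * z') := by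
  refine map_mem_triSpan (LinearMap.mulRight ℂ p') (fun a b s hw => ?_) hp
  rw [LinearMap.mulRight_apply, tri_apply, map_mul, mul_assoc, mul_assoc, mul_assoc]
  have h1 := emb_mul_mem_triSpan hz (xl_pow_mul_mem_triSpan hz' hp' b)
  have h2 := xf_pow_mul_mem_triSpan (map_mem_triSpan (LinearMap.mulLeft ℂ (emb N r (radius N r ^ s)))
    (w' := -b + w') (z' := z * z') (fun a b t hw => by
      rw [LinearMap.mulLeft_apply, emb_mul_tri, map_pow, theta_radius, smul_pow, smul_mul_assoc,
        map_smul, ← mul_assoc, ← pow_add, ← hw]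
      exact Submodule.smul_mem _ _ (tri_mem_triSpan a b (s + t) _)) h1) a
  rw [← hw, show (a : ℤ) - b + w' = a + (-b + w') by ring]
  exact h2

variable {σ : ℂ →+* ℂ}

theorem st_radius (hσ : Fixes N r σ) : st hσ (radius N r) = radius N r := by
  rw [radius, st, map_sum, Finset.unop_sum]
  refine sum_congr rfl fun i _ => ?_
  change st hσ _ = _
  rw [st_smul, st_mul, st_x, st_x, hσ.rho, smul_mul_smul_comm, Fin.rev_rev, rhoTwo_rev,
    ← zpow_add₀ (r_ne r), add_neg_cancel, zpow_zero, one_smul]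

theorem st_mem_triSpan (hσ : Fixes (N + 2) r σ) {w : ℤ} {z : Alg N r} {p : Alg (N + 2) r}
    (hp : p ∈ triSpan w z) : st hσ p ∈ triSpan (-w) (st hσ.inner z) := by
  induction hp using Submodule.span_induction with
  | mem p hp =>
    obtain ⟨a, b, s, rfl, rfl⟩ := hp
    rw [st_tri, st_mul, st_pow, st_radius, ← radius_pow_central, neg_sub]
    exact Submodule.smul_mem _ _ (tri_mem_triSpan b a s _)
  | zero => rw [st_zero]; exact Submodule.zero_mem _
  | add p p' _ _ hp hp' => rw [st_add]; exact add_mem hp hp'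
  | smul c p _ hp => rw [st_smul]; exact Submodule.smul_mem _ _ hp

theorem haar_eq_zero_of_mem_triSpan {d w : ℤ} {z : Alg N r} (hz : IsHom d z)
    (h : w ≠ 0 ∨ ∀ s, haarRed N r (radius N r ^ s * z) = 0) {p : Alg (N + 2) r}
    (hp : p ∈ triSpan w z) : haar (N + 2) r p = 0 := by
  -- `haar_eq` wants a natural degree; in negative degree `z` is zero anyway.
  by_cases hd : d < 0
  · have : z = 0 := hz.eq_zero_of_neg hd
    subst this
    induction hp using Submodule.span_induction with
    | mem p hp => obtain ⟨a, b, s, -, rfl⟩ := hp; simp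
    | zero => exact map_zero _
    | add p p' _ _ hp hp' => rw [map_add, hp, hp', add_zero]
    | smul c p _ hp => rw [map_smul, hp, smul_zero]
  induction hp using Submodule.span_induction with
  | mem p hp =>
    obtain ⟨a, b, s, rfl, rfl⟩ := hp
    have hdeg := isHom_tri ((isHom_radius_pow s).mul hz) a b
    rw [haar_eq (d := a + b + (2 * s + d.toNat)) (by convert hdeg using 1; push_cast; omega),
      haarRed_tri]
    split_ifs with hab
    · rw [h.resolve_left (by rw [hab]; simp) s, mul_zero, mul_zero]
    · rw [mul_zero]
  | zero => exact map_zero _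
  | add p p' _ _ hp hp' => rw [map_add, hp, hp', add_zero]
  | smul c p _ hp => rw [map_smul, hp, smul_zero]

theorem haar_st_mul_eq_zero (hσ : Fixes (N + 2) r σ) (hinv : ∀ c, σ (σ c) = c)
    (hN : 2 ≤ N + 2) {m : ℕ} {p p' : ℕ × ℕ} (hp : p.1 + p.2 ≤ m) (hp' : p'.1 + p'.2 ≤ m)
    (hne : p ≠ p') {u v : Alg (N + 2) r} (hu : u ∈ summand hN r m p.1 p.2)
    (hv : v ∈ summand hN r m p'.1 p'.2) : haar (N + 2) r (st hσ u * v) = 0 := by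
  obtain ⟨h, h1, h2, rfl⟩ := (mem_summand hp hN).mp hu
  obtain ⟨h', h1', h2', rfl⟩ := (mem_summand hp' hN).mp hv
  refine haar_eq_zero_of_mem_triSpan ((isHom_st hσ.inner h1).mul h1') ?_
    (mul_mem_triSpan (isHom_st hσ.inner h1) h1'
      (st_mem_triSpan hσ (tPoly_mul_emb_mem_triSpan h1 hN _ _))
      (tPoly_mul_emb_mem_triSpan h1' hN _ _))
  -- Equal inner degrees mean equal sums `a + b`, so distinct pairs then differ in `a - b`.
  by_cases hl : m - p.1 - p.2 = m - p'.1 - p'.2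
  · left
    intro hw
    exact hne (Prod.ext (by omega) (by omega))
  · right
    exact haarRed_harmonic_mul_eq_zero hσ.inner hinv h1 h1' h2 h2' hl

end Orthogonality

end QEuclid

end

theorem proposition7 (N : ℕ) (hN : 2 ≤ N) (r : ℂ) (hr : r ≠ 0)
    (hq : ∀ k : ℕ, 0 < k → (r ^ 2) ^ k ≠ 1) (m : ℕ) :
    (iSupIndep fun p : {p : ℕ × ℕ // p.1 + p.2 ≤ m} =>
        QEuclid.summand hN r m p.1.1 p.1.2) ∧
    (⨆ p : {p : ℕ × ℕ // p.1 + p.2 ≤ m}, QEuclid.summand hN r m p.1.1 p.1.2) =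
      QEuclid.harm N r m ∧
    ∀ (σ : ℂ →+* ℂ) (hσ : QEuclid.Fixes N r σ),
      (σ = RingHom.id ℂ ∨ σ = starRingEnd ℂ) →
      ∀ p p' : {p : ℕ × ℕ // p.1 + p.2 ≤ m}, p ≠ p' →
        ∀ a ∈ QEuclid.summand hN r m p.1.1 p.1.2,
        ∀ b ∈ QEuclid.summand hN r m p'.1.1 p'.1.2,
          QEuclid.scalarProd N hr hσ a b = 0 := by
  -- The inner algebra is the one for `N - 2`, possibly with no variables at all.
  obtain ⟨N, rfl⟩ : ∃ M, N = M + 2 := ⟨N - 2, by omega⟩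
  have : QEuclid.Generic r := ⟨hr, hq⟩
  refine ⟨QEuclid.iSupIndep_summand hN m, le_antisymm
    (iSup_le fun p => QEuclid.summand_le_harm p.2 hN) (QEuclid.harm_le_iSup_summand hN m),
    fun σ hσ hid p p' hne a ha b hb => ?_⟩
  have hinv : ∀ c, σ (σ c) = c := by
    rcases hid with rfl | rfl
    · exact fun c => rfl
    · exact Complex.conj_conj
  exact QEuclid.haar_st_mul_eq_zero hσ hinv hN p.2 p'.2 (fun e => hne (Subtype.ext e)) ha hb
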